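/- **Setting.** Let $k$ be a field, $A$ and $U=A^*$ Hopf algebras over $k$ with a non-degenerate Hopf pairing $\langle\cdot,\cdot\rangle:U\times A\to k$, and let the antipode $S$ of $U$ be bijective. Write $u\triangleright a=a_{(1)}\langle u,a_{(2)}\rangle$, $a\triangleleft u=\langle u,a_{(1)}\rangle a_{(2)}$, $a\triangleright u=u_{(1)}\langle u_{(2)},a\rangle$ ($u\in U$, $a\in A$). Repeated indices, which run over a finite set, are summed. *Calculus.* Let $f^i_j\in U$ and $r^i_j\in A$ satisfy $\Delta f^i_j=f^i_l\otimes f^l_j$, $\Delta r^i_j=r^l_j\otimes r^i_l$, $\epsilon(f^i_j)=\epsilon(r^i_j)=\delta^i_j$ and $(f^j_i\triangleright a)\,r^i_l=r^j_i\,(a\triangleleft f^i_l)$ for all $a\in A$; they define a bicovariant $A$-bimodule with basis $\omega^i$, $\omega^ia=(f^i_j\triangleright a)\omega^j$, $\Delta_L\omega^i=1\otimes\omega^i$, $\Delta_R\omega^i=\omega^j\otimes r^i_j$. Let $\chi_i\in U$ be such that $da=(\chi_i\triangleright a)\,\omega^i$ is right covariant, $\Delta_R(da)=(d\otimes\mathrm{id})\Delta(a)$,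 and such that there are $a^j\in A$ with $\langle\chi_i,a^j\rangle=\delta^j_i$. Put $\sigma^{ij}_{ml}=\langle f^i_l,r^j_m\rangle$ and $C^l_{ij}=\langle\chi_j,r^l_i\rangle$, the braid matrix and structure constants of the quantum Lie algebra $\chi_i\chi_j-\sigma^{ml}_{ij}\chi_m\chi_l=C^l_{ij}\chi_l$. *Antisymmetrizers.* Tensors are multiplied as matrices whose rows are labelled by lower and whose columns are labelled by upper multi-indices; subscripts indicate the spaces in which they act. Let $\sigma_{m\leftarrow1}=\sigma_{m-1\,m}\cdots\sigma_{23}\sigma_{12}$, $A_{1\to1}=1$ and $A_{1\to n}=\bigl(1-\sum_{m=2}^n(-1)^m\sigma_{m\leftarrow1}\bigr)A_{2\to n}$. The height of $\sigma$ is the number $h$ with $A_{1\to h}\neq0$ and $A_{1\to n}=0$ for all $n>h$; assume that it exists. *Exterior algebras.* $\Gamma^\wedge$ is the algebra generated by $A$ and the $\omega^i$ with the relations of $A$, $\omega^ia=(f^i_j\triangleright a)\omega^j$, and $\omega^{j_1}\cdots\omega^{j_n}c_{j_1\dots j_n}=0$ whenever $A_{1\to n}c=0$. $\Gamma^{\wedge*}$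 is the algebra generated by $U$ and elements $\gamma_i$ with the relations of $U$, $\gamma_iu=(r^j_i\triangleright u)\gamma_j$, and $c^{i_1\dots i_n}\gamma_{i_1}\cdots\gamma_{i_n}=0$ whenever $cA_{1\to n}=0$. Let $d:\Gamma^\wedge\to\Gamma^\wedge$ be a $k$-linear map of degree $1$ which extends $da=(\chi_i\triangleright a)\omega^i$, obeys the graded Leibniz rule and satisfies $d^2=0$. *Heisenberg double.* $\Gamma^\wedge\rtimes\Gamma^{\wedge*}$ is the algebra generated by $\Gamma^\wedge$ and $\Gamma^{\wedge*}$ with the cross relations $ua=(u_{(1)}\triangleright a)u_{(2)}$, $u\,\omega^j=\omega^l\langle u_{(1)},r^j_l\rangle u_{(2)}$, $\gamma_ia=a\gamma_i$, $\gamma_i\omega^j=-\omega^j\gamma_i+f^j_i$. It is graded by $\deg\omega^i=1$, $\deg\gamma_i=-1$, $\deg A=\deg U=0$. An element $z$ of it is called bi-invariant if $\Delta_Lz=1\otimes z$, where $\Delta_L$ is the algebra map to $A\otimes(\Gamma^\wedge\rtimes\Gamma^{\wedge*})$ with $a\mapsto a_{(1)}\otimes a_{(2)}$, $\omega^i\mapsto1\otimes\omega^i$,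 $u\mapsto1\otimes u$, $\gamma_i\mapsto1\otimes\gamma_i$, and if $x_{(1)}\,z\,S(x_{(2)})=\epsilon(x)z$ for all $x\in U$. A *BRST operator* for $d$ is a bi-invariant element $Q$ of degree $1$ which generates $d$, that is $$d\eta=[Q,\eta]_\pm=Q\eta-(-1)^n\eta\,Q\qquad(\eta\in\Gamma^{(n)},\ n\ge0),$$ and which satisfies $Q^2=0$. **Proposition.** Put $\Omega^i=\omega^jS^{-1}(f^i_j)$. For tensors $X_r=X^{1\dots r}_{1\dots r+1}$ ($r\ge1$) put $$Q_{(r)}=\Omega^{i_{r+1}}\cdots\Omega^{i_1}\,X^{j_1\dots j_r}_{i_1\dots i_{r+1}}\,\gamma_{j_1}\cdots\gamma_{j_r},\qquad Q=\Omega^i\chi_i+\sum_{r=1}^{h-1}Q_{(r)},$$ and consider the recurrence $$A_{1\to r+1}\,X^{1\dots r}_{1\dots r+1}\,A_{1\to r}=A_{1\to r+1}\bigl((-1)^r\sigma_{r+1\leftarrow1}-1\bigr)X^{2\dots r}_{2\dots r+1}\,A_{2\to r}\qquad(r\ge2)$$ with the initial condition $A_{12}X^{0}_{12}=-C^{0}_{12}$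 for $r=1$ (that is, $A_{1\to2}X_1=-C$). Then: 1. there are tensors $X_r$ that satisfy the recurrence and the initial condition; 2. the elements $Q_{(r)}$, and hence $Q$, do not depend on the choice of such tensors; 3. for all such tensors $Q$ is a BRST operator for $d$: it is bi-invariant, has degree $1$, generates $d$ and satisfies $Q^2=0$; 4. conversely, if an element $Q$ of the above form, for some tensors $X_r$, generates $d$, then the tensors satisfy the recurrence and the initial condition. -/

import Mathlib

open scoped TensorProduct Matrix

noncomputable section

namespace QuantumBRST

universe u v w x

/-! ### Tensors, the braid matrix and its antisymmetrizers

A tensor with lower (incoming) indices `i₁ … iₘ` and upper (outcoming) indices `j₁ … jₙ` is a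
matrix with row index `(i₁, …, iₘ) : Fin m → ι` and column index `(j₁, …, jₙ) : Fin n → ι`;
consecutive contraction of upper with lower indices is the matrix product. -/

section Tensors

variable {k : Type u} [Field k] {ι : Type x} [Fintype ι] [DecidableEq ι]

/-- `1 ⊗ M`: the tensor `M` shifted by one space, with the identity in the first space. -/
def shift {m n : ℕ} (M : Matrix (Fin m → ι) (Fin n → ι) k) :
    Matrix (Fin (m + 1) → ι) (Fin (n + 1) → ι) k :=
  Matrix.of fun I J => if I 0 = J 0 then M (Fin.tail I) (Fin.tail J) else 0

/-- The operator `σ_{p, p+1}` on `n` spaces (`1 ≤ p < n`), where `σ (i, j) (m, l) = σ^{ml}_{ij}`.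
Spaces are numbered from `1`; positions in `Fin n` are numbered from `0`.
(Outside the range `1 ≤ p < n` the value is the identity; it is never used.) -/
def braidAt (σ : Matrix (ι × ι) (ι × ι) k) (n p : ℕ) : Matrix (Fin n → ι) (Fin n → ι) k :=
  if h : 1 ≤ p ∧ p < n then
    Matrix.of fun I J =>
      if ∀ q : Fin n, (q : ℕ) ≠ p - 1 → (q : ℕ) ≠ p → I q = J q then
        σ (I ⟨p - 1, by omega⟩, I ⟨p, h.2⟩) (J ⟨p - 1, by omega⟩, J ⟨p, h.2⟩)
      else 0
  else 1

/-- `σ_{m ← 1} = σ_{m-1, m} ⋯ σ_{2 3} σ_{1 2}` on `n` spaces, for `1 ≤ m ≤ n`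
(so that `σ_{1 ← 1} = 1`). -/
def braidChain (σ : Matrix (ι × ι) (ι × ι) k) (n : ℕ) : ℕ → Matrix (Fin n → ι) (Fin n → ι) k
  | 0 => 1
  | 1 => 1
  | m + 2 => braidAt σ n (m + 1) * braidChain σ n (m + 1)

/-- The antisymmetrizer `A_{1 → n}` of the braid matrix `σ`:
`A_{1 → n} = (1 - ∑_{m=2}^{n} (-1)^m σ_{m ← 1}) A_{2 → n}`. -/
def antisymmetrizer (σ : Matrix (ι × ι) (ι × ι) k) : (n : ℕ) → Matrix (Fin n → ι) (Fin n → ι) k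
  | 0 => 1
  | n + 1 =>
    (1 - ∑ m ∈ Finset.Icc 2 (n + 1), (-1 : k) ^ m • braidChain σ (n + 1) m) *
      shift (antisymmetrizer σ n)

/-- `h` is the height of `σ`: the sequence of antisymmetrizers vanishes exactly from step `h + 1`
on. -/
def IsHeight (σ : Matrix (ι × ι) (ι × ι) k) (h : ℕ) : Prop :=
  antisymmetrizer σ h ≠ 0 ∧ ∀ n, h < n → antisymmetrizer σ n = 0

end Tensors

/-! ### Dual Hopf algebras -/

section Pairing

variable (k : Type u) [Field k] (A : Type v) [Ring A] [HopfAlgebra k A]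
  (U : Type w) [Ring U] [HopfAlgebra k U]

/-- A non-degenerate pairing `⟨u, a⟩` which makes the Hopf algebra `U` a Hopf dual `A*` of the
Hopf algebra `A`. -/
structure HopfDuality where
  pair : U →ₗ[k] A →ₗ[k] k
  mul_left : ∀ u v a, pair (u * v) a =
    LinearMap.mul' k k (TensorProduct.map (pair u) (pair v) (Coalgebra.comul a))
  mul_right : ∀ u a b, pair u (a * b) =
    LinearMap.mul' k k (TensorProduct.map (pair.flip a) (pair.flip b) (Coalgebra.comul u))
  one_left : ∀ a, pair 1 a = Coalgebra.counit a
  one_right : ∀ u, pair u 1 = Coalgebra.counit u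
  nondegenerate : pair.Nondegenerate

variable {k A U}

namespace HopfDuality

variable (P : HopfDuality k A U)

/-- The left action `u ▷ a = a₍₁₎ ⟨u, a₍₂₎⟩` of `U` on `A`. -/
def lact : U →ₗ[k] A →ₗ[k] A :=
  LinearMap.mk₂ k
    (fun u a => TensorProduct.rid k A ((P.pair u).lTensor A (Coalgebra.comul a)))
    (fun u v a => by simp [LinearMap.lTensor_add])
    (fun c u a => by simp [LinearMap.lTensor_smul])
    (fun u a b => by simp)
    (fun c u a => by simp)

/-- The right action `a ◁ u = ⟨u, a₍₁₎⟩ a₍₂₎` of `U` on `A`. -/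
def ract (a : A) (u : U) : A :=
  TensorProduct.lid k A ((P.pair u).rTensor A (Coalgebra.comul a))

/-- The left action `a ▷ u = u₍₁₎ ⟨u₍₂₎, a⟩` of `A` on `U`. -/
def dualLact (a : A) (u : U) : U :=
  TensorProduct.rid k U ((P.pair.flip a).lTensor U (Coalgebra.comul u))

/-- The right action `u ◁ a = ⟨u₍₁₎, a⟩ u₍₂₎` of `A` on `U`. -/
def dualRact (u : U) (a : A) : U :=
  TensorProduct.lid k U ((P.pair.flip a).rTensor U (Coalgebra.comul u))

theorem comul_lact (u : U) (a : A) :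
    Coalgebra.comul (R := k) (P.lact u a) = (P.lact u).lTensor A (Coalgebra.comul a) := by
  have h1 : ∀ (y : A) (s : A ⊗[k] A),
      LinearMap.lTensor A ((TensorProduct.rid k A).toLinearMap ∘ₗ (P.pair u).lTensor A)
        (TensorProduct.assoc k A A A (s ⊗ₜ y)) = P.pair u y • s := by
    intro y s
    induction s with
    | zero => simp
    | add s t hs ht => simp only [TensorProduct.add_tmul, map_add, hs, ht, smul_add]
    | tmul a b => simp
  have h2 : ∀ t : A ⊗[k] A,
      LinearMap.lTensor A ((TensorProduct.rid k A).toLinearMap ∘ₗ (P.pair u).lTensor A)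
        (TensorProduct.assoc k A A A ((Coalgebra.comul (R := k)).rTensor A t)) =
      Coalgebra.comul (R := k) (TensorProduct.rid k A ((P.pair u).lTensor A t)) := by
    intro t
    induction t with
    | zero => simp
    | add s t hs ht => simp only [map_add, hs, ht]
    | tmul a b => simp [h1]
  have h3 : P.lact u = ((TensorProduct.rid k A).toLinearMap ∘ₗ (P.pair u).lTensor A) ∘ₗ
      Coalgebra.comul (R := k) := by
    ext a
    rfl
  rw [h3, LinearMap.lTensor_comp]
  simp only [LinearMap.comp_apply, LinearEquiv.coe_coe]
  rw [← Coalgebra.coassoc_apply, h2]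

end HopfDuality

end Pairing

/-! ### Bicovariant bimodules and first order calculi -/

section Calculus

variable {k : Type u} [Field k] {A : Type v} [Ring A] [HopfAlgebra k A]
  {U : Type w} [Ring U] [HopfAlgebra k U]

/-- A bicovariant bimodule `Γ⁽¹⁾` over `A` with a finite left-invariant basis `ωⁱ`, given by its
structure elements `f i j = fⁱⱼ ∈ U` and `r i j = rⁱⱼ ∈ A`: the bimodule structure is
`ωⁱ a = (fⁱⱼ ▷ a) ωʲ`, the coactions are `Δ_L ωⁱ = 1 ⊗ ωⁱ` and `Δ_R ωⁱ = ωʲ ⊗ rⁱⱼ`. -/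
structure BicovariantBimodule (P : HopfDuality k A U) (ι : Type x) [Fintype ι] [DecidableEq ι] where
  f : ι → ι → U
  r : ι → ι → A
  comul_f : ∀ i j, Coalgebra.comul (R := k) (f i j) = ∑ l, f i l ⊗ₜ[k] f l j
  counit_f : ∀ i j, Coalgebra.counit (R := k) (f i j) = if i = j then 1 else 0
  comul_r : ∀ i j, Coalgebra.comul (R := k) (r i j) = ∑ l, r l j ⊗ₜ[k] r i l
  counit_r : ∀ i j, Coalgebra.counit (R := k) (r i j) = if i = j then 1 else 0
  compat : ∀ (j l : ι) (a : A), ∑ i, P.lact (f j i) a * r i l = ∑ i, r j i * P.ract a (f i l)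

/-- A bicovariant first order differential calculus `d a = (χᵢ ▷ a) ωⁱ` on `A` with vector fields
`χᵢ ∈ U`. -/
structure BicovariantCalculus (P : HopfDuality k A U) (ι : Type x) [Fintype ι] [DecidableEq ι]
    extends BicovariantBimodule P ι where
  χ : ι → U
  /-- Right covariance `Δ_R (d a) = (d ⊗ id) Δ a`, where `Δ_R (a ωⁱ) = Δ(a) (ωʲ ⊗ rⁱⱼ)`, written
  out in the left-invariant basis. (Left covariance is automatic for `d a = (χᵢ ▷ a) ωⁱ`.) -/
  right_covariant : ∀ (j : ι) (a : A),
    ∑ i, Coalgebra.comul (R := k) (P.lact (χ i) a) * ((1 : A) ⊗ₜ[k] r i j) =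
      (P.lact (χ j)).rTensor A (Coalgebra.comul a)
  /-- There are `aʲ ∈ A` with `⟨χᵢ, aʲ⟩ = δⁱⱼ`. -/
  exists_dual : ∃ e : ι → A, ∀ i j, P.pair (χ i) (e j) = if i = j then 1 else 0

variable {P : HopfDuality k A U} {ι : Type x} [Fintype ι] [DecidableEq ι]

/-- The braid matrix `σ^{ij}_{ml} = ⟨fⁱₗ, rʲₘ⟩`. -/
def BicovariantBimodule.σ (B : BicovariantBimodule P ι) : Matrix (ι × ι) (ι × ι) k :=
  Matrix.of fun ml ij => P.pair (B.f ij.1 ml.2) (B.r ij.2 ml.1)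

/-- The structure constants `C^l_{ij} = ⟨χⱼ, rˡᵢ⟩` of the quantum Lie algebra
`χᵢ χⱼ - σ^{ml}_{ij} χₘ χₗ = C^l_{ij} χₗ`, as a tensor with two lower and one upper index. -/
def BicovariantCalculus.C (B : BicovariantCalculus P ι) : Matrix (Fin 2 → ι) (Fin 1 → ι) k :=
  Matrix.of fun I J => P.pair (B.χ (I 1)) (B.r (J 0) (I 0))

/-- The product `x_{I 0} x_{I 1} ⋯ x_{I (n-1)}`. -/
def word {κ R : Type*} [Monoid R] (x : κ → R) {n : ℕ} (I : Fin n → κ) : R :=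
  (List.ofFn fun p => x (I p)).prod

theorem map_word {R S F : Type*} [Monoid R] [Monoid S] [FunLike F R S] [MonoidHomClass F R S]
    (φ : F) {κ : Type*} (x : κ → R) {n : ℕ} (I : Fin n → κ) :
    φ (word x I) = word (fun i => φ (x i)) I := by
  simp [word, map_list_prod, List.map_ofFn, Function.comp_def]

/-- The product `x_{I (n-1)} ⋯ x_{I 1} x_{I 0}`. -/
def revWord {κ R : Type*} [Monoid R] (x : κ → R) {n : ℕ} (I : Fin n → κ) : R :=
  (List.ofFn fun p => x (I p)).reverse.prod

/-! ### The exterior algebra `Γ^∧` -/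

namespace BicovariantBimodule

variable (B : BicovariantBimodule P ι)

/-- Generators of `Γ^∧`: elements of `A` and the forms `ωⁱ`. -/
abbrev ExtGen (k : Type u) [Field k] (A : Type v) [Ring A] [HopfAlgebra k A] (ι : Type x) :=
  TensorAlgebra k (A × (ι → k))

/-- An element of `A` as a generator. -/
def ExtGen.a : A →ₗ[k] ExtGen k A ι := TensorAlgebra.ι k ∘ₗ LinearMap.inl k A (ι → k)

/-- The generator `ωⁱ`. -/
def ExtGen.ω (i : ι) : ExtGen k A ι := TensorAlgebra.ι k ((0 : A), (Pi.single i 1 : ι → k))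

/-- The relations of `Γ^∧`: those of `A`, the bimodule relations `ωⁱ a = (fⁱⱼ ▷ a) ωʲ`, and the
relations of the covariant exterior product `ω ∧ ⋯ ∧ ω = (ω ⊗ ⋯ ⊗ ω) A_{1 → n}`: a combination
`ω^{j₁} ∧ ⋯ ∧ ω^{jₙ} c_{j₁ … jₙ}` vanishes when `A_{1 → n} c = 0`. -/
inductive ExtRel : ExtGen k A ι → ExtGen k A ι → Prop
  | one : ExtRel (ExtGen.a 1) 1
  | mul (a b : A) : ExtRel (ExtGen.a (a * b)) (ExtGen.a a * ExtGen.a b)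
  | bimodule (i : ι) (a : A) :
      ExtRel (ExtGen.ω i * ExtGen.a a) (∑ j, ExtGen.a (P.lact (B.f i j) a) * ExtGen.ω j)
  | wedge (n : ℕ) (c : (Fin n → ι) → k) (hc : antisymmetrizer B.σ n *ᵥ c = 0) :
      ExtRel (∑ J, c J • word ExtGen.ω J) 0

/-- The exterior algebra `Γ^∧ = A ⊕ Γ⁽¹⁾ ⊕ Γ⁽²⁾ ⊕ ⋯` of the bicovariant bimodule. -/
def Ext : Type _ := RingQuot B.ExtRel

instance : Ring B.Ext := inferInstanceAs (Ring (RingQuot B.ExtRel))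
instance : Algebra k B.Ext := inferInstanceAs (Algebra k (RingQuot B.ExtRel))

/-- The quotient map onto `Γ^∧`. -/
def extMk : ExtGen k A ι →ₐ[k] B.Ext := RingQuot.mkAlgHom k B.ExtRel

theorem extMk_rel {x y : ExtGen k A ι} (h : B.ExtRel x y) : B.extMk x = B.extMk y :=
  RingQuot.mkAlgHom_rel k h

/-- The inclusion of `A = Γ⁽⁰⁾` in `Γ^∧`. -/
def extA : A →ₐ[k] B.Ext :=
  AlgHom.ofLinearMap (B.extMk.toLinearMap ∘ₗ ExtGen.a)
    (by simpa using B.extMk_rel ExtRel.one)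
    (fun a b => by simpa using B.extMk_rel (ExtRel.mul a b))

/-- The left-invariant 1-form `ωⁱ ∈ Γ^∧`. -/
def extω (i : ι) : B.Ext := B.extMk (ExtGen.ω i)

/-- The space `Γ⁽ⁿ⁾` of forms of degree `n`. -/
def extDeg (n : ℕ) : Submodule k B.Ext :=
  Submodule.span k
    (Set.range fun aI : A × (Fin n → ι) => B.extA aI.1 * word B.extω aI.2)

/-! ### The dual exterior algebra `Γ^∧*` -/

/-- The relations of `Γ^∧*`: those of `U`, the bimodule relations `γᵢ u = (rʲᵢ ▷ u) γⱼ`, and the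
relations of the exterior product `γ ∧ ⋯ ∧ γ = A_{1 → n} (γ ⊗ ⋯ ⊗ γ)`: a combination
`c^{i₁ … iₙ} γ_{i₁} ∧ ⋯ ∧ γ_{iₙ}` vanishes when `c A_{1 → n} = 0`. The generators are elements of
`U` (written `ExtGen.a`) and the `γᵢ` (written `ExtGen.ω`). -/
inductive DualRel : ExtGen k U ι → ExtGen k U ι → Prop
  | one : DualRel (ExtGen.a 1) 1
  | mul (u v : U) : DualRel (ExtGen.a (u * v)) (ExtGen.a u * ExtGen.a v)
  | bimodule (i : ι) (u : U) :
      DualRel (ExtGen.ω i * ExtGen.a u) (∑ j, ExtGen.a (P.dualLact (B.r j i) u) * ExtGen.ω j)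
  | wedge (n : ℕ) (c : (Fin n → ι) → k) (hc : c ᵥ* antisymmetrizer B.σ n = 0) :
      DualRel (∑ I, c I • word ExtGen.ω I) 0

/-- The exterior algebra `Γ^∧*` over `U = A*`. -/
def DualExt : Type _ := RingQuot B.DualRel

instance : Ring B.DualExt := inferInstanceAs (Ring (RingQuot B.DualRel))
instance : Algebra k B.DualExt := inferInstanceAs (Algebra k (RingQuot B.DualRel))

/-- The quotient map onto `Γ^∧*`. -/
def dualMk : ExtGen k U ι →ₐ[k] B.DualExt := RingQuot.mkAlgHom k B.DualRel

theorem dualMk_rel {x y : ExtGen k U ι} (h : B.DualRel x y) : B.dualMk x = B.dualMk y :=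
  RingQuot.mkAlgHom_rel k h

/-- The inclusion of `U` in `Γ^∧*`. -/
def dualU : U →ₐ[k] B.DualExt :=
  AlgHom.ofLinearMap (B.dualMk.toLinearMap ∘ₗ ExtGen.a)
    (by simpa using B.dualMk_rel DualRel.one)
    (fun a b => by simpa using B.dualMk_rel (DualRel.mul a b))

/-- The element `γᵢ ∈ Γ^∧*`. -/
def dualγ (i : ι) : B.DualExt := B.dualMk (ExtGen.ω i)

/-! ### The Heisenberg double `Γ^∧ ⋊ Γ^∧*` -/

/-- Generators of the Heisenberg double: elements of `Γ^∧` and of `Γ^∧*`. -/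
abbrev HGen := TensorAlgebra k (B.Ext × B.DualExt)

/-- An element of `Γ^∧` as a generator. -/
def hgenL : B.Ext →ₗ[k] B.HGen := TensorAlgebra.ι k ∘ₗ LinearMap.inl k B.Ext B.DualExt

/-- An element of `Γ^∧*` as a generator. -/
def hgenR : B.DualExt →ₗ[k] B.HGen := TensorAlgebra.ι k ∘ₗ LinearMap.inr k B.Ext B.DualExt

/-- The relations of the Heisenberg double: those of `Γ^∧` and `Γ^∧*`, and the graded
cross-multiplication rule
`γ ω = (-1)^{|γ₍₁₎||ω₍₁₎| + |γ₍₂₎||ω|} ω₍₁₎ ⟨γ₍₁₎, ω₍₂₎⟩ γ₍₂₎`, which is imposed for `γ` and `ω`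
running through the generators `u ∈ U`, `γᵢ` and `a ∈ A`, `ωʲ`, and by associativity then holds
everywhere. The comultiplications are those of `U` and `A` and
`Δ γᵢ = 1 ⊗ γᵢ + γⱼ ⊗ fʲᵢ`, `Δ ωʲ = 1 ⊗ ωʲ + ωˡ ⊗ rʲₗ`; the pairing is graded with
`⟨γᵢ, ωʲ⟩ = δʲᵢ`. -/
inductive HRel : B.HGen → B.HGen → Prop
  | one_left : HRel (B.hgenL 1) 1
  | mul_left (x y : B.Ext) : HRel (B.hgenL (x * y)) (B.hgenL x * B.hgenL y)
  | one_right : HRel (B.hgenR 1) 1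
  | mul_right (x y : B.DualExt) : HRel (B.hgenR (x * y)) (B.hgenR x * B.hgenR y)
  /-- `u a = (u₍₁₎ ▷ a) u₍₂₎` -/
  | u_a (u : U) (a : A) :
      HRel (B.hgenR (B.dualU u) * B.hgenL (B.extA a))
        (LinearMap.mul' k B.HGen
          (TensorProduct.map (B.hgenL ∘ₗ B.extA.toLinearMap ∘ₗ P.lact.flip a)
            (B.hgenR ∘ₗ B.dualU.toLinearMap) (Coalgebra.comul u)))
  /-- `u ωʲ = ωˡ ⟨u₍₁₎, rʲₗ⟩ u₍₂₎` -/
  | u_ω (u : U) (j : ι) :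
      HRel (B.hgenR (B.dualU u) * B.hgenL (B.extω j))
        (∑ l, B.hgenL (B.extω l) * B.hgenR (B.dualU (P.dualRact u (B.r j l))))
  /-- `γᵢ a = a γᵢ` -/
  | γ_a (i : ι) (a : A) :
      HRel (B.hgenR (B.dualγ i) * B.hgenL (B.extA a)) (B.hgenL (B.extA a) * B.hgenR (B.dualγ i))
  /-- `γᵢ ωʲ = - ωʲ γᵢ + fʲᵢ` -/
  | γ_ω (i j : ι) :
      HRel (B.hgenR (B.dualγ i) * B.hgenL (B.extω j))
        (-(B.hgenL (B.extω j) * B.hgenR (B.dualγ i)) + B.hgenR (B.dualU (B.f j i)))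

/-- The Heisenberg double `Γ^∧ ⋊ Γ^∧*`. -/
def Heis : Type _ := RingQuot B.HRel

instance : Ring B.Heis := inferInstanceAs (Ring (RingQuot B.HRel))
instance : Algebra k B.Heis := inferInstanceAs (Algebra k (RingQuot B.HRel))

/-- The quotient map onto the Heisenberg double. -/
def heisMk : B.HGen →ₐ[k] B.Heis := RingQuot.mkAlgHom k B.HRel

theorem heisMk_rel {x y : B.HGen} (h : B.HRel x y) : B.heisMk x = B.heisMk y :=
  RingQuot.mkAlgHom_rel k h

/-- The algebra `Γ^∧` in the Heisenberg double. -/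
def form : B.Ext →ₐ[k] B.Heis :=
  AlgHom.ofLinearMap (B.heisMk.toLinearMap ∘ₗ B.hgenL)
    (by simpa using B.heisMk_rel HRel.one_left)
    (fun x y => by simpa using B.heisMk_rel (HRel.mul_left x y))

/-- The algebra `Γ^∧*` in the Heisenberg double. -/
def dual : B.DualExt →ₐ[k] B.Heis :=
  AlgHom.ofLinearMap (B.heisMk.toLinearMap ∘ₗ B.hgenR)
    (by simpa using B.heisMk_rel HRel.one_right)
    (fun x y => by simpa using B.heisMk_rel (HRel.mul_right x y))

/-- `a ∈ A` in the Heisenberg double. -/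
def hA (a : A) : B.Heis := B.form (B.extA a)
/-- `ωⁱ` in the Heisenberg double. -/
def hω (i : ι) : B.Heis := B.form (B.extω i)
/-- `u ∈ U` in the Heisenberg double. -/
def hU (u : U) : B.Heis := B.dual (B.dualU u)
/-- `γᵢ` in the Heisenberg double. -/
def hγ (i : ι) : B.Heis := B.dual (B.dualγ i)

/-- The grading of the Heisenberg double: `deg ωⁱ = 1`, `deg γᵢ = -1`, `deg a = deg u = 0`. -/
def heisDeg (z : ℤ) : Submodule k B.Heis :=
  Submodule.span k {y | ∃ (m n : ℕ) (a : A) (I : Fin m → ι) (J : Fin n → ι) (u : U),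
    (m : ℤ) - n = z ∧ y = B.hA a * word B.hω I * word B.hγ J * B.hU u}

/-- The elements `Ωⁱ = ωʲ S⁻¹(fⁱⱼ)`, for the inverse `S⁻¹` of a bijective antipode of `U`. -/
def Ω (hS : Function.Bijective (HopfAlgebra.antipode k (A := U))) (i : ι) : B.Heis :=
  ∑ j, B.hω j * B.hU ((LinearEquiv.ofBijective _ hS).symm (B.f i j))

/-! ### Invariance -/


theorem extMk_a (a : A) : B.extMk (ExtGen.a a) = B.extA a := rfl

theorem extMk_ω (i : ι) : B.extMk (ExtGen.ω i) = B.extω i := rfl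

theorem extA_bimodule (i : ι) (a : A) :
    B.extω i * B.extA a = ∑ j, B.extA (P.lact (B.f i j) a) * B.extω j := by
  simpa [extMk_a, extMk_ω] using B.extMk_rel (ExtRel.bimodule i a)

theorem ext_wedge (n : ℕ) (c : (Fin n → ι) → k) (hc : antisymmetrizer B.σ n *ᵥ c = 0) :
    ∑ J, c J • word B.extω J = 0 := by
  simpa [map_word, extMk_ω] using B.extMk_rel (ExtRel.wedge n c hc)

/-- `Δ_L` on the generators of `Γ^∧`. -/
def extLeftGen : ExtGen k A ι →ₐ[k] A ⊗[k] B.Ext :=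
  TensorAlgebra.lift k
    (LinearMap.coprod
      ((B.extA.toLinearMap.lTensor A) ∘ₗ Coalgebra.comul (R := k))
      ((TensorProduct.mk k A B.Ext 1) ∘ₗ Fintype.linearCombination k B.extω))

theorem extLeftGen_a (a : A) :
    B.extLeftGen (ExtGen.a a) = B.extA.toLinearMap.lTensor A (Coalgebra.comul a) := by
  simp [extLeftGen, ExtGen.a]

theorem extLeftGen_ω (i : ι) : B.extLeftGen (ExtGen.ω i) = (1 : A) ⊗ₜ[k] B.extω i := by
  simp [extLeftGen, ExtGen.ω, Fintype.linearCombination_apply_single]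

/-- The left coaction `Δ_L : Γ^∧ → A ⊗ Γ^∧`: the algebra map with `Δ_L a = Δ a` and
`Δ_L ωⁱ = 1 ⊗ ωⁱ`. -/
def extLeftCoaction : B.Ext →ₐ[k] A ⊗[k] B.Ext :=
  RingQuot.liftAlgHom k ⟨B.extLeftGen, by
    intro x y h
    induction h with
    | one => simp [extLeftGen_a, Algebra.TensorProduct.one_def]
    | mul a b =>
      simp only [map_mul, extLeftGen_a, Bialgebra.comul_mul]
      exact map_mul (Algebra.TensorProduct.map (AlgHom.id k A) B.extA) _ _
    | bimodule i a =>
      simp only [map_mul, map_sum, extLeftGen_a, extLeftGen_ω, P.comul_lact]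
      generalize Coalgebra.comul (R := k) a = t
      induction t with
      | zero => simp
      | add s t hs ht => simp only [map_add, mul_add, add_mul, hs, ht, Finset.sum_add_distrib]
      | tmul a b => simp [extA_bimodule, TensorProduct.tmul_sum]
    | wedge n c hc =>
      have h : (Algebra.TensorProduct.includeRight : B.Ext →ₐ[k] A ⊗[k] B.Ext)
          (∑ J, c J • word B.extω J) = 0 := by rw [B.ext_wedge n c hc, map_zero]
      simpa [map_word, extLeftGen_ω] using h⟩

theorem extLeftCoaction_a (a : A) :
    B.extLeftCoaction (B.extA a) = B.extA.toLinearMap.lTensor A (Coalgebra.comul a) := by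
  rw [← extLeftGen_a]
  exact RingQuot.liftAlgHom_mkAlgHom_apply k _ _ _

theorem extLeftCoaction_ω (i : ι) :
    B.extLeftCoaction (B.extω i) = (1 : A) ⊗ₜ[k] B.extω i := by
  rw [← extLeftGen_ω]
  exact RingQuot.liftAlgHom_mkAlgHom_apply k _ _ _

/-- `Δ_L` on the generators of the Heisenberg double. -/
def heisLeftGen : B.HGen →ₐ[k] A ⊗[k] B.Heis :=
  TensorAlgebra.lift k
    (LinearMap.coprod
      ((B.form.toLinearMap.lTensor A) ∘ₗ B.extLeftCoaction.toLinearMap)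
      ((TensorProduct.mk k A B.Heis 1) ∘ₗ B.dual.toLinearMap))

theorem heisLeftGen_L (x : B.Ext) :
    B.heisLeftGen (B.hgenL x) = B.form.toLinearMap.lTensor A (B.extLeftCoaction x) := by
  simp [heisLeftGen, hgenL]

theorem heisLeftGen_R (y : B.DualExt) :
    B.heisLeftGen (B.hgenR y) = (1 : A) ⊗ₜ[k] B.dual y := by
  simp [heisLeftGen, hgenR]

theorem heisLeftGen_a (a : A) :
    B.heisLeftGen (B.hgenL (B.extA a)) =
      (B.form.toLinearMap ∘ₗ B.extA.toLinearMap).lTensor A (Coalgebra.comul a) := by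
  rw [heisLeftGen_L, extLeftCoaction_a, LinearMap.lTensor_comp, LinearMap.comp_apply]

theorem heisLeftGen_ω (i : ι) :
    B.heisLeftGen (B.hgenL (B.extω i)) = (1 : A) ⊗ₜ[k] B.hω i := by
  simp [heisLeftGen_L, extLeftCoaction_ω, hω]

theorem heis_u_a (u : U) (a : A) :
    B.hU u * B.hA a = LinearMap.mul' k B.Heis
      (TensorProduct.map (B.form.toLinearMap ∘ₗ B.extA.toLinearMap ∘ₗ P.lact.flip a)
        (B.dual.toLinearMap ∘ₗ B.dualU.toLinearMap) (Coalgebra.comul u)) := by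
  have h := B.heisMk_rel (HRel.u_a u a)
  rw [map_mul] at h
  refine h.trans ?_
  generalize Coalgebra.comul (R := k) u = t
  induction t with
  | zero => simp
  | add s t hs ht => simp only [map_add, hs, ht]
  | tmul x y => simp [form, dual]

/-- The left coaction `Δ_L : Γ^∧ ⋊ Γ^∧* → A ⊗ (Γ^∧ ⋊ Γ^∧*)` of `A`: the algebra map which is
`Δ_L` on `Γ^∧` and `y ↦ 1 ⊗ y` on `Γ^∧*`. -/
def leftCoaction : B.Heis →ₐ[k] A ⊗[k] B.Heis :=
  RingQuot.liftAlgHom k ⟨B.heisLeftGen, by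
    intro x y h
    induction h with
    | one_left => simp [heisLeftGen_L, Algebra.TensorProduct.one_def]
    | mul_left x y =>
      simp only [map_mul, heisLeftGen_L]
      exact map_mul (Algebra.TensorProduct.map (AlgHom.id k A) B.form) _ _
    | one_right => simp [heisLeftGen_R, Algebra.TensorProduct.one_def]
    | mul_right x y => simp [heisLeftGen_R]
    | u_a u a =>
      have h1 : ∀ t : A ⊗[k] A,
          ((1 : A) ⊗ₜ[k] B.hU u) * (B.form.toLinearMap ∘ₗ B.extA.toLinearMap).lTensor A t =
            LinearMap.lTensor A (LinearMap.mulLeft k (B.hU u) ∘ₗ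
              B.form.toLinearMap ∘ₗ B.extA.toLinearMap) t := by
        intro t
        induction t with
        | zero => simp
        | add s t hs ht => simp only [map_add, mul_add, hs, ht]
        | tmul x y => simp
      let hAl : A →ₗ[k] B.Heis := B.form.toLinearMap ∘ₗ B.extA.toLinearMap
      let g : U ⊗[k] U →ₗ[k] A →ₗ[k] B.Heis := TensorProduct.lift (LinearMap.mk₂ k
        (fun x y => LinearMap.mulRight k (B.hU y) ∘ₗ hAl ∘ₗ P.lact x)
        (fun x x' y => by ext a; simp [add_mul])
        (fun c x y => by ext a; simp)
        (fun x y y' => by ext a; simp [hU, mul_add])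
        (fun c x y => by ext a; simp [hU]))
      have h2 : ∀ (y : A) (s : U ⊗[k] U), g s y = LinearMap.mul' k B.Heis
          (TensorProduct.map (B.form.toLinearMap ∘ₗ B.extA.toLinearMap ∘ₗ P.lact.flip y)
            (B.dual.toLinearMap ∘ₗ B.dualU.toLinearMap) s) := by
        intro y s
        induction s with
        | zero => simp
        | add s t hs ht => simp only [map_add, LinearMap.add_apply, hs, ht]
        | tmul x z => simp [g, hAl, hU]
      have h3 : LinearMap.mulLeft k (B.hU u) ∘ₗ hAl = g (Coalgebra.comul u) := by
        ext y
        rw [h2, ← heis_u_a]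
        rfl
      have h4 : ∀ (x y : U) (t : A ⊗[k] A),
          hAl.lTensor A ((P.lact x).lTensor A t) * ((1 : A) ⊗ₜ[k] B.hU y) =
            LinearMap.lTensor A (g (x ⊗ₜ y)) t := by
        intro x y t
        induction t with
        | zero => simp
        | add s t hs ht => simp only [map_add, add_mul, hs, ht]
        | tmul x y => simp [g]
      have h5 : ∀ s : U ⊗[k] U, B.heisLeftGen (LinearMap.mul' k B.HGen
          (TensorProduct.map (B.hgenL ∘ₗ B.extA.toLinearMap ∘ₗ P.lact.flip a)
            (B.hgenR ∘ₗ B.dualU.toLinearMap) s)) =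
              LinearMap.lTensor A (g s) (Coalgebra.comul a) := by
        intro s
        induction s with
        | zero => simp
        | add s t hs ht => simp only [map_add, hs, ht, LinearMap.lTensor_add, LinearMap.add_apply]
        | tmul x y =>
          rw [← h4, ← P.comul_lact]
          simp [heisLeftGen_a, heisLeftGen_R, hAl, hU]
      rw [h5, ← h3, map_mul, heisLeftGen_R, heisLeftGen_a]
      exact h1 _
    | u_ω u j =>
      have h := B.heisMk_rel (HRel.u_ω u j)
      simp only [map_mul, map_sum] at h
      change B.hU u * B.hω j = ∑ l, B.hω l * B.hU (P.dualRact u (B.r j l)) at h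
      simp only [map_mul, map_sum, heisLeftGen_R, heisLeftGen_ω,
        Algebra.TensorProduct.tmul_mul_tmul, one_mul, ← TensorProduct.tmul_sum]
      exact congrArg _ h
    | γ_a i a =>
      have h : ∀ y : A, B.hγ i * B.hA y = B.hA y * B.hγ i := fun y => by
        have h := B.heisMk_rel (HRel.γ_a i y)
        simp only [map_mul] at h
        exact h
      simp only [map_mul, heisLeftGen_R, heisLeftGen_a]
      generalize Coalgebra.comul (R := k) a = t
      induction t with
      | zero => simp
      | add s t hs ht => simp only [map_add, mul_add, add_mul, hs, ht]
      | tmul x y =>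
        simp only [LinearMap.lTensor_tmul, Algebra.TensorProduct.tmul_mul_tmul, one_mul, mul_one]
        exact congrArg _ (h y)
    | γ_ω i j =>
      have h := B.heisMk_rel (HRel.γ_ω i j)
      simp only [map_mul, map_add, map_neg] at h
      change B.hγ i * B.hω j = -(B.hω j * B.hγ i) + B.hU (B.f j i) at h
      simp only [map_mul, map_add, map_neg, heisLeftGen_R, heisLeftGen_ω,
        Algebra.TensorProduct.tmul_mul_tmul, one_mul, ← TensorProduct.tmul_neg,
        ← TensorProduct.tmul_add]
      exact congrArg _ h⟩

/-- The action `z ↦ x₍₁₎ z S(x₍₂₎)` of `x ∈ U` on the Heisenberg double, which is dual to the right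
coaction of `A`: `Δ_R z = (e^α₍₁₎ z S(e^α₍₂₎)) ⊗ e_α` for dual bases `e^α` of `U`, `e_α` of `A`. -/
def adjoint (x : U) (z : B.Heis) : B.Heis :=
  LinearMap.mul' k B.Heis
    (TensorProduct.map ((LinearMap.mulRight k z) ∘ₗ B.dual.toLinearMap ∘ₗ B.dualU.toLinearMap)
      (B.dual.toLinearMap ∘ₗ B.dualU.toLinearMap ∘ₗ HopfAlgebra.antipode k) (Coalgebra.comul x))

/-- Bi-invariant elements: `Δ_L z = 1 ⊗ z` and `Δ_R z = z ⊗ 1`, the latter paired with every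
`x ∈ U`. -/
def IsBiinvariant (z : B.Heis) : Prop :=
  B.leftCoaction z = (1 : A) ⊗ₜ[k] z ∧ ∀ x : U, B.adjoint x z = Coalgebra.counit (R := k) x • z

end BicovariantBimodule

/-! ### The differential and the BRST operator -/

namespace BicovariantCalculus

variable (B : BicovariantCalculus P ι)

/-- `d` is a differential on `Γ^∧`: it raises the degree by one, obeys the graded Leibniz rule,
squares to zero and extends `d a = (χᵢ ▷ a) ωⁱ`. -/
structure IsDifferential (d : B.Ext →ₗ[k] B.Ext) : Prop where
  map_deg : ∀ n, ∀ η ∈ B.extDeg n, d η ∈ B.extDeg (n + 1)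
  leibniz : ∀ n, ∀ η ∈ B.extDeg n, ∀ ζ, d (η * ζ) = d η * ζ + (-1 : k) ^ n • (η * d ζ)
  sq_zero : ∀ η, d (d η) = 0
  d_a : ∀ a, d (B.extA a) = ∑ i, B.extA (P.lact (B.χ i) a) * B.extω i

/-- `Q` generates `d`: `d η = [Q, η]_±` for all `η ∈ Γ^∧`, where the bracket is the graded
commutator with an element of degree one. -/
def Generates (d : B.Ext →ₗ[k] B.Ext) (Q : B.Heis) : Prop :=
  ∀ n, ∀ η ∈ B.extDeg n, B.form (d η) = Q * B.form η - (-1 : k) ^ n • (B.form η * Q)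

/-- A BRST operator for `d`: a bi-invariant element of the Heisenberg double of degree one which
generates `d` and squares to zero. -/
structure IsBRSTOperator (d : B.Ext →ₗ[k] B.Ext) (Q : B.Heis) : Prop where
  biinvariant : B.IsBiinvariant Q
  mem_deg : Q ∈ B.heisDeg 1
  generates : B.Generates d Q
  mul_self : Q * Q = 0

/-- The recurrence for the tensors `X r = X^{1 … r}_{1 … r+1}`, `r ≥ 1`:
`A_{1 → r+1} X^{1 … r}_{1 … r+1} A_{1 → r} =
  A_{1 → r+1} ((-1)^r σ_{r+1 ← 1} - 1) X^{2 … r}_{2 … r+1} A_{2 → r}` for `r = s + 1 ≥ 2`, with the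
initial condition `A_{12} X^{0}_{12} = - C^{0}_{12}` for `r = 1`. (The value `X 0` plays no role.) -/
structure IsBRSTTensor (X : (r : ℕ) → Matrix (Fin (r + 1) → ι) (Fin r → ι) k) : Prop where
  init : antisymmetrizer B.σ 2 * X 1 = -B.C
  recur : ∀ s, 1 ≤ s →
    antisymmetrizer B.σ (s + 2) * X (s + 1) * antisymmetrizer B.σ (s + 1) =
      antisymmetrizer B.σ (s + 2) * ((-1 : k) ^ (s + 1) • braidChain B.σ (s + 2) (s + 2) - 1) *
        shift (X s) * shift (antisymmetrizer B.σ s)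

/-- `Q_(r) = Ω^{i_{r+1}} ⋯ Ω^{i_1} X^{j_1 … j_r}_{i_1 … i_{r+1}} γ_{j_1} ⋯ γ_{j_r}`. -/
def Qr (hS : Function.Bijective (HopfAlgebra.antipode k (A := U)))
    (X : (r : ℕ) → Matrix (Fin (r + 1) → ι) (Fin r → ι) k) (r : ℕ) : B.Heis :=
  ∑ I, ∑ J, X r I J • (revWord (B.Ω hS) I * word B.hγ J)

/-- `Q = Ωⁱ χᵢ + ∑_{r=1}^{h-1} Q_(r)`. -/
def Q (hS : Function.Bijective (HopfAlgebra.antipode k (A := U))) (h : ℕ)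
    (X : (r : ℕ) → Matrix (Fin (r + 1) → ι) (Fin r → ι) k) : B.Heis :=
  ∑ i, B.Ω hS i * B.hU (B.χ i) + ∑ r ∈ Finset.Icc 1 (h - 1), B.Qr hS X r

end BicovariantCalculus

end Calculus

end QuantumBRST

end

noncomputable section

namespace QuantumBRST

set_option linter.unusedSectionVars false
set_option linter.unusedSimpArgs false

/-! ### Sums over multi-indices -/

section MultiIndex

variable {ι : Type*} [Fintype ι] {M : Type*} [AddCommMonoid M]

/-! The Heisenberg double is presented by generators and relations, so the proof first needs a test
for an element to vanish. This is the Fock representation: the algebra acts on `A`-valued functions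
on words, with `γᵢ` acting by `ψ ↦ ψ(i · )`, and the space is cut down to the functions `fockSub` on
which the wedge relations of the `γᵢ` hold. The map `vac` (action on the vacuum) kills `x γᵢ` and
sends `x u` to `ε(u)` times the image of `x`. The central computation is `vac_word_hγ_word_hω`: on
the vacuum, `γ_J ω^K` is `± A_{1→n}` at `(J, K)`. The antisymmetrizer is thus the Gram matrix of
`γ`-words against `ω`-words, and a form that vanishes on the vacuum vanishes by the relations of the
exterior product.

Each way of normal ordering a word contracts with a different one-step factor of `A_{1→n+1}`: `Bm`,
`Mm`, `Dm`, `Bm'`. The four factorizations are not derived by braid-word manipulation. The entries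
of the chains are pairings `⟨f, r⋯r⟩` and `⟨f⋯f, r⟩` (`Lch_apply`, `Rch_apply`), so a chain passes
through every tensor that intertwines the words in `r` or in `f`, and the compatibility of `f` and
`r` says that `σ` is such a tensor.

The elements `Ωⁱ` commute with `A`, and their reversed words satisfy the relations of the exterior
product (`rowKer_revWord_Ω`). Hence `Q_(r)` commutes with `A` and depends on `X_r` only through `A
X_r A`. Together with `Ωⁱ χᵢ`, which generates `d` on `A`, it remains to control the commutators
with `ωᵗ`. By `tensorElt_anticomm_hω`, the anticommutator of `Q_(r)` with `ωᵗ` has two pieces: a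
contraction with `r - 1` letters `γ`, and an uncontracted piece with `r` letters. The recurrence
says that the contraction in `Q_(r+1)` cancels the uncontracted piece of `Q_(r)`; above the height
nothing is left. The start is the Maurer-Cartan equation `dω = ωωD` with `A_{1→2} D = -C`, a
consequence of `d² a = 0`.

Existence: by a generalized inverse, `A X A = A V` is solvable for `X` once `A V` kills the kernel
of the right-hand `A`. A vector `c` in this kernel gives `∑ c_K ω^K = 0`, so that both `Q` and `d`
applied to it vanish, and the difference of the two is exactly `A V c` (`mulVec_rest_eq_zero`).
Uniqueness: the right-hand side of the recurrence is a function of `A X_s A` alone (`conj_succ`).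
Necessity: on a word of length `n` over the vacuum only `Q_(r)` with `r ≤ n` act, so comparison with
`d` in increasing length gives back one equation at a time.

For `Q² = 0`: on the vectors `a ω^K |0⟩` the operator `Q²` acts as `d² = 0`, and a normal ordered
homogeneous element is determined by this action, by induction on the number of letters `γ`, which
the height bounds (`eq_zero_of_mem_normal`). Right invariance amounts to commuting with `U`, which
holds because the tensors `A X_r A` intertwine the words in `r`. -/

theorem sum_cons {n : ℕ} (F : (Fin (n + 1) → ι) → M) :
    ∑ I, F I = ∑ i, ∑ I, F (Fin.cons i I) := by
  rw [← Fintype.sum_prod_type']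
  exact (Fintype.sum_equiv (Fin.consEquiv fun _ : Fin (n + 1) => ι) _ _ fun _ => rfl).symm

theorem sum_snoc {n : ℕ} (F : (Fin (n + 1) → ι) → M) :
    ∑ I, F I = ∑ i, ∑ I, F (Fin.snoc (α := fun _ => ι) I i) := by
  rw [← Fintype.sum_prod_type']
  exact (Fintype.sum_equiv (Fin.snocEquiv fun _ : Fin (n + 1) => ι) _ _ fun _ => rfl).symm

theorem sum_fin_zero (F : (Fin 0 → ι) → M) : ∑ I, F I = F Fin.elim0 := by
  rw [Fintype.sum_unique]
  exact congrArg F (Subsingleton.elim _ _)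

end MultiIndex

/-- Appending an index at the end of a multi-index. -/
abbrev snoc' {ι : Type*} {n : ℕ} (I : Fin n → ι) (i : ι) : Fin (n + 1) → ι :=
  Fin.snoc (α := fun _ => ι) I i

theorem cons_snoc' {ι : Type*} {n : ℕ} (i : ι) (I : Fin n → ι) (j : ι) :
    (Fin.cons i (snoc' I j) : Fin (n + 2) → ι) = snoc' (Fin.cons i I) j :=
  Fin.cons_snoc_eq_snoc_cons _ _ _

theorem exists_cons {ι : Type*} {n : ℕ} (I : Fin (n + 1) → ι) :
    ∃ i I', I = Fin.cons i I' := ⟨_, _, (Fin.cons_self_tail I).symm⟩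

theorem exists_snoc {ι : Type*} {n : ℕ} (I : Fin (n + 1) → ι) :
    ∃ I' i, I = snoc' I' i := ⟨_, _, (Fin.snoc_init_self (α := fun _ => ι) I).symm⟩

/-! ### Products along multi-indices -/

section Words

variable {κ R : Type*} [Monoid R] (x : κ → R)

theorem word_zero (I : Fin 0 → κ) : word x I = 1 := by simp [word]

theorem word_cons {n : ℕ} (i : κ) (I : Fin n → κ) :
    word x (Fin.cons i I : Fin (n + 1) → κ) = x i * word x I := by
  simp [word, List.ofFn_succ]

theorem word_snoc {n : ℕ} (I : Fin n → κ) (i : κ) :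
    word x (snoc' I i) = word x I * x i := by
  rw [word, List.ofFn_succ']
  simp [word]

theorem revWord_zero (I : Fin 0 → κ) : revWord x I = 1 := by simp [revWord]

theorem revWord_cons {n : ℕ} (i : κ) (I : Fin n → κ) :
    revWord x (Fin.cons i I : Fin (n + 1) → κ) = revWord x I * x i := by
  simp [revWord, List.ofFn_succ]

theorem revWord_snoc {n : ℕ} (I : Fin n → κ) (i : κ) :
    revWord x (snoc' I i) = x i * revWord x I := by
  rw [revWord, List.ofFn_succ']
  simp [revWord]

end Words

/-! ### Adding a space to the left or to the right of a tensor -/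

section Tensors

variable {k : Type*} [Field k] {ι : Type*} [Fintype ι] [DecidableEq ι]

theorem shift_cons {m n : ℕ} (M : Matrix (Fin m → ι) (Fin n → ι) k) (i j : ι)
    (I : Fin m → ι) (J : Fin n → ι) :
    shift M (Fin.cons i I) (Fin.cons j J) = if i = j then M I J else 0 := by
  simp [shift]

/-- `M ⊗ 1`: the tensor `M` with the identity in an additional last space. -/
def shiftR {m n : ℕ} (M : Matrix (Fin m → ι) (Fin n → ι) k) :
    Matrix (Fin (m + 1) → ι) (Fin (n + 1) → ι) k :=
  Matrix.of fun I J => if I (Fin.last m) = J (Fin.last n) then M (Fin.init I) (Fin.init J) else 0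

theorem shiftR_snoc {m n : ℕ} (M : Matrix (Fin m → ι) (Fin n → ι) k) (i j : ι)
    (I : Fin m → ι) (J : Fin n → ι) :
    shiftR M (snoc' I i) (snoc' J j) = if i = j then M I J else 0 := by
  simp [shiftR]

theorem shift_ext {m n : ℕ} {M N : Matrix (Fin (m + 1) → ι) (Fin (n + 1) → ι) k}
    (h : ∀ i I j J, M (Fin.cons i I) (Fin.cons j J) = N (Fin.cons i I) (Fin.cons j J)) : M = N := by
  ext I J
  obtain ⟨i, I, rfl⟩ := exists_cons I
  obtain ⟨j, J, rfl⟩ := exists_cons J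
  exact h _ _ _ _

theorem shiftR_ext {m n : ℕ} {M N : Matrix (Fin (m + 1) → ι) (Fin (n + 1) → ι) k}
    (h : ∀ i I j J, M (snoc' I i) (snoc' J j) = N (snoc' I i) (snoc' J j)) : M = N := by
  ext I J
  obtain ⟨I, i, rfl⟩ := exists_snoc I
  obtain ⟨J, j, rfl⟩ := exists_snoc J
  exact h _ _ _ _

theorem shift_mul {m n p : ℕ} (M : Matrix (Fin m → ι) (Fin n → ι) k)
    (N : Matrix (Fin n → ι) (Fin p → ι) k) : shift (M * N) = shift M * shift N := by
  refine shift_ext fun i I j J => ?_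
  simp only [Matrix.mul_apply, sum_cons, shift_cons]
  rw [Finset.sum_comm]
  by_cases h : i = j <;> simp [h]

theorem shiftR_mul {m n p : ℕ} (M : Matrix (Fin m → ι) (Fin n → ι) k)
    (N : Matrix (Fin n → ι) (Fin p → ι) k) : shiftR (M * N) = shiftR M * shiftR N := by
  refine shiftR_ext fun i I j J => ?_
  simp only [Matrix.mul_apply, sum_snoc, shiftR_snoc]
  rw [Finset.sum_comm]
  by_cases h : i = j <;> simp [h]

theorem shift_one (n : ℕ) : shift (1 : Matrix (Fin n → ι) (Fin n → ι) k) = 1 := by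
  refine shift_ext fun i I j J => ?_
  simp only [shift_cons, Matrix.one_apply, Fin.cons_inj]
  split_ifs <;> simp_all

theorem shiftR_one (n : ℕ) : shiftR (1 : Matrix (Fin n → ι) (Fin n → ι) k) = 1 := by
  refine shiftR_ext fun i I j J => ?_
  simp only [shiftR_snoc, Matrix.one_apply, Fin.snoc_inj]
  split_ifs <;> simp_all

theorem shift_add {m n : ℕ} (M N : Matrix (Fin m → ι) (Fin n → ι) k) :
    shift (M + N) = shift M + shift N := by
  ext I J; simp only [shift, Matrix.of_apply, Matrix.add_apply]; split_ifs <;> simp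

theorem shift_smul {m n : ℕ} (c : k) (M : Matrix (Fin m → ι) (Fin n → ι) k) :
    shift (c • M) = c • shift M := by
  ext I J; simp only [shift, Matrix.of_apply, Matrix.smul_apply]; split_ifs <;> simp

theorem shiftR_smul {m n : ℕ} (c : k) (M : Matrix (Fin m → ι) (Fin n → ι) k) :
    shiftR (c • M) = c • shiftR M := by
  ext I J; simp only [shiftR, Matrix.of_apply, Matrix.smul_apply]; split_ifs <;> simp

theorem shift_sub {m n : ℕ} (M N : Matrix (Fin m → ι) (Fin n → ι) k) :
    shift (M - N) = shift M - shift N := by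
  ext I J; simp only [shift, Matrix.of_apply, Matrix.sub_apply]; split_ifs <;> simp

theorem shiftR_sub {m n : ℕ} (M N : Matrix (Fin m → ι) (Fin n → ι) k) :
    shiftR (M - N) = shiftR M - shiftR N := by
  ext I J; simp only [shiftR, Matrix.of_apply, Matrix.sub_apply]; split_ifs <;> simp

theorem shift_sum {m n : ℕ} {α : Type*} (s : Finset α)
    (M : α → Matrix (Fin m → ι) (Fin n → ι) k) :
    shift (∑ a ∈ s, M a) = ∑ a ∈ s, shift (M a) := by
  ext I J
  simp only [shift, Matrix.of_apply, Matrix.sum_apply]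
  split_ifs <;> simp

theorem shiftR_sum {m n : ℕ} {α : Type*} (s : Finset α)
    (M : α → Matrix (Fin m → ι) (Fin n → ι) k) :
    shiftR (∑ a ∈ s, M a) = ∑ a ∈ s, shiftR (M a) := by
  ext I J
  simp only [shiftR, Matrix.of_apply, Matrix.sum_apply]
  split_ifs <;> simp

theorem shift_shiftR {m n : ℕ} (M : Matrix (Fin m → ι) (Fin n → ι) k) :
    shift (shiftR M) = shiftR (shift M) := by
  refine shift_ext fun i I j J => ?_
  obtain ⟨I, a, rfl⟩ := exists_snoc I
  obtain ⟨J, b, rfl⟩ := exists_snoc J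
  rw [shift_cons, shiftR_snoc, cons_snoc', cons_snoc', shiftR_snoc, shift_cons]
  split_ifs <;> rfl

/-- The tensor `M` on two spaces, acting in the first two of `n + 2` spaces. -/
def onFirst (n : ℕ) (M : Matrix (ι × ι) (ι × ι) k) :
    Matrix (Fin (n + 2) → ι) (Fin (n + 2) → ι) k :=
  Matrix.of fun I J => if Fin.tail (Fin.tail I) = Fin.tail (Fin.tail J) then
    M (I 0, Fin.tail I 0) (J 0, Fin.tail J 0) else 0

theorem onFirst_cons (n : ℕ) (M : Matrix (ι × ι) (ι × ι) k) (i i' j j' : ι) (I J : Fin n → ι) :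
    onFirst n M (Fin.cons i (Fin.cons i' I)) (Fin.cons j (Fin.cons j' J)) =
      if I = J then M (i, i') (j, j') else 0 := by
  simp only [onFirst, Matrix.of_apply, Fin.tail_cons, Fin.cons_zero]

/-- The tensor `M` on two spaces, acting in the last two of `n + 2` spaces. -/
def onLast (n : ℕ) (M : Matrix (ι × ι) (ι × ι) k) :
    Matrix (Fin (n + 2) → ι) (Fin (n + 2) → ι) k :=
  Matrix.of fun I J => if Fin.init (Fin.init I) = Fin.init (Fin.init J) then
    M (Fin.init I (Fin.last n), I (Fin.last (n + 1)))
      (Fin.init J (Fin.last n), J (Fin.last (n + 1))) else 0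

theorem onLast_snoc (n : ℕ) (M : Matrix (ι × ι) (ι × ι) k) (i i' j j' : ι) (I J : Fin n → ι) :
    onLast n M (snoc' (snoc' I i) i') (snoc' (snoc' J j) j') =
      if I = J then M (i, i') (j, j') else 0 := by
  simp only [onLast, Matrix.of_apply, Fin.init_snoc, Fin.snoc_last]

theorem onFirst_mul (n : ℕ) (M N : Matrix (ι × ι) (ι × ι) k) :
    onFirst n (M * N) = onFirst n M * onFirst n N := by
  refine shift_ext fun i I j J => ?_
  obtain ⟨i', I, rfl⟩ := exists_cons I
  obtain ⟨j', J, rfl⟩ := exists_cons J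
  simp only [Matrix.mul_apply, sum_cons, onFirst_cons, Fintype.sum_prod_type]
  by_cases h : I = J
  · simp [h]
  · have h' : ∀ K, I = K → K ≠ J := fun K h1 h2 => h (h1.trans h2)
    simp +contextual [h, h']

theorem onLast_mul (n : ℕ) (M N : Matrix (ι × ι) (ι × ι) k) :
    onLast n (M * N) = onLast n M * onLast n N := by
  refine shiftR_ext fun i I j J => ?_
  obtain ⟨I, i', rfl⟩ := exists_snoc I
  obtain ⟨J, j', rfl⟩ := exists_snoc J
  simp only [Matrix.mul_apply, sum_snoc, onLast_snoc, Fintype.sum_prod_type]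
  rw [Finset.sum_comm]
  by_cases h : I = J
  · simp [h]
  · have h' : ∀ K, I = K → K ≠ J := fun K h1 h2 => h (h1.trans h2)
    simp +contextual [h, h']

theorem onFirst_one (n : ℕ) : onFirst n (1 : Matrix (ι × ι) (ι × ι) k) = 1 := by
  refine shift_ext fun i I j J => ?_
  obtain ⟨i', I, rfl⟩ := exists_cons I
  obtain ⟨j', J, rfl⟩ := exists_cons J
  simp only [onFirst_cons, Matrix.one_apply, Fin.cons_inj, Prod.mk.injEq]
  split_ifs <;> simp_all

theorem onLast_one (n : ℕ) : onLast n (1 : Matrix (ι × ι) (ι × ι) k) = 1 := by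
  refine shiftR_ext fun i I j J => ?_
  obtain ⟨I, i', rfl⟩ := exists_snoc I
  obtain ⟨J, j', rfl⟩ := exists_snoc J
  simp only [onLast_snoc, Matrix.one_apply, Fin.snoc_inj, Prod.mk.injEq]
  split_ifs <;> simp_all

theorem shiftR_onFirst (n : ℕ) (M : Matrix (ι × ι) (ι × ι) k) :
    shiftR (onFirst n M) = onFirst (n + 1) M := by
  refine shift_ext fun i I j J => ?_
  obtain ⟨i', I, rfl⟩ := exists_cons I
  obtain ⟨j', J, rfl⟩ := exists_cons J
  obtain ⟨I, a, rfl⟩ := exists_snoc I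
  obtain ⟨J, b, rfl⟩ := exists_snoc J
  rw [onFirst_cons, cons_snoc', cons_snoc', cons_snoc', cons_snoc', shiftR_snoc, onFirst_cons]
  simp only [Fin.snoc_inj]
  split_ifs <;> simp_all

/-- Tensors which act in different spaces commute. -/
theorem onFirst_mul_shift_shift {m n : ℕ} (M : Matrix (ι × ι) (ι × ι) k)
    (N : Matrix (Fin m → ι) (Fin n → ι) k) :
    onFirst m M * shift (shift N) = shift (shift N) * onFirst n M := by
  refine shift_ext fun i I j J => ?_
  obtain ⟨i', I, rfl⟩ := exists_cons I
  obtain ⟨j', J, rfl⟩ := exists_cons J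
  simp [Matrix.mul_apply, sum_cons, onFirst_cons, shift_cons, mul_comm]

theorem braidAt_one (σ : Matrix (ι × ι) (ι × ι) k) (n : ℕ) :
    braidAt σ (n + 2) 1 = onFirst n σ := by
  refine shift_ext fun i I j J => ?_
  obtain ⟨i', I, rfl⟩ := exists_cons I
  obtain ⟨j', J, rfl⟩ := exists_cons J
  have h : (∀ q : Fin (n + 2), (q : ℕ) ≠ 1 - 1 → (q : ℕ) ≠ 1 →
      (Fin.cons i (Fin.cons i' I) : Fin (n + 2) → ι) q =
        (Fin.cons j (Fin.cons j' J) : Fin (n + 2) → ι) q) ↔ I = J := by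
    constructor
    · intro h
      ext q
      simpa using h q.succ.succ (by simp) (by simp)
    · rintro rfl q h0 h1
      obtain ⟨q, hq⟩ := q
      match q, hq with
      | 0, _ => exact absurd rfl h0
      | 1, _ => exact absurd rfl h1
      | q + 2, _ => rfl
  rw [onFirst_cons, braidAt, dif_pos (by omega), Matrix.of_apply]
  simp only [h]
  rfl

end Tensors

/-! ### Intertwiners -/

section Intertwiners

variable {k : Type*} [Field k] {ι : Type*} [Fintype ι] [DecidableEq ι]
variable {R : Type*} [Ring R] [Algebra k R]

/-- The `n`-th tensor power of a matrix `g` over an algebra. -/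
def gword (g : ι → ι → R) (n : ℕ) : Matrix (Fin n → ι) (Fin n → ι) R :=
  Matrix.of fun I J => (List.ofFn fun p => g (I p) (J p)).prod

theorem gword_zero (g : ι → ι → R) (I J : Fin 0 → ι) : gword g 0 I J = 1 := by simp [gword]

theorem gword_cons (g : ι → ι → R) {n : ℕ} (i j : ι) (I J : Fin n → ι) :
    gword g (n + 1) (Fin.cons i I) (Fin.cons j J) = g i j * gword g n I J := by
  simp [gword, List.ofFn_succ]

theorem gword_snoc (g : ι → ι → R) {n : ℕ} (i j : ι) (I J : Fin n → ι) :
    gword g (n + 1) (snoc' I i) (snoc' J j) = gword g n I J * g i j := by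
  rw [gword, Matrix.of_apply, List.ofFn_succ']
  simp [gword]

/-- `Z` intertwines the tensor powers of `g`. -/
def Intertwines (k : Type*) [Field k] {R : Type*} [Ring R] [Algebra k R] (g : ι → ι → R)
    {n m : ℕ} (Z : Matrix (Fin n → ι) (Fin m → ι) k) : Prop :=
  ∀ I J, ∑ K, Z K J • gword g n I K = ∑ K, Z I K • gword g m K J

variable {g : ι → ι → R}

namespace Intertwines

theorem one (n : ℕ) : Intertwines k g (1 : Matrix (Fin n → ι) (Fin n → ι) k) := by
  intro I J
  simp [Matrix.one_apply]

theorem mul {n m p : ℕ} {Y : Matrix (Fin n → ι) (Fin m → ι) k}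
    {Z : Matrix (Fin m → ι) (Fin p → ι) k} (hY : Intertwines k g Y) (hZ : Intertwines k g Z) :
    Intertwines k g (Y * Z) := by
  intro I J
  calc ∑ K, (Y * Z) K J • gword g n I K
      = ∑ L, Z L J • ∑ K, Y K L • gword g n I K := by
        simp only [Matrix.mul_apply, Finset.sum_smul, Finset.smul_sum, smul_smul]
        rw [Finset.sum_comm]
        simp only [mul_comm]
    _ = ∑ K, Y I K • ∑ L, Z L J • gword g m K L := by
        simp only [hY I, Finset.smul_sum, smul_smul]
        rw [Finset.sum_comm]
        simp only [mul_comm]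
    _ = ∑ K, (Y * Z) I K • gword g p K J := by
        simp only [hZ _ J, Matrix.mul_apply, Finset.sum_smul, Finset.smul_sum, smul_smul]
        rw [Finset.sum_comm]

theorem add {n m : ℕ} {Y Z : Matrix (Fin n → ι) (Fin m → ι) k} (hY : Intertwines k g Y)
    (hZ : Intertwines k g Z) : Intertwines k g (Y + Z) := by
  intro I J
  simp only [Matrix.add_apply, add_smul, Finset.sum_add_distrib, hY I J, hZ I J]

theorem sub {n m : ℕ} {Y Z : Matrix (Fin n → ι) (Fin m → ι) k} (hY : Intertwines k g Y)
    (hZ : Intertwines k g Z) : Intertwines k g (Y - Z) := by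
  intro I J
  simp only [Matrix.sub_apply, sub_smul, Finset.sum_sub_distrib, hY I J, hZ I J]

theorem smul {n m : ℕ} (c : k) {Z : Matrix (Fin n → ι) (Fin m → ι) k}
    (hZ : Intertwines k g Z) : Intertwines k g (c • Z) := by
  intro I J
  simp only [Matrix.smul_apply, smul_assoc, ← Finset.smul_sum, hZ I J]

theorem shift {n m : ℕ} {Z : Matrix (Fin n → ι) (Fin m → ι) k} (hZ : Intertwines k g Z) :
    Intertwines k g (shift Z) := by
  intro I J
  obtain ⟨i, I, rfl⟩ := exists_cons I
  obtain ⟨j, J, rfl⟩ := exists_cons J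
  simp only [sum_cons, shift_cons, gword_cons, ite_smul, zero_smul]
  rw [Finset.sum_comm, Finset.sum_comm (s := Finset.univ (α := ι))]
  simp only [Finset.sum_ite_eq, Finset.sum_ite_eq', Finset.mem_univ, if_true,
    ← mul_smul_comm, ← Finset.mul_sum, hZ I J]

end Intertwines

/-- The hypothesis is the FRT relation in two spaces; the remaining letters of a word are carried
along as a right factor. -/
theorem intertwines_onFirst (n : ℕ) {M : Matrix (ι × ι) (ι × ι) k}
    (h : ∀ a b c d, ∑ x, ∑ y, M (x, y) (c, d) • (g a x * g b y) =
      ∑ x, ∑ y, M (a, b) (x, y) • (g x c * g y d)) :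
    Intertwines k g (onFirst n M) := by
  intro I J
  obtain ⟨a, I, rfl⟩ := exists_cons I
  obtain ⟨b, I, rfl⟩ := exists_cons I
  obtain ⟨c, J, rfl⟩ := exists_cons J
  obtain ⟨d, J, rfl⟩ := exists_cons J
  simp only [sum_cons, onFirst_cons, gword_cons, ite_smul, zero_smul, Finset.sum_ite_eq,
    Finset.sum_ite_eq', Finset.mem_univ, if_true]
  simpa only [Finset.sum_mul, smul_mul_assoc, mul_assoc] using
    congrArg (· * gword g n I J) (h a b c d)

/-- If `g` has a left inverse matrix, then so do its tensor powers. -/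
theorem gword_left_cancel {h : ι → ι → R}
    (hg : ∀ i j, ∑ l, h i l * g l j = if i = j then 1 else 0) (n : ℕ)
    (y : (Fin n → ι) → R) (hy : ∀ I, ∑ J, gword g n I J * y J = 0) : y = 0 := by
  induction n with
  | zero =>
    ext I
    have := hy I
    rw [sum_fin_zero, gword_zero, one_mul] at this
    rwa [Subsingleton.elim I Fin.elim0]
  | succ n ih =>
    have h1 : ∀ i, (fun I => y (Fin.cons i I)) = 0 := by
      intro i
      refine ih _ fun I => ?_
      calc ∑ J, gword g n I J * y (Fin.cons i J)
          = ∑ l, h i l * ∑ J, gword g (n + 1) (Fin.cons l I) J * y J := by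
            simp only [sum_cons, gword_cons, Finset.mul_sum, ← mul_assoc]
            rw [Finset.sum_comm]
            simp only [Finset.sum_comm (s := (Finset.univ : Finset ι))
              (t := (Finset.univ : Finset (Fin n → ι)))]
            simp only [← Finset.sum_mul, hg, ite_mul, one_mul, zero_mul, Finset.sum_ite_eq,
              Finset.mem_univ, if_true]
        _ = 0 := by simp [hy]
    ext I
    obtain ⟨i, I, rfl⟩ := exists_cons I
    exact congrFun (h1 i) I

end Intertwiners

/-! ### Factorizations of the antisymmetrizers -/

section Antisymmetrizers

variable {k : Type*} [Field k] {ι : Type*} [Fintype ι] [DecidableEq ι]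
variable (σ : Matrix (ι × ι) (ι × ι) k)

theorem braidAt_succ {n p : ℕ} (hp : 1 ≤ p) (hn : p < n) :
    braidAt σ (n + 1) (p + 1) = shift (braidAt σ n p) := by
  refine shift_ext fun i I j J => ?_
  obtain ⟨p, rfl⟩ : ∃ q, p = q + 1 := ⟨p - 1, by omega⟩
  rw [shift_cons, braidAt, braidAt, dif_pos (by omega), dif_pos (by omega), Matrix.of_apply,
    Matrix.of_apply]
  have h : (∀ q : Fin (n + 1), (q : ℕ) ≠ p + 1 + 1 - 1 → (q : ℕ) ≠ p + 1 + 1 →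
      (Fin.cons i I : Fin (n + 1) → ι) q = (Fin.cons j J : Fin (n + 1) → ι) q) ↔
      (i = j ∧ ∀ q : Fin n, (q : ℕ) ≠ p + 1 - 1 → (q : ℕ) ≠ p + 1 → I q = J q) := by
    rw [Fin.forall_fin_succ]
    simp
  rw [if_congr h rfl rfl]
  have e1 : (⟨p + 1 + 1 - 1, by omega⟩ : Fin (n + 1)) = Fin.succ ⟨p + 1 - 1, by omega⟩ := rfl
  have e2 : (⟨p + 1 + 1, by omega⟩ : Fin (n + 1)) = Fin.succ ⟨p + 1, hn⟩ := rfl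
  rw [e1, e2]
  simp only [Fin.cons_succ]
  split_ifs <;> simp_all

theorem braidAt_shiftR {n p : ℕ} (hp : 1 ≤ p) (hn : p < n) :
    braidAt σ (n + 1) p = shiftR (braidAt σ n p) := by
  refine shiftR_ext fun i I j J => ?_
  rw [shiftR_snoc, braidAt, braidAt, dif_pos (by omega), dif_pos (by omega), Matrix.of_apply,
    Matrix.of_apply]
  have h : (∀ q : Fin (n + 1), (q : ℕ) ≠ p - 1 → (q : ℕ) ≠ p → snoc' I i q = snoc' J j q) ↔
      (i = j ∧ ∀ q : Fin n, (q : ℕ) ≠ p - 1 → (q : ℕ) ≠ p → I q = J q) := by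
    rw [Fin.forall_fin_succ']
    simp only [Fin.val_castSucc, Fin.snoc_castSucc, Fin.snoc_last, Fin.val_last]
    constructor
    · rintro ⟨h1, h2⟩
      exact ⟨h2 (by omega) (by omega), h1⟩
    · rintro ⟨h1, h2⟩
      exact ⟨h2, fun _ _ => h1⟩
  rw [if_congr h rfl rfl]
  have e1 : (⟨p - 1, by omega⟩ : Fin (n + 1)) = Fin.castSucc ⟨p - 1, by omega⟩ := rfl
  have e2 : (⟨p, by omega⟩ : Fin (n + 1)) = Fin.castSucc ⟨p, hn⟩ := rfl
  rw [e1, e2]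
  simp only [Fin.snoc_castSucc]
  split_ifs <;> simp_all

/-- `σ_{12}` is the rightmost factor of the chain, and all the other factors avoid the first space.
-/
theorem braidChain_succ (n m : ℕ) (hm : m ≤ n) :
    braidChain σ (n + 2) (m + 2) = shift (braidChain σ (n + 1) (m + 1)) * onFirst n σ := by
  induction m with
  | zero => simp [braidChain, braidAt_one, shift_one]
  | succ m ih =>
    have h1 : braidChain σ (n + 2) (m + 1 + 2) =
      braidAt σ (n + 2) (m + 2) * braidChain σ (n + 2) (m + 2) := rfl
    have h2 : braidChain σ (n + 1) (m + 1 + 1) =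
      braidAt σ (n + 1) (m + 1) * braidChain σ (n + 1) (m + 1) := rfl
    rw [h1, h2, ih (by omega), braidAt_succ σ (by omega) (by omega), shift_mul, Matrix.mul_assoc]

theorem braidChain_shiftR (n m : ℕ) (hm : m ≤ n) :
    braidChain σ (n + 1) m = shiftR (braidChain σ n m) := by
  induction m with
  | zero => simp [braidChain, shiftR_one]
  | succ m ih =>
    match m with
    | 0 => simp [braidChain, shiftR_one]
    | m + 1 =>
      rw [braidChain, braidChain, ih (by omega), braidAt_shiftR σ (by omega) (by omega),
        shiftR_mul]

/-- `σ_{n, n+1} ⋯ σ_{12}` on `n + 1` spaces. -/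
abbrev Lch (n : ℕ) : Matrix (Fin (n + 1) → ι) (Fin (n + 1) → ι) k := braidChain σ (n + 1) (n + 1)

theorem Lch_succ (n : ℕ) : Lch σ (n + 1) = shift (Lch σ n) * onFirst n σ :=
  braidChain_succ σ n n le_rfl

/-- `σ_{12} ⋯ σ_{n, n+1}` on `n + 1` spaces. -/
def Rch : (n : ℕ) → Matrix (Fin (n + 1) → ι) (Fin (n + 1) → ι) k
  | 0 => 1
  | n + 1 => onFirst n σ * shift (Rch n)

/-- The factor `1 - ∑ (-1)^m σ_{m ← 1}` of the antisymmetrizer on `n + 1` spaces. -/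
def Bm (n : ℕ) : Matrix (Fin (n + 1) → ι) (Fin (n + 1) → ι) k :=
  1 - ∑ m ∈ Finset.Icc 2 (n + 1), (-1 : k) ^ m • braidChain σ (n + 1) m

theorem antisymmetrizer_succ (n : ℕ) :
    antisymmetrizer σ (n + 1) = Bm σ n * shift (antisymmetrizer σ n) := rfl

theorem Bm_zero : Bm σ 0 = 1 := by simp [Bm]

/-- Horner's scheme: each summand of `Bm` contains `σ_{12}` as its last factor, which is taken out
on the right. This is the recursion met when `ω` is moved to the left through a word of `γ`s. -/
theorem Bm_succ (n : ℕ) : Bm σ (n + 1) = 1 - shift (Bm σ n) * onFirst n σ := by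
  have h : ∀ N, ∑ m ∈ Finset.Icc 2 (N + 2), (-1 : k) ^ m • braidChain σ (n + 2) m =
      braidChain σ (n + 2) 2 + ∑ m ∈ Finset.Icc 2 (N + 1), (-1 : k) ^ (m + 1) •
        braidChain σ (n + 2) (m + 1) := by
    intro N
    induction N with
    | zero => simp
    | succ N ih =>
      rw [Finset.sum_Icc_succ_top (b := N + 2) (by omega), ih,
        Finset.sum_Icc_succ_top (b := N + 1) (by omega), add_assoc]
  rw [Bm, Bm, h, shift_sub, shift_one, shift_sum, sub_mul, one_mul, Finset.sum_mul,
    braidChain_succ σ n 0 (by omega)]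
  simp only [braidChain, shift_one, one_mul]
  rw [sub_sub_eq_add_sub, sub_add_eq_sub_sub, sub_eq_sub_iff_add_eq_add]
  have h2 : ∑ m ∈ Finset.Icc 2 (n + 1), (-1 : k) ^ (m + 1) • braidChain σ (n + 2) (m + 1) =
      - ∑ m ∈ Finset.Icc 2 (n + 1), shift ((-1 : k) ^ m • braidChain σ (n + 1) m) *
        onFirst n σ := by
    rw [← Finset.sum_neg_distrib]
    refine Finset.sum_congr rfl fun m hm => ?_
    rw [Finset.mem_Icc] at hm
    obtain ⟨m, rfl⟩ : ∃ q, m = q + 1 := ⟨m - 1, by omega⟩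
    rw [braidChain_succ σ n m (by omega), shift_smul, smul_mul_assoc, pow_succ]
    simp
  rw [h2]
  abel

/-- The other recursion: the longest chain is split off, and the remaining ones do not touch the
last space. -/
theorem Bm_succ' (n : ℕ) :
    Bm σ (n + 1) = shiftR (Bm σ n) + (-1 : k) ^ (n + 1) • Lch σ (n + 1) := by
  rw [Bm, Finset.sum_Icc_succ_top (by omega), Bm, shiftR_sub, shiftR_one, shiftR_sum,
    sub_add_eq_sub_sub, sub_eq_add_neg _ ((-1 : k) ^ (n + 1 + 1) • _)]
  congr 1
  · congr 1
    refine Finset.sum_congr rfl fun m hm => ?_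
    rw [Finset.mem_Icc] at hm
    rw [braidChain_shiftR σ _ _ hm.2, shiftR_smul]
  · rw [pow_succ _ (n + 1)]
    simp

/-- The factor of `A_{1 → n+1} = A_{1 → n} Mm n`. -/
def Mm : (n : ℕ) → Matrix (Fin (n + 1) → ι) (Fin (n + 1) → ι) k
  | 0 => 1
  | n + 1 => shift (Mm n) + (-1 : k) ^ (n + 1) • Lch σ (n + 1)

/-- The factor of `A_{1 → n+1} = Dm n A_{1 → n}`. -/
def Dm : (n : ℕ) → Matrix (Fin (n + 1) → ι) (Fin (n + 1) → ι) k
  | 0 => 1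
  | n + 1 => shift (Dm n) + (-1 : k) ^ (n + 1) • Rch σ (n + 1)

/-- The factor of `A_{1 → n+1} = A_{2 → n+1} Bm' n`. -/
def Bm' : (n : ℕ) → Matrix (Fin (n + 1) → ι) (Fin (n + 1) → ι) k
  | 0 => 1
  | n + 1 => shiftR (Bm' n) + (-1 : k) ^ (n + 1) • Rch σ (n + 1)

variable {R : Type*} [Ring R] [Algebra k R] {g : ι → ι → R}

theorem intertwines_Lch (hg : ∀ n, Intertwines k g (onFirst n σ)) (n : ℕ) :
    Intertwines k g (Lch σ n) := by
  induction n with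
  | zero => exact Intertwines.one _
  | succ n ih => rw [Lch_succ]; exact ih.shift.mul (hg n)

theorem intertwines_Rch (hg : ∀ n, Intertwines k g (onFirst n σ)) (n : ℕ) :
    Intertwines k g (Rch σ n) := by
  induction n with
  | zero => exact Intertwines.one _
  | succ n ih => exact (hg n).mul ih.shift

theorem intertwines_Bm (hg : ∀ n, Intertwines k g (onFirst n σ)) (n : ℕ) :
    Intertwines k g (Bm σ n) := by
  induction n with
  | zero => rw [Bm_zero]; exact Intertwines.one _
  | succ n ih => rw [Bm_succ]; exact (Intertwines.one _).sub (ih.shift.mul (hg n))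

theorem intertwines_Dm (hg : ∀ n, Intertwines k g (onFirst n σ)) (n : ℕ) :
    Intertwines k g (Dm σ n) := by
  induction n with
  | zero => exact Intertwines.one _
  | succ n ih => exact ih.shift.add ((intertwines_Rch σ hg _).smul _)

theorem intertwines_antisymmetrizer (hg : ∀ n, Intertwines k g (onFirst n σ)) (n : ℕ) :
    Intertwines k g (antisymmetrizer σ n) := by
  induction n with
  | zero => exact Intertwines.one _
  | succ n ih => exact (intertwines_Bm σ hg n).mul ih.shift

/-- The factorizations of the antisymmetrizers, from the commutation rules of `L` and `R` with
braids. -/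
theorem antisymmetrizer_succ_Mm
    (hL : ∀ n, Lch σ n * shift (antisymmetrizer σ n) = shiftR (antisymmetrizer σ n) * Lch σ n)
    (n : ℕ) : antisymmetrizer σ (n + 1) = shiftR (antisymmetrizer σ n) * Mm σ n := by
  induction n with
  | zero => simp [antisymmetrizer, shift_one, shiftR_one, Mm]
  | succ n ih =>
    rw [antisymmetrizer_succ, Bm_succ', add_mul, smul_mul_assoc, hL, ih, shift_mul, shift_shiftR,
      ← Matrix.mul_assoc, ← shiftR_mul, ← antisymmetrizer_succ, ih, Mm, mul_add, mul_smul_comm]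

/-- The factor that splits off the first space is exchanged with the one that splits off the last.
This is the inductive step of `A_{1→n+1} = Dm A_{1→n}`: rewrite `A_{1→n+2} = Bm · shift A_{1→n+1}`,
split the last space off inside the shift, and exchange. -/
theorem Bm_mul_shift_Dm (hR : ∀ n, Rch σ (n + 1) * shiftR (Bm σ n) = shift (Bm σ n) * Rch σ (n + 1))
    (n : ℕ) : Bm σ (n + 1) * shift (Dm σ n) = Dm σ (n + 1) * shiftR (Bm σ n) := by
  induction n with
  | zero =>
    simp [Bm_succ, Bm_zero, Dm, Rch, shift_one, shiftR_one, sub_eq_add_neg]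
  | succ n ih =>
    have h1 : onFirst (n + 1) σ * shift (Dm σ (n + 1)) =
        shift (shift (Dm σ n)) * onFirst (n + 1) σ + (-1 : k) ^ (n + 1) • Rch σ (n + 2) := by
      rw [Dm, shift_add, mul_add, onFirst_mul_shift_shift, shift_smul, mul_smul_comm]
      rfl
    calc Bm σ (n + 2) * shift (Dm σ (n + 1))
        = shift (Dm σ (n + 1)) - shift (Bm σ (n + 1)) *
            (onFirst (n + 1) σ * shift (Dm σ (n + 1))) := by
          rw [Bm_succ, sub_mul, one_mul, Matrix.mul_assoc]
      _ = shift (Dm σ (n + 1)) - shift (Bm σ (n + 1) * shift (Dm σ n)) * onFirst (n + 1) σ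
            + (-1 : k) ^ (n + 2) • (Rch σ (n + 2) * shiftR (Bm σ (n + 1))) := by
          rw [h1, mul_add, mul_smul_comm, ← hR, shift_mul, Matrix.mul_assoc, pow_succ _ (n + 1)]
          simp only [mul_neg, mul_one, neg_smul]
          abel
      _ = shift (Dm σ (n + 1)) * (1 - shift (shiftR (Bm σ n)) * onFirst (n + 1) σ)
            + (-1 : k) ^ (n + 2) • (Rch σ (n + 2) * shiftR (Bm σ (n + 1))) := by
          rw [ih, shift_mul, mul_sub, mul_one, Matrix.mul_assoc]
      _ = Dm σ (n + 2) * shiftR (Bm σ (n + 1)) := by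
          have h2 : 1 - shift (shiftR (Bm σ n)) * onFirst (n + 1) σ = shiftR (Bm σ (n + 1)) := by
            rw [Bm_succ, shiftR_sub, shiftR_one, shiftR_mul, shiftR_onFirst, shift_shiftR]
          have h3 : Dm σ (n + 2) =
            shift (Dm σ (n + 1)) + (-1 : k) ^ (n + 2) • Rch σ (n + 2) := rfl
          rw [h2, h3, add_mul, smul_mul_assoc]

theorem antisymmetrizer_succ_Dm
    (hR : ∀ n, Rch σ (n + 1) * shiftR (Bm σ n) = shift (Bm σ n) * Rch σ (n + 1)) (n : ℕ) :
    antisymmetrizer σ (n + 1) = Dm σ n * shiftR (antisymmetrizer σ n) := by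
  induction n with
  | zero => simp [antisymmetrizer, shift_one, shiftR_one, Dm]
  | succ n ih =>
    rw [antisymmetrizer_succ, ih, shift_mul, ← Matrix.mul_assoc, Bm_mul_shift_Dm σ hR,
      Matrix.mul_assoc, shift_shiftR, ← shiftR_mul, ← antisymmetrizer_succ, ih]

/-- Start from the factorization with `Dm` on the left and split `Dm` by its recursion. The shifted
part is treated by induction; in the part with `Rch`, the chain carries the antisymmetrizer from the
first `n` spaces to the last `n`. -/
theorem antisymmetrizer_succ_Bm'
    (hR : ∀ n, Rch σ (n + 1) * shiftR (Bm σ n) = shift (Bm σ n) * Rch σ (n + 1))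
    (hR' : ∀ n, Rch σ n * shiftR (antisymmetrizer σ n) = shift (antisymmetrizer σ n) * Rch σ n)
    (n : ℕ) : antisymmetrizer σ (n + 1) = shift (antisymmetrizer σ n) * Bm' σ n := by
  induction n with
  | zero => simp [antisymmetrizer, shift_one, Bm_zero, Bm']
  | succ n ih =>
    calc antisymmetrizer σ (n + 2)
        = shift (Dm σ n) * shiftR (antisymmetrizer σ (n + 1)) +
            (-1 : k) ^ (n + 1) • (Rch σ (n + 1) * shiftR (antisymmetrizer σ (n + 1))) := by
          rw [antisymmetrizer_succ_Dm σ hR (n + 1), Dm, add_mul, smul_mul_assoc]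
      _ = shift (Dm σ n * shiftR (antisymmetrizer σ n)) * shiftR (Bm' σ n) +
            (-1 : k) ^ (n + 1) • (shift (antisymmetrizer σ (n + 1)) * Rch σ (n + 1)) := by
          rw [hR']
          congr 1
          rw [ih, shiftR_mul, shift_mul, Matrix.mul_assoc, shift_shiftR]
      _ = shift (antisymmetrizer σ (n + 1)) * Bm' σ (n + 1) := by
          rw [← antisymmetrizer_succ_Dm σ hR, Bm', mul_add, mul_smul_comm]

end Antisymmetrizers

/-! ### Identities of dual Hopf algebras -/

section Pairing

variable {k : Type*} [Field k] {A : Type*} [Ring A] [HopfAlgebra k A]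
  {U : Type*} [Ring U] [HopfAlgebra k U]

namespace HopfDuality

variable (P : HopfDuality k A U)

theorem ext_left {u v : U} (h : ∀ a, P.pair u a = P.pair v a) : u = v := by
  rw [← sub_eq_zero]
  exact P.nondegenerate.1 _ fun a => by simp [h]

theorem ext_right {a b : A} (h : ∀ u, P.pair u a = P.pair u b) : a = b := by
  rw [← sub_eq_zero]
  exact P.nondegenerate.2 _ fun u => by simp [h]

theorem lact_apply (u : U) (a : A) :
    P.lact u a = TensorProduct.rid k A ((P.pair u).lTensor A (Coalgebra.comul a)) := rfl

theorem pair_lact (u v : U) (a : A) : P.pair v (P.lact u a) = P.pair (v * u) a := by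
  rw [P.mul_left, lact_apply]
  generalize Coalgebra.comul (R := k) a = t
  induction t with
  | zero => simp
  | add s t hs ht => simp only [map_add, hs, ht]
  | tmul x y => simp [mul_comm]

theorem pair_ract (u v : U) (a : A) : P.pair v (P.ract a u) = P.pair (u * v) a := by
  rw [P.mul_left, ract]
  generalize Coalgebra.comul (R := k) a = t
  induction t with
  | zero => simp
  | add s t hs ht => simp only [map_add, hs, ht]
  | tmul x y => simp

theorem pair_dualLact (a b : A) (u : U) : P.pair (P.dualLact a u) b = P.pair u (b * a) := by
  rw [P.mul_right, dualLact]
  generalize Coalgebra.comul (R := k) u = t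
  induction t with
  | zero => simp
  | add s t hs ht => simp only [map_add, LinearMap.add_apply, hs, ht]
  | tmul x y => simp [mul_comm]

theorem pair_dualRact (a b : A) (u : U) : P.pair (P.dualRact u a) b = P.pair u (a * b) := by
  rw [P.mul_right, dualRact]
  generalize Coalgebra.comul (R := k) u = t
  induction t with
  | zero => simp
  | add s t hs ht => simp only [map_add, LinearMap.add_apply, hs, ht]
  | tmul x y => simp

theorem lact_mul (u v : U) (a : A) : P.lact (u * v) a = P.lact u (P.lact v a) :=
  P.ext_right fun w => by simp only [pair_lact, mul_assoc]

theorem lact_one (a : A) : P.lact 1 a = a :=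
  P.ext_right fun w => by simp only [pair_lact, mul_one]

theorem counit_lact (u : U) (a : A) : Coalgebra.counit (R := k) (P.lact u a) = P.pair u a := by
  rw [← P.one_left, pair_lact, one_mul]

theorem lact_injective {u : U} (h : ∀ a, P.lact u a = 0) : u = 0 :=
  P.ext_left fun a => by rw [← counit_lact, h]; simp

/-- The left action of `A` on `U` as a bilinear map. -/
def dualLactₗ : A →ₗ[k] U →ₗ[k] U :=
  LinearMap.mk₂ k P.dualLact
    (fun _ _ _ => P.ext_left fun _ => by simp [pair_dualLact, mul_add])
    (fun _ _ _ => P.ext_left fun _ => by simp [pair_dualLact])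
    (fun _ _ _ => P.ext_left fun _ => by simp [pair_dualLact])
    (fun _ _ _ => P.ext_left fun _ => by simp [pair_dualLact])

theorem dualLactₗ_apply (a : A) (u : U) : P.dualLactₗ a u = P.dualLact a u := rfl

theorem dualLact_dualLact (a b : A) (u : U) :
    P.dualLact a (P.dualLact b u) = P.dualLact (a * b) u :=
  P.ext_left fun _ => by simp [pair_dualLact, mul_assoc]

theorem dualRact_dualRact (a b : A) (u : U) :
    P.dualRact (P.dualRact u a) b = P.dualRact u (a * b) :=
  P.ext_left fun _ => by simp [pair_dualRact, mul_assoc]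

theorem one_dualLact (u : U) : P.dualLact 1 u = u :=
  P.ext_left fun _ => by simp [pair_dualLact]

theorem dualRact_one (u : U) : P.dualRact u 1 = u :=
  P.ext_left fun _ => by simp [pair_dualRact]

theorem counit_dualLact (a : A) (u : U) : Coalgebra.counit (R := k) (P.dualLact a u) = P.pair u a := by
  rw [← P.one_right, pair_dualLact, one_mul]

theorem counit_dualRact (a : A) (u : U) : Coalgebra.counit (R := k) (P.dualRact u a) = P.pair u a := by
  rw [← P.one_right, pair_dualRact, mul_one]

theorem dualLact_one (a : A) : P.dualLact a 1 = Coalgebra.counit (R := k) a • (1 : U) :=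
  P.ext_left fun b => by simp [pair_dualLact, P.one_left, mul_comm]

/-- By coassociativity, `u ↦ u₍₁₎ φ(u₍₂₎)` leaves the first leg of the coproduct untouched. -/
theorem _root_.Coalgebra.comul_rid_lTensor {R C : Type*} [CommSemiring R] [AddCommMonoid C]
    [Module R C] [Coalgebra R C] (φ : C →ₗ[R] R) (u : C) :
    Coalgebra.comul (R := R) (TensorProduct.rid R C (φ.lTensor C (Coalgebra.comul u))) =
      ((TensorProduct.rid R C).toLinearMap ∘ₗ φ.lTensor C ∘ₗ Coalgebra.comul).lTensor C
        (Coalgebra.comul u) := by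
  have h1 : ∀ (y : C) (s : C ⊗[R] C),
      LinearMap.lTensor C ((TensorProduct.rid R C).toLinearMap ∘ₗ φ.lTensor C)
        (TensorProduct.assoc R C C C (s ⊗ₜ y)) = φ y • s := by
    intro y s
    induction s with
    | zero => simp
    | add s t hs ht => simp only [TensorProduct.add_tmul, map_add, hs, ht, smul_add]
    | tmul a b => simp
  have h2 : ∀ t : C ⊗[R] C,
      LinearMap.lTensor C ((TensorProduct.rid R C).toLinearMap ∘ₗ φ.lTensor C)
        (TensorProduct.assoc R C C C ((Coalgebra.comul (R := R)).rTensor C t)) =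
      Coalgebra.comul (R := R) (TensorProduct.rid R C (φ.lTensor C t)) := by
    intro t
    induction t with
    | zero => simp
    | add s t hs ht => simp only [map_add, hs, ht]
    | tmul a b => simp [h1]
  rw [← LinearMap.comp_assoc, LinearMap.lTensor_comp, LinearMap.comp_apply,
    ← Coalgebra.coassoc_apply, h2]

theorem comul_dualLact (a : A) (u : U) :
    Coalgebra.comul (R := k) (P.dualLact a u) =
      (P.dualLactₗ a).lTensor U (Coalgebra.comul u) :=
  Coalgebra.comul_rid_lTensor (P.pair.flip a) u

theorem lact_repr (u : U) {a : A} {κ : Type*} (r : Coalgebra.Repr k a κ) :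
    P.lact u a = ∑ i ∈ r.index, P.pair u (r.right i) • r.left i := by
  rw [lact_apply, ← r.eq]
  simp

/-- `A` is a module algebra over `U`. -/
theorem lact_mul_right (u : U) (a b : A) :
    P.lact u (a * b) = LinearMap.mul' k A
      (TensorProduct.map (P.lact.flip a) (P.lact.flip b) (Coalgebra.comul u)) := by
  have ha := Coalgebra.Repr.arbitrary k a
  have hb := Coalgebra.Repr.arbitrary k b
  have h1 : P.lact u (a * b) = ∑ i ∈ ha.index, ∑ j ∈ hb.index,
      P.pair u (ha.right i * hb.right j) • (ha.left i * hb.left j) := by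
    rw [lact_apply, Bialgebra.comul_mul, ← ha.eq, ← hb.eq]
    simp [Finset.sum_mul_sum]
  rw [h1]
  simp only [P.mul_right]
  generalize Coalgebra.comul (R := k) u = t
  induction t with
  | zero => simp
  | add s t hs ht => simp only [map_add, add_smul, Finset.sum_add_distrib, hs, ht]
  | tmul p q =>
    simp only [TensorProduct.map_tmul, LinearMap.mul'_apply, LinearMap.flip_apply,
      P.lact_repr p ha, P.lact_repr q hb, Finset.sum_mul_sum, smul_mul_smul_comm]

theorem lact_one_right (u : U) : P.lact u 1 = Coalgebra.counit (R := k) u • (1 : A) :=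
  P.ext_right fun v => by simp [pair_lact, P.one_right, mul_comm]

theorem lact_of_comul {κ : Type*} [Fintype κ] {a : A} {x y : κ → A}
    (ha : Coalgebra.comul (R := k) a = ∑ l, x l ⊗ₜ[k] y l) (u : U) :
    P.lact u a = ∑ l, P.pair u (y l) • x l := by
  rw [lact_apply, ha]; simp

theorem ract_of_comul {κ : Type*} [Fintype κ] {a : A} {x y : κ → A}
    (ha : Coalgebra.comul (R := k) a = ∑ l, x l ⊗ₜ[k] y l) (u : U) :
    P.ract a u = ∑ l, P.pair u (x l) • y l := by
  rw [ract, ha]; simp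

theorem dualLact_of_comul {κ : Type*} [Fintype κ] {u : U} {x y : κ → U}
    (hu : Coalgebra.comul (R := k) u = ∑ l, x l ⊗ₜ[k] y l) (a : A) :
    P.dualLact a u = ∑ l, P.pair (y l) a • x l := by
  rw [dualLact, hu]; simp

theorem dualRact_of_comul {κ : Type*} [Fintype κ] {u : U} {x y : κ → U}
    (hu : Coalgebra.comul (R := k) u = ∑ l, x l ⊗ₜ[k] y l) (a : A) :
    P.dualRact u a = ∑ l, P.pair (x l) a • y l := by
  rw [dualRact, hu]; simp

theorem pair_mul_of_comul {κ : Type*} [Fintype κ] {a : A} {x y : κ → A}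
    (ha : Coalgebra.comul (R := k) a = ∑ l, x l ⊗ₜ[k] y l) (u v : U) :
    P.pair (u * v) a = ∑ l, P.pair u (x l) * P.pair v (y l) := by
  rw [P.mul_left, ha]; simp

theorem pair_of_comul_mul {κ : Type*} [Fintype κ] {u : U} {x y : κ → U}
    (hu : Coalgebra.comul (R := k) u = ∑ l, x l ⊗ₜ[k] y l) (a b : A) :
    P.pair u (a * b) = ∑ l, P.pair (x l) a * P.pair (y l) b := by
  rw [P.mul_right, hu]; simp

/-- The second leg of `c` is absorbed into `u`, which avoids expanding the coproduct of `u`; the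
module algebra law of `U` over `A` follows by pairing. -/
theorem lact_mul_comul {κ : Type*} [Fintype κ] {c : A} {x y : κ → A}
    (hc : Coalgebra.comul (R := k) c = ∑ l, x l ⊗ₜ[k] y l) (u : U) (b : A) :
    P.lact u (b * c) = ∑ l, P.lact (P.dualLact (y l) u) b * x l := by
  simp only [lact_apply, Bialgebra.comul_mul, hc]
  generalize Coalgebra.comul (R := k) b = t
  induction t with
  | zero => simp
  | add s t hs ht => simp only [map_add, add_mul, hs, ht, Finset.sum_add_distrib]
  | tmul p q => simp [Finset.mul_sum, pair_dualLact]

/-- `U` is a module algebra over `A`. -/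
theorem dualLact_mul {κ : Type*} [Fintype κ] {c : A} {x y : κ → A}
    (hc : Coalgebra.comul (R := k) c = ∑ l, x l ⊗ₜ[k] y l) (u v : U) :
    P.dualLact c (u * v) = ∑ l, P.dualLact (x l) u * P.dualLact (y l) v := by
  refine P.ext_left fun b => ?_
  rw [pair_dualLact, ← pair_lact, P.lact_mul_comul hc]
  simp [← pair_lact, pair_dualLact]

end HopfDuality
end Pairing

/-! ### Identities of bicovariant bimodules -/

section Bimodule

variable {k : Type*} [Field k] {A : Type*} [Ring A] [HopfAlgebra k A]
  {U : Type*} [Ring U] [HopfAlgebra k U] {P : HopfDuality k A U}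
  {ι : Type*} [Fintype ι] [DecidableEq ι]

namespace BicovariantBimodule

variable (B : BicovariantBimodule P ι)

/-- The elements `rʲᵢ` as a matrix with row index `i` and column index `j`. -/
abbrev rT (i j : ι) : A := B.r j i

/-- The elements `fʲᵢ` as a matrix with row index `i` and column index `j`. -/
abbrev fT (i j : ι) : U := B.f j i

theorem σ_apply (m l i j : ι) : B.σ (m, l) (i, j) = P.pair (B.f i l) (B.r j m) := rfl

theorem dualLact_r_mul (i j : ι) (u v : U) :
    P.dualLact (B.r i j) (u * v) = ∑ l, P.dualLact (B.r l j) u * P.dualLact (B.r i l) v :=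
  P.dualLact_mul (B.comul_r i j) u v

theorem dualLact_f (a : A) (i j : ι) :
    P.dualLact a (B.f i j) = ∑ l, P.pair (B.f l j) a • B.f i l :=
  P.dualLact_of_comul (B.comul_f i j) a

theorem dualRact_f (a : A) (i j : ι) :
    P.dualRact (B.f i j) a = ∑ l, P.pair (B.f i l) a • B.f l j :=
  P.dualRact_of_comul (B.comul_f i j) a

theorem lact_r (u : U) (i j : ι) : P.lact u (B.r i j) = ∑ l, P.pair u (B.r i l) • B.r l j :=
  P.lact_of_comul (B.comul_r i j) u

theorem ract_r (u : U) (i j : ι) : P.ract (B.r i j) u = ∑ l, P.pair u (B.r l j) • B.r i l :=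
  P.ract_of_comul (B.comul_r i j) u

/-- The compatibility of `f` and `r`, written in `U`. -/
theorem compat_dual (j l : ι) (u : U) :
    ∑ i, P.dualLact (B.r i l) u * B.f j i = ∑ i, B.f i l * P.dualRact u (B.r j i) := by
  refine P.ext_left fun a => ?_
  have h := congrArg (P.pair u) (B.compat j l a)
  have h1 : ∀ i, P.pair (P.dualLact (B.r i l) u * B.f j i) a =
      P.pair u (P.lact (B.f j i) a * B.r i l) := fun i => by
    rw [← P.pair_lact, P.pair_dualLact]
  have h2 : ∀ i, P.pair (B.f i l * P.dualRact u (B.r j i)) a =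
      P.pair u (B.r j i * P.ract a (B.f i l)) := fun i => by
    rw [← P.pair_ract, P.pair_dualRact]
  simpa only [map_sum, LinearMap.sum_apply, h1, h2] using h

/-- Applied to an entry of `r`, the compatibility condition becomes the FRT relation, since the
coefficients `⟨f, r⟩` that appear are the entries of `σ`. -/
theorem intertwines_r (n : ℕ) : Intertwines k B.rT (onFirst n B.σ) := by
  refine intertwines_onFirst n fun a b c d => ?_
  have h := B.compat c b (B.r d a)
  simp only [lact_r, ract_r, Finset.sum_mul, Finset.mul_sum, smul_mul_assoc, mul_smul_comm] at h
  rw [Finset.sum_comm] at h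
  exact h

theorem intertwines_f (n : ℕ) : Intertwines k B.fT (onFirst n B.σ) := by
  refine intertwines_onFirst n fun b a d c => ?_
  have h := B.compat_dual c b (B.f d a)
  simp only [dualLact_f, dualRact_f, Finset.sum_mul, Finset.mul_sum, smul_mul_assoc,
    mul_smul_comm] at h
  rw [Finset.sum_comm] at h
  exact h.symm

/-- The coproduct of `f` distributes `f` over a product of `r`s, and each factor `⟨f, r⟩` is one
braid of the chain. This turns identities in `A` into exchange relations for the chain. -/
theorem Lch_apply {n : ℕ} (I J : Fin n → ι) (x y : ι) :
    Lch B.σ n (snoc' I y) (Fin.cons x J) = P.pair (B.f x y) (gword B.rT n I J) := by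
  induction n generalizing x y with
  | zero =>
    have h : ∀ z, (snoc' I z : Fin 1 → ι) = Fin.cons z J := fun z => by
      ext q; fin_cases q; rfl
    rw [h, gword_zero, P.one_right, B.counit_f]
    simp [Lch, braidChain, Matrix.one_apply, eq_comm]
  | succ n ih =>
    obtain ⟨i, I, rfl⟩ := exists_cons I
    obtain ⟨j, J, rfl⟩ := exists_cons J
    rw [gword_cons, P.pair_of_comul_mul (B.comul_f x y), Lch_succ, ← cons_snoc']
    simp only [Matrix.mul_apply, sum_cons, shift_cons, onFirst_cons, ite_mul, zero_mul, mul_ite,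
      mul_zero, Finset.sum_ite_eq, Finset.sum_ite_eq', Finset.mem_univ, if_true, ih]
    rw [Finset.sum_comm]
    rw [Finset.sum_congr rfl fun y _ => Finset.sum_comm]
    simp [σ_apply, mul_comm]

/-- The mirror image of `Lch_apply`: here the coproduct of `r` distributes `r` over a product of
`f`s. -/
theorem Rch_apply {n : ℕ} (I J : Fin n → ι) (x y : ι) :
    Rch B.σ n (Fin.cons x I) (snoc' J y) = P.pair (gword B.fT n I J) (B.r y x) := by
  induction n generalizing x y with
  | zero =>
    have h : ∀ z, (snoc' J z : Fin 1 → ι) = Fin.cons z I := fun z => by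
      ext q; fin_cases q; rfl
    rw [h, gword_zero, P.one_left, B.counit_r]
    simp [Rch, Matrix.one_apply, eq_comm]
  | succ n ih =>
    obtain ⟨i, I, rfl⟩ := exists_cons I
    obtain ⟨j, J, rfl⟩ := exists_cons J
    rw [gword_cons, P.pair_mul_of_comul (B.comul_r y x), Rch, ← cons_snoc']
    simp only [Matrix.mul_apply, sum_cons, shift_cons, onFirst_cons, ite_mul, zero_mul, mul_ite,
      mul_zero, Finset.sum_ite_eq, Finset.sum_ite_eq', Finset.mem_univ, if_true, ih]
    rw [Finset.sum_comm]
    simp [σ_apply]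

/-- The description by pairings is symmetric in the two ends of the word, so that the chain, defined
by splitting off its first braid, also splits off its last. -/
theorem Rch_succ' (n : ℕ) : Rch B.σ (n + 1) = shiftR (Rch B.σ n) * onLast n B.σ := by
  ext I J
  obtain ⟨x, I, rfl⟩ := exists_cons I
  obtain ⟨I, i, rfl⟩ := exists_snoc I
  obtain ⟨J, y, rfl⟩ := exists_snoc J
  obtain ⟨J, j, rfl⟩ := exists_snoc J
  rw [Rch_apply, gword_snoc, P.pair_mul_of_comul (B.comul_r y x), cons_snoc']
  simp only [Matrix.mul_apply, sum_snoc, shiftR_snoc, onLast_snoc, ite_mul, zero_mul, mul_ite,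
    mul_zero, Finset.sum_ite_eq, Finset.sum_ite_eq', Finset.mem_univ, if_true, Rch_apply]
  rw [Finset.sum_comm]
  simp [σ_apply]

/-- Pair the intertwining relation of `Z` with `f`. -/
theorem Lch_mul_shift {n m : ℕ} {Z : Matrix (Fin n → ι) (Fin m → ι) k}
    (hZ : Intertwines k B.rT Z) : Lch B.σ n * shift Z = shiftR Z * Lch B.σ m := by
  ext I J
  obtain ⟨I, y, rfl⟩ := exists_snoc I
  obtain ⟨x, J, rfl⟩ := exists_cons J
  have h := congrArg (P.pair (B.f x y)) (hZ I J)
  simp only [Matrix.mul_apply]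
  rw [sum_cons, sum_snoc]
  simp only [shift_cons, shiftR_snoc, Lch_apply, mul_ite, ite_mul, mul_zero, zero_mul]
  rw [Finset.sum_comm, Finset.sum_comm (s := (Finset.univ : Finset ι))]
  simpa [mul_comm] using h

theorem Rch_mul_shiftR {n m : ℕ} {Z : Matrix (Fin n → ι) (Fin m → ι) k}
    (hZ : Intertwines k B.fT Z) : Rch B.σ n * shiftR Z = shift Z * Rch B.σ m := by
  ext I J
  obtain ⟨x, I, rfl⟩ := exists_cons I
  obtain ⟨J, y, rfl⟩ := exists_snoc J
  have h := congrArg (P.pair.flip (B.r y x)) (hZ I J)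
  simp only [Matrix.mul_apply]
  rw [sum_snoc, sum_cons]
  simp only [shift_cons, shiftR_snoc, Rch_apply, mul_ite, ite_mul, mul_zero, zero_mul]
  rw [Finset.sum_comm, Finset.sum_comm (s := (Finset.univ : Finset ι))]
  simpa [mul_comm] using h

theorem antisymmetrizer_eq_Mm (n : ℕ) :
    antisymmetrizer B.σ (n + 1) = shiftR (antisymmetrizer B.σ n) * Mm B.σ n :=
  antisymmetrizer_succ_Mm B.σ
    (fun n => B.Lch_mul_shift (intertwines_antisymmetrizer B.σ B.intertwines_r n)) n

theorem Rch_mul_shiftR_Bm (n : ℕ) :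
    Rch B.σ (n + 1) * shiftR (Bm B.σ n) = shift (Bm B.σ n) * Rch B.σ (n + 1) :=
  B.Rch_mul_shiftR (intertwines_Bm B.σ B.intertwines_f n)

theorem Rch_mul_shiftR_antisymmetrizer (n : ℕ) :
    Rch B.σ n * shiftR (antisymmetrizer B.σ n) = shift (antisymmetrizer B.σ n) * Rch B.σ n :=
  B.Rch_mul_shiftR (intertwines_antisymmetrizer B.σ B.intertwines_f n)

theorem antisymmetrizer_eq_Dm (n : ℕ) :
    antisymmetrizer B.σ (n + 1) = Dm B.σ n * shiftR (antisymmetrizer B.σ n) :=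
  antisymmetrizer_succ_Dm B.σ B.Rch_mul_shiftR_Bm n

theorem antisymmetrizer_eq_Bm' (n : ℕ) :
    antisymmetrizer B.σ (n + 1) = shift (antisymmetrizer B.σ n) * Bm' B.σ n :=
  antisymmetrizer_succ_Bm' B.σ B.Rch_mul_shiftR_Bm B.Rch_mul_shiftR_antisymmetrizer n

/-! ### The inverse of the antipode -/

variable (hS : Function.Bijective (HopfAlgebra.antipode k (A := U)))

/-- The inverse `S⁻¹` of the antipode. -/
abbrev sinv (hS : Function.Bijective (HopfAlgebra.antipode k (A := U))) : U →ₗ[k] U :=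
  (LinearEquiv.ofBijective _ hS).symm.toLinearMap

theorem antipode_sinv (u : U) : HopfAlgebra.antipode k (sinv hS u) = u :=
  (LinearEquiv.ofBijective _ hS).apply_symm_apply u

theorem antipode_f_mul (i j : ι) :
    ∑ l, HopfAlgebra.antipode k (B.f i l) * B.f l j = if i = j then 1 else 0 := by
  have h := HopfAlgebra.mul_antipode_rTensor_comul_apply (R := k) (B.f i j)
  rw [B.comul_f, B.counit_f] at h
  simpa using h

theorem f_mul_antipode (i j : ι) :
    ∑ l, B.f i l * HopfAlgebra.antipode k (B.f l j) = if i = j then 1 else 0 := by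
  have h := HopfAlgebra.mul_antipode_lTensor_comul_apply (R := k) (B.f i j)
  rw [B.comul_f, B.counit_f] at h
  simpa using h

/-- The antipode reverses products, so applying `S` gives the antipode axiom for the matrix
coalgebra spanned by `f`; this explains the transposed position of the indices. -/
theorem f_mul_sinv (l m : ι) : ∑ j, B.f j m * sinv hS (B.f l j) = if l = m then 1 else 0 := by
  refine hS.1 ?_
  simp only [map_sum, HopfAlgebra.antipode_mul_antidistrib, antipode_sinv, f_mul_antipode]
  split_ifs <;> simp

theorem sinv_mul_f (j l : ι) : ∑ i, sinv hS (B.f i l) * B.f j i = if j = l then 1 else 0 := by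
  refine hS.1 ?_
  simp only [map_sum, HopfAlgebra.antipode_mul_antidistrib, antipode_sinv, antipode_f_mul]
  split_ifs <;> simp

/-- The inverse of the braid matrix. -/
def σinv (hS : Function.Bijective (HopfAlgebra.antipode k (A := U))) :
    Matrix (ι × ι) (ι × ι) k :=
  Matrix.of fun ij qp => P.pair (sinv hS (B.f qp.2 ij.1)) (B.r qp.1 ij.2)

/-- The sum over the second index is the coproduct of `r` and multiplies the two elements of `U`;
the sum over the first is then `f_mul_sinv`. -/
theorem σ_mul_σinv : B.σ * B.σinv hS = 1 := by
  ext ⟨m, l⟩ ⟨q, p⟩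
  have h : ∀ i, ∑ j, P.pair (B.f i l) (B.r j m) * P.pair (sinv hS (B.f p i)) (B.r q j) =
      P.pair (B.f i l * sinv hS (B.f p i)) (B.r q m) := fun i =>
    (P.pair_mul_of_comul (B.comul_r q m) _ _).symm
  simp only [Matrix.mul_apply, Fintype.sum_prod_type, σ_apply, σinv, Matrix.of_apply, h]
  rw [← LinearMap.sum_apply, ← map_sum, f_mul_sinv, Matrix.one_apply]
  by_cases h1 : p = l
  · simp [h1, P.one_left, B.counit_r, eq_comm]
  · simp [h1, Ne.symm h1]

theorem σinv_mul_σ : B.σinv hS * B.σ = 1 := mul_eq_one_comm.mp (B.σ_mul_σinv hS)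

end BicovariantBimodule
end Bimodule

/-! ### Generalized inverses and kernels -/

section Kernels

variable {k : Type*} [Field k] {m n p q : Type*} [Fintype m] [Fintype n] [Fintype p] [Fintype q]
  [DecidableEq m] [DecidableEq n] [DecidableEq p] [DecidableEq q]

/-- A linear section over the range of `M`, extended to the whole target space. -/
theorem exists_generalized_inverse (M : Matrix m n k) : ∃ G : Matrix n m k, M * G * M = M := by
  obtain ⟨s, hs⟩ := (LinearMap.range_eq_top.mpr
    (Matrix.toLin' M).surjective_rangeRestrict |> fun h =>
      (Matrix.toLin' M).rangeRestrict.exists_rightInverse_of_surjective h)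
  obtain ⟨g, hg⟩ := LinearMap.exists_extend s
  refine ⟨LinearMap.toMatrix' g, Matrix.toLin'.injective ?_⟩
  rw [Matrix.toLin'_mul, Matrix.toLin'_mul, Matrix.toLin'_toMatrix']
  refine LinearMap.ext fun x => ?_
  have h1 : g (Matrix.toLin' M x) = s ((Matrix.toLin' M).rangeRestrict x) := by
    rw [← hg]; rfl
  have h2 := LinearMap.congr_fun hs ((Matrix.toLin' M).rangeRestrict x)
  simp only [LinearMap.comp_apply]
  rw [h1]
  exact congrArg Subtype.val h2

variable {V : Type*} [AddCommGroup V] [Module k V]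

/-- The combinations `∑ wⱼ cⱼ` with `M c = 0` vanish. -/
def RowKer (M : Matrix p n k) (w : n → V) : Prop := ∀ c : n → k, M *ᵥ c = 0 → ∑ j, c j • w j = 0

/-- The combinations `∑ cⁱ vᵢ` with `c M = 0` vanish. -/
def ColKer (M : Matrix m p k) (v : m → V) : Prop := ∀ c : m → k, c ᵥ* M = 0 → ∑ i, c i • v i = 0

theorem colKer_iff (M : Matrix m p k) (v : m → V) : ColKer M v ↔ RowKer Mᵀ v := by
  simp [ColKer, RowKer, Matrix.mulVec_transpose]

/-- The columns of `1 - G M` lie in the kernel of `M`, hence `w (1 - G M) = 0`. -/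
theorem RowKer.exists_eq {M : Matrix p n k} {w : n → V} (h : RowKer M w) :
    ∃ G : Matrix n p k, ∀ j, w j = ∑ l, (G * M) l j • w l := by
  obtain ⟨G, hG⟩ := exists_generalized_inverse M
  refine ⟨G, fun j => ?_⟩
  have h1 := h (fun l => (1 - G * M : Matrix n n k) l j) (by
    have h2 : M * (1 - G * M) = 0 := by
      rw [Matrix.mul_sub, Matrix.mul_one, ← Matrix.mul_assoc, hG, sub_self]
    ext i
    exact congrFun (congrFun h2 i) j)
  simp only [Matrix.sub_apply, sub_smul, Finset.sum_sub_distrib, sub_eq_zero] at h1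
  rw [← h1]
  simp [Matrix.one_apply]

variable {E V' : Type*} [AddCommGroup E] [Module k E] [AddCommGroup V'] [Module k V']

/-- The relations are assumed for scalar coefficients only; writing `w = w G M` and moving `M` onto
`z` extends them to coefficients in an arbitrary module. This is how elements of `A`, `U` and the
double come to serve as coefficients. -/
theorem RowKer.sum_apply_eq_zero {M : Matrix p n k} {w : n → V} (h : RowKer M w)
    (b : E →ₗ[k] V →ₗ[k] V') {z : n → E} (hz : ∀ i, ∑ j, M i j • z j = 0) :
    ∑ j, b (z j) (w j) = 0 := by
  obtain ⟨G, hG⟩ := h.exists_eq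
  calc ∑ j, b (z j) (w j) = ∑ l, b (∑ q, G l q • ∑ j, M q j • z j) (w l) := by
        simp only [Finset.smul_sum, map_sum, smul_smul, LinearMap.sum_apply]
        rw [Finset.sum_congr rfl fun j _ => by rw [hG j]]
        simp only [map_sum, Matrix.mul_apply, Finset.sum_smul]
        rw [Finset.sum_comm]
        refine Finset.sum_congr rfl fun l _ => ?_
        rw [Finset.sum_comm]
        simp
    _ = 0 := by simp [hz]

theorem ColKer.sum_apply_eq_zero {M : Matrix m p k} {v : m → V} (h : ColKer M v)
    (b : E →ₗ[k] V →ₗ[k] V') {z : m → E} (hz : ∀ j, ∑ i, M i j • z i = 0) :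
    ∑ i, b (z i) (v i) = 0 :=
  ((colKer_iff M v).mp h).sum_apply_eq_zero b hz

variable {H : Type*} [Ring H] [Algebra k H]

theorem RowKer.sum_mul_eq_zero {M : Matrix p n k} {w : n → H} (h : RowKer M w) {z : n → H}
    (hz : ∀ i, ∑ j, M i j • z j = 0) : ∑ j, w j * z j = 0 :=
  h.sum_apply_eq_zero (LinearMap.mul k H).flip hz

theorem RowKer.sum_mul_eq_zero' {M : Matrix p n k} {w : n → H} (h : RowKer M w) {z : n → H}
    (hz : ∀ i, ∑ j, M i j • z j = 0) : ∑ j, z j * w j = 0 :=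
  h.sum_apply_eq_zero (LinearMap.mul k H) hz

theorem ColKer.sum_mul_eq_zero {M : Matrix m p k} {v : m → H} (h : ColKer M v) {z : m → H}
    (hz : ∀ j, ∑ i, M i j • z i = 0) : ∑ i, z i * v i = 0 :=
  h.sum_apply_eq_zero (LinearMap.mul k H) hz

/-- `∑ wᵢ zᵢⱼ vⱼ` vanishes when `M z N = 0`. -/
theorem RowKer.sum_mul_mul_eq_zero {M : Matrix p n k} {N : Matrix m q k} {w : n → H} {v : m → H}
    (hw : RowKer M w) (hv : ColKer N v) {z : n → m → H}
    (hz : ∀ a b, ∑ i, ∑ j, M a i • N j b • z i j = 0) :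
    ∑ i, ∑ j, w i * z i j * v j = 0 := by
  rw [Finset.sum_comm]
  simp only [← Finset.sum_mul]
  refine hv.sum_mul_eq_zero fun b => ?_
  simp only [Finset.smul_sum, ← mul_smul_comm]
  rw [Finset.sum_comm]
  simp only [← Finset.mul_sum]
  refine hw.sum_mul_eq_zero fun a => ?_
  simpa only [Finset.smul_sum] using hz a b

end Kernels

/-! ### Normal ordering of words -/

section Words

variable {k : Type*} [Field k] {ι : Type*} [Fintype ι] [DecidableEq ι]

theorem shift_mul_onFirst_apply {n : ℕ} (X : Matrix (Fin (n + 1) → ι) (Fin (n + 1) → ι) k)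
    (σ : Matrix (ι × ι) (ι × ι) k) (l j i : ι) (K : Fin (n + 1) → ι) (J : Fin n → ι) :
    (shift X * onFirst n σ) (Fin.cons l K) (Fin.cons j (Fin.cons i J)) =
      ∑ m, σ (l, m) (j, i) * X K (Fin.cons m J) := by
  simp only [Matrix.mul_apply, sum_cons, shift_cons, onFirst_cons, ite_mul, zero_mul, mul_ite,
    mul_zero]
  rw [Finset.sum_comm, Finset.sum_congr rfl fun y _ => Finset.sum_comm]
  simp [mul_comm]

theorem one_snoc_cons_zero (L J : Fin 0 → ι) (m j : ι) :
    (1 : Matrix (Fin (0 + 1) → ι) (Fin (0 + 1) → ι) k) (snoc' L m) (Fin.cons j J) = if m = j then 1 else 0 := by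
  have h : (snoc' L m : Fin 1 → ι) = Fin.cons m J := by
    ext q; fin_cases q; rfl
  rw [h, Matrix.one_apply]
  simp

variable (σ : Matrix (ι × ι) (ι × ι) k) {H : Type*} [Ring H] [Algebra k H]
  {ω γ : ι → H} {f : ι → ι → H}

/-- Each letter contributes one braid, and together they form the chain `Lch`. It is stated for
abstract `ω`, `γ`, `f`, since the normal ordering rules are needed both in the Fock space, before
the double acts on it, and in the double. -/
theorem f_mul_word
    (hω : ∀ i j l, f j i * ω l = ∑ a, ∑ b, σ (a, b) (j, l) • (ω a * f b i))
    (i j : ι) {n : ℕ} (J : Fin n → ι) :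
    f j i * word ω J = ∑ L : Fin n → ι, ∑ m, Lch σ n (snoc' L m) (Fin.cons j J) •
      (word ω L * f m i) := by
  induction n generalizing j with
  | zero =>
    rw [sum_fin_zero]
    simp only [Lch, braidChain, one_snoc_cons_zero]
    simp [word_zero]
  | succ n ih =>
    obtain ⟨l, J, rfl⟩ := exists_cons J
    rw [word_cons, ← mul_assoc, hω, sum_cons]
    simp only [Finset.sum_mul, smul_mul_assoc, mul_assoc, ih]
    refine Finset.sum_congr rfl fun a _ => ?_
    simp only [Lch_succ, ← cons_snoc', shift_mul_onFirst_apply, Finset.sum_smul, Finset.mul_sum,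
      Finset.smul_sum, mul_smul_comm, smul_smul, word_cons, mul_assoc]
    rw [Finset.sum_comm]
    refine Finset.sum_congr rfl fun L _ => ?_
    rw [Finset.sum_comm]

/-- Contraction with the first letter leaves an `f` that still has to pass the rest of the word,
which gives the chain `Lch`; contraction with a later letter is the shifted case. This is the
recursion of `Mm`. -/
theorem γ_mul_word
    (hω : ∀ i j l, f j i * ω l = ∑ a, ∑ b, σ (a, b) (j, l) • (ω a * f b i))
    (hγ : ∀ i j, γ i * ω j = -(ω j * γ i) + f j i) (i : ι) {n : ℕ} (J : Fin (n + 1) → ι) :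
    γ i * word ω J = (-1 : k) ^ (n + 1) • (word ω J * γ i) +
      (-1 : k) ^ n • ∑ L : Fin n → ι, ∑ m, Mm σ n (snoc' L m) J • (word ω L * f m i) := by
  induction n with
  | zero =>
    obtain ⟨j, J, rfl⟩ := exists_cons J
    rw [sum_fin_zero]
    simp only [Mm, one_snoc_cons_zero]
    simp [word_zero, word_cons, hγ]
  | succ n ih =>
    obtain ⟨j, J, rfl⟩ := exists_cons J
    have h1 : ∑ L : Fin (n + 1) → ι, ∑ m, Mm σ (n + 1) (snoc' L m) (Fin.cons j J) •
        (word ω L * f m i) = ω j * (∑ L : Fin n → ι, ∑ m, Mm σ n (snoc' L m) J •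
          (word ω L * f m i)) + (-1 : k) ^ (n + 1) • (f j i * word ω J) := by
      simp only [Mm, Matrix.add_apply, add_smul, Finset.sum_add_distrib, f_mul_word σ hω,
        Matrix.smul_apply, smul_assoc, ← Finset.smul_sum]
      congr 1
      simp only [sum_cons, ← cons_snoc', shift_cons, ite_smul, zero_smul, word_cons]
      rw [Finset.sum_eq_single j (by simp +contextual) (by simp)]
      simp [Finset.mul_sum, mul_assoc]
    rw [h1, word_cons, ← mul_assoc, hγ, add_mul, neg_mul, mul_assoc, ih]
    have h2 : (-1 : k) ^ n * (-1) * ((-1) ^ n * (-1)) = 1 := by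
      rw [← pow_succ, ← mul_pow]; simp
    simp only [mul_add, mul_smul_comm, smul_add, smul_smul, pow_succ, h2, mul_assoc]
    module

/-- Contraction with the leftmost `γ` gives the `1` in the recursion of `Bm`; a contraction further
to the right leaves an `f` which that `γ` must pass, at the price of one `σ` and a sign. -/
theorem word_mul_ω
    (hγ : ∀ i j, γ i * ω j = -(ω j * γ i) + f j i)
    (hf : ∀ i j l, γ i * f j l = ∑ a, ∑ b, σ (i, l) (a, b) • (f j a * γ b))
    (j : ι) {n : ℕ} (I : Fin (n + 1) → ι) :
    word γ I * ω j = (-1 : k) ^ (n + 1) • (ω j * word γ I) +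
      (-1 : k) ^ n • ∑ p, ∑ L : Fin n → ι, Bm σ n I (Fin.cons p L) • (f j p * word γ L) := by
  induction n with
  | zero =>
    obtain ⟨i, I, rfl⟩ := exists_cons I
    simp only [sum_fin_zero, Bm_zero]
    simp [Matrix.one_apply, word_zero, word_cons, hγ, Subsingleton.elim I Fin.elim0]
  | succ n ih =>
    obtain ⟨i, I, rfl⟩ := exists_cons I
    have h1 : ∑ q, ∑ K : Fin (n + 1) → ι, Bm σ (n + 1) (Fin.cons i I) (Fin.cons q K) •
        (f j q * word γ K) = f j i * word γ I - γ i * ∑ p, ∑ L : Fin n → ι,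
          Bm σ n I (Fin.cons p L) • (f j p * word γ L) := by
      simp only [Bm_succ, Matrix.sub_apply, sub_smul, Finset.sum_sub_distrib]
      congr 1
      · simp [Matrix.one_apply, ite_and]
      · simp only [sum_cons, shift_mul_onFirst_apply, Finset.mul_sum, mul_smul_comm, ← mul_assoc,
          hf, word_cons]
        simp only [Finset.sum_mul, smul_mul_assoc, Finset.sum_smul, Finset.smul_sum, smul_smul]
        refine Eq.symm ?_
        rw [Finset.sum_congr rfl fun _ _ => Finset.sum_comm, Finset.sum_comm]
        refine Finset.sum_congr rfl fun a _ => ?_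
        rw [Finset.sum_congr rfl fun _ _ => Finset.sum_comm, Finset.sum_comm]
        refine Finset.sum_congr rfl fun b _ => ?_
        rw [Finset.sum_comm]
        simp only [mul_comm]
    rw [h1, word_cons, mul_assoc, ih, mul_add, mul_smul_comm, ← mul_assoc, hγ, add_mul]
    have h2 : (-1 : k) ^ n * (-1) * ((-1) ^ n * (-1)) = 1 := by
      rw [← pow_succ, ← mul_pow]; simp
    simp only [mul_add, mul_smul_comm, smul_add, smul_sub, neg_mul, smul_smul, pow_succ, h2,
      mul_assoc]
    module

end Words

/-! ### The Fock representation -/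

section Fock

variable {k : Type*} [Field k] {A : Type*} [Ring A] [HopfAlgebra k A]
  {U : Type*} [Ring U] [HopfAlgebra k U] {P : HopfDuality k A U}
  {ι : Type*} [Fintype ι] [DecidableEq ι]

theorem HopfDuality.dualLact_dualRact (a b : A) (u : U) :
    P.dualLact a (P.dualRact u b) = P.dualRact (P.dualLact a u) b :=
  P.ext_left fun _ => by simp [pair_dualLact, pair_dualRact, mul_assoc]

namespace BicovariantBimodule

variable (B : BicovariantBimodule P ι)

variable (k A ι) in
/-- Functions on words; the value at a word `i₁ i₂ …` is the vacuum coefficient after the action of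
`… γ_{i₂} γ_{i₁}`. -/
abbrev Fun (k : Type*) [Field k] (A : Type*) [Ring A] [HopfAlgebra k A] (ι : Type*) := List ι → A

/-- The action of `A` on functions. -/
def fa : A →ₐ[k] Module.End k (Fun k A ι) :=
  AlgHom.ofLinearMap
    (LinearMap.mk₂ k (fun a ψ L => a * ψ L)
      (fun _ _ _ => by ext; simp [add_mul]) (fun _ _ _ => by ext; simp)
      (fun _ _ _ => by ext; simp [mul_add]) (fun _ _ _ => by ext; simp))
    (by ext; simp) (fun _ _ => by ext; simp [mul_assoc])

/-- The action of `γᵢ` on functions. -/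
def fγ (i : ι) : Module.End k (Fun k A ι) where
  toFun ψ L := ψ (i :: L)
  map_add' _ _ := rfl
  map_smul' _ _ := rfl

theorem fa_apply (a : A) (ψ : Fun k A ι) (L : List ι) : fa (k := k) a ψ L = a * ψ L := rfl

/-- The action of `U` on functions, evaluated at a word. -/
def fuAt : List ι → U →ₗ[k] Fun k A ι →ₗ[k] A
  | [] => P.lact.compl₂ (LinearMap.proj (R := k) (φ := fun _ : List ι => A) [])
  | i :: L => ∑ j, ((fuAt L).compl₂ (fγ (k := k) (A := A) j)) ∘ₗ P.dualLactₗ (B.r j i)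

/-- The action of `U` on functions. -/
def fu : U →ₗ[k] Module.End k (Fun k A ι) :=
  LinearMap.mk₂ k (fun u ψ L => B.fuAt L u ψ)
    (fun _ _ _ => by ext; simp) (fun _ _ _ => by ext; simp)
    (fun _ _ _ => by ext; simp) (fun _ _ _ => by ext; simp)

theorem fu_nil (u : U) (ψ : Fun k A ι) : B.fu u ψ [] = P.lact u (ψ []) := rfl

theorem fu_cons (u : U) (ψ : Fun k A ι) (i : ι) (L : List ι) :
    B.fu u ψ (i :: L) = ∑ j, B.fu (P.dualLact (B.r j i) u) (fγ j ψ) L := by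
  change B.fuAt (i :: L) u ψ = _
  simp only [fuAt, LinearMap.sum_apply]
  rfl

/-- True by the recursive definition of `fu`: the values at longer words are chosen so that the rule
for moving `γᵢ` past `u` holds. The definition of `fω` works likewise, and the other relations are
then verified by induction on the word. -/
theorem fγ_fu (u : U) (i : ι) :
    fγ i * B.fu u = ∑ j, B.fu (P.dualLact (B.r j i) u) * fγ (k := k) j := by
  ext ψ L
  simp only [LinearMap.sum_apply, Finset.sum_apply]
  exact B.fu_cons u ψ i L

theorem fγ_fa (a : A) (i : ι) : fγ (k := k) i * fa a = fa a * fγ i := rfl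

/-- The action of `ωʲ` on functions, evaluated at a word. -/
def fωAt : List ι → ι → Fun k A ι →ₗ[k] A
  | [], _ => 0
  | i :: L, j => -(fωAt L j ∘ₗ fγ i) + LinearMap.proj L ∘ₗ B.fu (B.f j i)

/-- The action of `ωʲ` on functions. -/
def fω (j : ι) : Module.End k (Fun k A ι) := LinearMap.pi fun L => B.fωAt L j

theorem fω_nil (j : ι) (ψ : Fun k A ι) : B.fω j ψ [] = 0 := rfl

theorem fγ_fω (i j : ι) : fγ i * B.fω j = -(B.fω j * fγ i) + B.fu (B.f j i) := rfl

theorem fω_cons (i j : ι) (ψ : Fun k A ι) (L : List ι) :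
    B.fω j ψ (i :: L) = -(B.fω j (fγ i ψ) L) + B.fu (B.f j i) ψ L := rfl

theorem fu_mul (u v : U) : B.fu (u * v) = B.fu u * B.fu v := by
  ext ψ L
  induction L generalizing u v ψ with
  | nil => simp [fu_nil, P.lact_mul]
  | cons i L ih =>
    have h : ∀ l, fγ (k := k) l (B.fu v ψ) = ∑ j, B.fu (P.dualLact (B.r j l) v) (fγ j ψ) := by
      intro l
      simpa using LinearMap.congr_fun (B.fγ_fu v l) ψ
    simp only [Module.End.mul_apply] at ih ⊢
    simp only [fu_cons, dualLact_r_mul, map_sum, LinearMap.sum_apply, Finset.sum_apply, ih, h]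
    rw [Finset.sum_comm]

theorem fu_one : B.fu 1 = 1 := by
  ext ψ L
  induction L generalizing ψ with
  | nil => simp [fu_nil, P.lact_one]
  | cons i L ih =>
    rw [fu_cons, Finset.sum_eq_single i]
    · rw [P.dualLact_one, B.counit_r, if_pos rfl, one_smul]
      exact ih (fγ i ψ)
    · intro j _ hj
      simp [P.dualLact_one, B.counit_r, hj]
    · simp

theorem fu_fa (u : U) (a : A) :
    B.fu u * fa a = LinearMap.mul' k (Module.End k (Fun k A ι))
      (TensorProduct.map ((fa (ι := ι) (k := k)).toLinearMap ∘ₗ P.lact.flip a) B.fu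
        (Coalgebra.comul u)) := by
  ext ψ L
  induction L generalizing u ψ with
  | nil =>
    rw [Module.End.mul_apply, fu_nil, fa_apply, P.lact_mul_right]
    generalize Coalgebra.comul (R := k) u = t
    induction t with
    | zero => simp
    | add s t hs ht => simp only [map_add, LinearMap.add_apply, Pi.add_apply, hs, ht]
    | tmul x y => simp [fa_apply, fu_nil]
  | cons i L ih =>
    have h : ∀ t : U ⊗[k] U, LinearMap.mul' k (Module.End k (Fun k A ι))
        (TensorProduct.map ((fa (ι := ι) (k := k)).toLinearMap ∘ₗ P.lact.flip a) B.fu t) ψ (i :: L)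
        = ∑ j, LinearMap.mul' k (Module.End k (Fun k A ι))
        (TensorProduct.map ((fa (ι := ι) (k := k)).toLinearMap ∘ₗ P.lact.flip a) B.fu
          ((P.dualLactₗ (B.r j i)).lTensor U t)) (fγ j ψ) L := by
      intro t
      induction t with
      | zero => simp
      | add s t hs ht =>
        simp only [map_add, LinearMap.add_apply, Pi.add_apply, hs, ht, Finset.sum_add_distrib]
      | tmul x y => simp [fa_apply, fu_cons, Finset.mul_sum, HopfDuality.dualLactₗ_apply]
    rw [h, Module.End.mul_apply, fu_cons]
    refine Finset.sum_congr rfl fun j _ => ?_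
    rw [← P.comul_dualLact, ← ih]
    rfl

theorem fu_f_fa (i j : ι) (a : A) :
    B.fu (B.f i j) * fa a = ∑ l, fa (P.lact (B.f i l) a) * B.fu (B.f l j) := by
  rw [fu_fa, B.comul_f]
  simp

theorem fω_fa (i : ι) (a : A) : B.fω i * fa a = ∑ j, fa (P.lact (B.f i j) a) * B.fω j := by
  ext ψ L
  induction L generalizing a ψ with
  | nil => simp [fω_nil, fa_apply]
  | cons l L ih =>
    have h := congrFun (LinearMap.congr_fun (B.fu_f_fa i l a) ψ) L
    simp only [Module.End.mul_apply, LinearMap.sum_apply, Finset.sum_apply] at ih h ⊢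
    rw [fω_cons, h]
    have h2 : fγ (k := k) l (fa a ψ) = fa a (fγ l ψ) := rfl
    rw [h2, ih]
    simp [fa_apply, fω_cons, mul_add, Finset.sum_add_distrib]

/-- This is the relation that needs bicovariance: after one step of the induction on the word, the
terms in which `γ` and `ω` are contracted match precisely by `compat_dual`. -/
theorem fu_fω (u : U) (j : ι) :
    B.fu u * B.fω j = ∑ l, B.fω l * B.fu (P.dualRact u (B.r j l)) := by
  ext ψ L
  induction L generalizing u ψ with
  | nil => simp [fω_nil, fu_nil]
  | cons i L ih =>
    have h : ∀ m v, fγ (k := k) m (B.fu v ψ) = ∑ j, B.fu (P.dualLact (B.r j m) v) (fγ j ψ) := by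
      intro m v
      simpa using LinearMap.congr_fun (B.fγ_fu v m) ψ
    have h2 : ∀ m, fγ (k := k) m (B.fω j ψ) = -(B.fω j (fγ m ψ)) + B.fu (B.f j m) ψ :=
      fun m => rfl
    have h3 := congrArg (fun x => B.fu x ψ L) (B.compat_dual j i u)
    simp only [fu_mul, map_sum, LinearMap.sum_apply, Finset.sum_apply, Module.End.mul_apply] at h3
    simp only [Module.End.mul_apply, LinearMap.sum_apply, Finset.sum_apply] at ih ⊢
    simp only [fu_cons, fω_cons, h, h2, map_add, map_neg, Pi.add_apply, Pi.neg_apply, ih,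
      Finset.sum_add_distrib, h3, map_sum, Finset.sum_apply, Finset.sum_neg_distrib,
      HopfDuality.dualLact_dualRact]
    rw [Finset.sum_comm]

theorem fu_f_fω (i j l : ι) :
    B.fu (B.f j i) * B.fω l = ∑ a, ∑ b, B.σ (a, b) (j, l) • (B.fω a * B.fu (B.f b i)) := by
  rw [fu_fω]
  refine Finset.sum_congr rfl fun a _ => ?_
  simp only [dualRact_f, map_sum, map_smul, Finset.mul_sum, mul_smul_comm]
  rfl

theorem fγ_fu_f (i j l : ι) :
    fγ i * B.fu (B.f j l) = ∑ a, ∑ b, B.σ (i, l) (a, b) • (B.fu (B.f j a) * fγ (k := k) b) := by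
  rw [fγ_fu, Finset.sum_comm]
  refine Finset.sum_congr rfl fun a _ => ?_
  simp only [dualLact_f, map_sum, map_smul, Finset.sum_mul, smul_mul_assoc]
  rfl

theorem shiftR_mulVec_snoc {m n : ℕ} (M : Matrix (Fin m → ι) (Fin n → ι) k)
    (v : (Fin (n + 1) → ι) → k) (I : Fin m → ι) (i : ι) :
    (shiftR M *ᵥ v) (snoc' I i) = (M *ᵥ fun J => v (snoc' J i)) I := by
  simp only [Matrix.mulVec, dotProduct]
  rw [sum_snoc]
  simp only [shiftR_snoc, ite_mul, zero_mul]
  rw [Finset.sum_eq_single i (by simp +contextual [eq_comm]) (by simp)]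
  simp

/-- The contraction term has the coefficients `Mm c`. By `A_{1→n+1} = (A_{1→n} ⊗ 1) Mm` they lie,
for every fixed last index, in the kernel of `A_{1→n}`, so the relations one degree lower remove
them. -/
theorem γ_mul_sum_word {H : Type*} [Ring H] [Algebra k H] {ω γ : ι → H} {f : ι → ι → H}
    (hω : ∀ i j l, f j i * ω l = ∑ a, ∑ b, B.σ (a, b) (j, l) • (ω a * f b i))
    (hγ : ∀ i j, γ i * ω j = -(ω j * γ i) + f j i) {n : ℕ}
    (ih : RowKer (antisymmetrizer B.σ n) (fun J => word ω J))
    (c : (Fin (n + 1) → ι) → k) (hc : antisymmetrizer B.σ (n + 1) *ᵥ c = 0) (i : ι) :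
    γ i * ∑ J, c J • word ω J = (-1 : k) ^ (n + 1) • ((∑ J, c J • word ω J) * γ i) := by
  have h2 : ∀ m, (∑ L : Fin n → ι, (Mm B.σ n *ᵥ c) (snoc' L m) • word ω L) = 0 := by
    intro m
    refine ih _ ?_
    ext K
    have h3 : (shiftR (antisymmetrizer B.σ n) *ᵥ (Mm B.σ n *ᵥ c)) (snoc' K m) = 0 := by
      rw [Matrix.mulVec_mulVec, ← antisymmetrizer_eq_Mm, hc]
      rfl
    rwa [shiftR_mulVec_snoc] at h3
  have h1 : ∑ J, c J • ∑ L : Fin n → ι, ∑ m, Mm B.σ n (snoc' L m) J • (word ω L * f m i) = 0 := by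
    calc _ = ∑ m, (∑ L : Fin n → ι, (Mm B.σ n *ᵥ c) (snoc' L m) • word ω L) * f m i := by
          simp only [Finset.sum_mul, Matrix.mulVec, dotProduct, Finset.sum_smul,
            Finset.smul_sum, smul_mul_assoc, smul_smul]
          rw [Finset.sum_comm, Finset.sum_congr rfl fun _ _ => Finset.sum_comm, Finset.sum_comm]
          simp only [mul_comm]
      _ = 0 := by simp [h2]
  simp only [Finset.mul_sum, mul_smul_comm, γ_mul_word B.σ hω hγ, smul_add,
    Finset.sum_add_distrib, smul_comm (c _) ((-1 : k) ^ _), ← Finset.smul_sum, Finset.sum_mul,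
    smul_mul_assoc]
  rw [h1, smul_zero, add_zero]

/-- A function is zero if it vanishes at the empty word and all `γᵢ` annihilate it. The first holds
for anything that begins with an `ω`; the second follows by induction, since `γᵢ` passes a relation
up to a sign. -/
theorem rowKer_word_fω (n : ℕ) : RowKer (antisymmetrizer B.σ n) (fun J => word B.fω J) := by
  induction n with
  | zero =>
    intro c hc
    simp only [antisymmetrizer, Matrix.one_mulVec] at hc
    simp [hc]
  | succ n ih =>
    intro c hc
    have h := B.γ_mul_sum_word B.fu_f_fω B.fγ_fω ih c hc
    ext ψ L
    induction L generalizing ψ with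
    | nil =>
      simp only [LinearMap.sum_apply, LinearMap.smul_apply, Finset.sum_apply, Pi.smul_apply]
      refine Finset.sum_eq_zero fun J _ => ?_
      obtain ⟨j, J, rfl⟩ := exists_cons J
      rw [word_cons, Module.End.mul_apply, fω_nil, smul_zero]
    | cons i L ihL =>
      have h5 := congrFun (LinearMap.congr_fun (h i) ψ) L
      refine h5.trans ?_
      rw [LinearMap.smul_apply, Pi.smul_apply, Module.End.mul_apply, ihL]
      simp

end BicovariantBimodule
end Fock

/-! ### The invariant subspace and the action of the Heisenberg double on it -/

section Fock

variable {k : Type*} [Field k] {A : Type*} [Ring A] [HopfAlgebra k A]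
  {U : Type*} [Ring U] [HopfAlgebra k U] {P : HopfDuality k A U}
  {ι : Type*} [Fintype ι] [DecidableEq ι]

theorem shiftR_vecMul_snoc {m n : ℕ} (M : Matrix (Fin m → ι) (Fin n → ι) k)
    (c : (Fin m → ι) → k) (i : ι) (J : Fin n → ι) (j : ι) :
    ((fun I => if I (Fin.last m) = i then c (Fin.init I) else 0) ᵥ* shiftR M) (snoc' J j) =
      if i = j then (c ᵥ* M) J else 0 := by
  simp only [Matrix.vecMul, dotProduct]
  rw [sum_snoc]
  simp only [shiftR_snoc, Fin.snoc_last, Fin.init_snoc, ite_mul, zero_mul, mul_ite, mul_zero]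
  rw [Finset.sum_eq_single i (fun b _ hb => by simp [hb]) (by simp)]
  simp only [if_true]
  split_ifs <;> simp

theorem vecMul_shift_cons {m n : ℕ} (M : Matrix (Fin m → ι) (Fin n → ι) k)
    (c : (Fin (m + 1) → ι) → k) (i : ι) (J : Fin n → ι) :
    (c ᵥ* shift M) (Fin.cons i J) = ((fun I => c (Fin.cons i I)) ᵥ* M) J := by
  simp only [Matrix.vecMul, dotProduct]
  rw [sum_cons]
  simp only [shift_cons, mul_ite, mul_zero]
  rw [Finset.sum_eq_single i (by simp +contextual) (by simp)]
  simp

namespace BicovariantBimodule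

variable (B : BicovariantBimodule P ι)

section Generic

variable {H : Type*} [Ring H] [Algebra k H] {ω γ : ι → H} (hu : U →ₗ[k] H)

theorem word_γ_mul_u
    (hγu : ∀ i u, γ i * hu u = ∑ j, hu (P.dualLact (B.r j i) u) * γ j)
    {n : ℕ} (I : Fin n → ι) (u : U) :
    word γ I * hu u = ∑ K, hu (P.dualLact (gword B.rT n I K) u) * word γ K := by
  induction n generalizing u with
  | zero => simp [sum_fin_zero, word_zero, gword_zero, P.one_dualLact]
  | succ n ih =>
    obtain ⟨i, I, rfl⟩ := exists_cons I
    rw [word_cons, mul_assoc, ih, Finset.mul_sum, sum_cons, Finset.sum_comm]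
    refine Finset.sum_congr rfl fun K _ => ?_
    rw [← mul_assoc, hγu, Finset.sum_mul]
    simp only [gword_cons, word_cons, P.dualLact_dualLact, mul_assoc]

theorem u_mul_word_ω
    (huω : ∀ u j, hu u * ω j = ∑ l, ω l * hu (P.dualRact u (B.r j l)))
    {n : ℕ} (J : Fin n → ι) (u : U) :
    hu u * word ω J = ∑ L, word ω L * hu (P.dualRact u (gword B.rT n L J)) := by
  induction n generalizing u with
  | zero => simp [sum_fin_zero, word_zero, gword_zero, P.dualRact_one]
  | succ n ih =>
    obtain ⟨j, J, rfl⟩ := exists_cons J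
    rw [word_cons, ← mul_assoc, huω, Finset.sum_mul, sum_cons]
    refine Finset.sum_congr rfl fun l _ => ?_
    rw [mul_assoc, ih, Finset.mul_sum]
    simp only [gword_cons, word_cons, P.dualRact_dualRact, mul_assoc]

end Generic

/-- The functions on which the relations of the exterior product of the `γᵢ` hold. -/
def fockSub : Submodule k (Fun k A ι) where
  carrier := {ψ | ∀ n, ColKer (antisymmetrizer B.σ n)
    (fun I : Fin n → ι => word (fγ (k := k) (A := A)) I ψ)}
  zero_mem' n c _ := by simp
  add_mem' hx hy n c hc := by
    simp only [map_add, smul_add, Finset.sum_add_distrib]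
    rw [hx n c hc, hy n c hc, add_zero]
  smul_mem' a x hx n c hc := by
    simp only [map_smul, smul_comm _ a, ← Finset.smul_sum]
    rw [hx n c hc, smul_zero]

/-- The operators which preserve `fockSub`. -/
def fockOps : Subalgebra k (Module.End k (Fun k A ι)) where
  carrier := {T | ∀ ψ ∈ B.fockSub, T ψ ∈ B.fockSub}
  mul_mem' hS hT ψ hψ := hS _ (hT _ hψ)
  add_mem' hS hT ψ hψ := B.fockSub.add_mem (hS _ hψ) (hT _ hψ)
  algebraMap_mem' a ψ hψ := by
    simpa [Module.algebraMap_end_apply] using B.fockSub.smul_mem a hψ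

/-- Restriction of operators to `fockSub`. -/
def fockRes : B.fockOps →ₐ[k] Module.End k B.fockSub where
  toFun T := T.1.restrict T.2
  map_one' := rfl
  map_mul' _ _ := rfl
  map_zero' := rfl
  map_add' _ _ := rfl
  commutes' _ := rfl

theorem fockRes_apply (T : B.fockOps) (v : B.fockSub) : (B.fockRes T v : Fun k A ι) = T.1 v.1 := rfl

theorem fa_mem (a : A) : fa a ∈ B.fockOps := by
  intro ψ hψ n c hc
  have h : ∀ {n : ℕ} (I : Fin n → ι), word (fγ (k := k)) I * fa a = fa a * word fγ I := by
    intro n I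
    induction n with
    | zero => simp [word_zero]
    | succ n ih =>
      obtain ⟨i, I, rfl⟩ := exists_cons I
      rw [word_cons, mul_assoc, ih, ← mul_assoc, fγ_fa, mul_assoc]
  have h1 : ∀ I : Fin n → ι, word (fγ (k := k)) I (fa a ψ) = fa a (word fγ I ψ) :=
    fun I => LinearMap.congr_fun (h I) ψ
  simpa [map_sum, h1] using congrArg (fa a) (hψ n c hc)

/-- A relation of length `n` multiplied by `γᵢ` on the right is a relation of length `n + 1`, by the
factorization with `A_{1→n} ⊗ 1` on the left. -/
theorem fγ_mem (i : ι) : fγ i ∈ B.fockOps := by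
  intro ψ hψ n c hc
  -- The coefficients are `c ⊗ eᵢ`, with `eᵢ` in the last space.
  have h := hψ (n + 1) (fun I => if I (Fin.last n) = i then c (Fin.init I) else 0) (by
    have h0 : (fun I : Fin (n + 1) → ι => if I (Fin.last n) = i then c (Fin.init I) else 0) ᵥ*
        shiftR (antisymmetrizer B.σ n) = 0 := by
      ext J
      obtain ⟨J, j, rfl⟩ := exists_snoc J
      rw [shiftR_vecMul_snoc, hc]
      simp
    rw [antisymmetrizer_eq_Mm, ← Matrix.vecMul_vecMul, h0, Matrix.zero_vecMul])
  rw [sum_snoc] at h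
  simp only [Fin.snoc_last, Fin.init_snoc, ite_smul, zero_smul] at h
  rw [Finset.sum_eq_single i (by simp +contextual) (by simp)] at h
  simpa [word_snoc] using h

/-- Moving `u` to the left of a `γ`-word produces words in `r`, with which the antisymmetrizer is
intertwined. -/
theorem fu_mem (u : U) : B.fu u ∈ B.fockOps := by
  intro ψ hψ n c hc
  have h1 : ∀ I : Fin n → ι, word (fγ (k := k)) I (B.fu u ψ) =
      ∑ K, B.fu (P.dualLact (gword B.rT n I K) u) (word fγ K ψ) := fun I => by
    simpa using LinearMap.congr_fun (B.word_γ_mul_u B.fu (fun i u => B.fγ_fu u i) I u) ψ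
  have h2 := (hψ n).sum_apply_eq_zero
    (B.fu ∘ₗ (P.dualLactₗ.flip u)) (z := fun K => ∑ I, c I • gword B.rT n I K) (by
      intro J
      simp only [Finset.smul_sum, smul_comm _ (c _)]
      rw [Finset.sum_comm]
      simp only [← Finset.smul_sum, intertwines_antisymmetrizer B.σ B.intertwines_r n _ J]
      simp only [Finset.smul_sum, smul_smul]
      rw [Finset.sum_comm]
      simp only [← Finset.sum_smul]
      refine Finset.sum_eq_zero fun K _ => ?_
      have := congrFun hc K
      simp only [Matrix.vecMul, dotProduct, Pi.zero_apply] at this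
      rw [this, zero_smul])
  simp only [h1, Finset.smul_sum]
  rw [Finset.sum_comm]
  simpa [HopfDuality.dualLactₗ_apply, LinearMap.sum_apply] using h2

theorem word_fγ_fω (j : ι) {n : ℕ} (I : Fin (n + 1) → ι) :
    word (fγ (k := k)) I * B.fω j = (-1 : k) ^ (n + 1) • (B.fω j * word fγ I) +
      (-1 : k) ^ n • ∑ p, ∑ L : Fin n → ι, Bm B.σ n I (Fin.cons p L) •
        (B.fu (B.f j p) * word fγ L) := by
  have h := @word_mul_ω k _ ι _ _ B.σ (Module.End k (Fun k A ι)) _ _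
  have h1 := @h B.fω (fγ (k:=k)) 
  have h2 := @h1 (fun i j => B.fu (B.f i j))
  have h3 := h2 B.fγ_fω
  have h4 := h3 (fun i j l => B.fγ_fu_f i j l)
  exact h4 j I

/-- The contraction term carries the coefficients `c Bm`, which are killed by `1 ⊗ A_{1→n}` because
of the defining recursion of the antisymmetrizer. -/
theorem fω_mem (j : ι) : B.fω j ∈ B.fockOps := by
  intro ψ hψ n c hc
  match n with
  | 0 =>
    simp only [antisymmetrizer, Matrix.vecMul_one] at hc
    simp [hc]
  | n + 1 =>
    have h1 : ∀ I : Fin (n + 1) → ι, word (fγ (k := k)) I (B.fω j ψ) =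
        (-1 : k) ^ (n + 1) • B.fω j (word fγ I ψ) + (-1 : k) ^ n • ∑ p, ∑ L : Fin n → ι,
          Bm B.σ n I (Fin.cons p L) • B.fu (B.f j p) (word fγ L ψ) := fun I => by
      have h0 := B.word_fγ_fω j I
      have h := LinearMap.congr_fun h0 ψ
      simp only [LinearMap.add_apply, LinearMap.smul_apply, LinearMap.sum_apply,
        Module.End.mul_apply] at h
      exact h
    have h2 : ∀ p, ∑ L : Fin n → ι, (c ᵥ* Bm B.σ n) (Fin.cons p L) • word (fγ (k := k)) L ψ = 0 := by
      intro p
      refine hψ n _ ?_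
      ext J
      rw [← vecMul_shift_cons, Matrix.vecMul_vecMul, ← antisymmetrizer_succ, hc]
      rfl
    have h3 : ∑ I, c I • ∑ p, ∑ L : Fin n → ι,
          Bm B.σ n I (Fin.cons p L) • B.fu (B.f j p) (word (fγ (k := k)) L ψ) = 0 := by
      have h4 : ∀ p, ∑ I, c I • ∑ L : Fin n → ι,
          Bm B.σ n I (Fin.cons p L) • B.fu (B.f j p) (word (fγ (k := k)) L ψ) = 0 := by
        intro p
        have h5 := congrArg (B.fu (B.f j p)) (h2 p)
        rw [map_zero, map_sum] at h5
        rw [← h5]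
        simp only [Finset.smul_sum, smul_smul]
        rw [Finset.sum_comm]
        refine Finset.sum_congr rfl fun L _ => ?_
        rw [map_smul, ← Finset.sum_smul]
        rfl
      refine Eq.trans ?_ (Finset.sum_eq_zero fun p (_ : p ∈ Finset.univ) => h4 p)
      rw [Finset.sum_comm]
      simp only [Finset.smul_sum]
    have h5 := congrArg (B.fω j) (hψ (n + 1) c hc)
    rw [map_zero, map_sum] at h5
    simp only [map_smul] at h5
    simp only [h1, smul_add, Finset.sum_add_distrib, smul_comm (c _) ((-1 : k) ^ _),
      ← Finset.smul_sum, h5, h3, smul_zero, add_zero]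

/-- The action of `A` as operators which preserve `fockSub`. -/
def faS : A →ₐ[k] B.fockOps := fa.codRestrict B.fockOps B.fa_mem

/-- The action of `ωⁱ` as an operator which preserves `fockSub`. -/
def fωS (i : ι) : B.fockOps := ⟨B.fω i, B.fω_mem i⟩

/-- The action of `γᵢ` as an operator which preserves `fockSub`. -/
def fγS (i : ι) : B.fockOps := ⟨fγ i, B.fγ_mem i⟩

/-- The action of `U` as operators which preserve `fockSub`. -/
def fuS : U →ₐ[k] B.fockOps :=
  AlgHom.ofLinearMap (B.fu.codRestrict (Subalgebra.toSubmodule B.fockOps) B.fu_mem)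
    (Subtype.ext B.fu_one) (fun u v => Subtype.ext (B.fu_mul u v))

/-- The Fock representation on generators of `Γ^∧`. -/
def fockExtGen : ExtGen k A ι →ₐ[k] B.fockOps :=
  TensorAlgebra.lift k (LinearMap.coprod B.faS.toLinearMap (Fintype.linearCombination k B.fωS))

theorem fockExtGen_a (a : A) : B.fockExtGen (ExtGen.a a) = B.faS a := by
  simp [fockExtGen, ExtGen.a]

theorem fockExtGen_ω (i : ι) : B.fockExtGen (ExtGen.ω i) = B.fωS i := by
  simp [fockExtGen, ExtGen.ω, Fintype.linearCombination_apply_single]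

/-- The Fock representation of `Γ^∧`. -/
def fockExt : B.Ext →ₐ[k] B.fockOps :=
  RingQuot.liftAlgHom k ⟨B.fockExtGen, by
    intro x y h
    induction h with
    | one => simp [fockExtGen_a]
    | mul a b => simp [fockExtGen_a]
    | bimodule i a =>
      simp only [map_mul, map_sum, fockExtGen_a, fockExtGen_ω]
      refine Subtype.ext ?_
      rw [AddSubmonoidClass.coe_finsetSum]
      exact B.fω_fa i a
    | wedge n c hc =>
      simp only [map_sum, map_smul, map_word, fockExtGen_ω, map_zero]
      refine Subtype.ext ?_
      have h := B.rowKer_word_fω n c hc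
      rw [AddSubmonoidClass.coe_finsetSum]
      refine Eq.trans (Finset.sum_congr rfl fun J _ => ?_) h
      exact congrArg (c J • ·) (map_word B.fockOps.val B.fωS J)⟩

theorem fockExt_a (a : A) : B.fockExt (B.extA a) = B.faS a := by
  rw [← fockExtGen_a]
  exact RingQuot.liftAlgHom_mkAlgHom_apply k _ _ _

theorem fockExt_ω (i : ι) : B.fockExt (B.extω i) = B.fωS i := by
  rw [← fockExtGen_ω]
  exact RingQuot.liftAlgHom_mkAlgHom_apply k _ _ _

/-- The Fock representation on generators of `Γ^∧*`. -/
def fockDualGen : ExtGen k U ι →ₐ[k] B.fockOps :=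
  TensorAlgebra.lift k (LinearMap.coprod B.fuS.toLinearMap (Fintype.linearCombination k B.fγS))

theorem fockDualGen_a (u : U) : B.fockDualGen (ExtGen.a u) = B.fuS u := by
  simp [fockDualGen, ExtGen.a]

theorem fockDualGen_ω (i : ι) : B.fockDualGen (ExtGen.ω i) = B.fγS i := by
  simp [fockDualGen, ExtGen.ω, Fintype.linearCombination_apply_single]

/-- The Fock representation of `Γ^∧*`. -/
def fockDual : B.DualExt →ₐ[k] Module.End k B.fockSub :=
  RingQuot.liftAlgHom k ⟨B.fockRes.comp B.fockDualGen, by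
    intro x y h
    induction h with
    | one => simp [fockDualGen_a]
    | mul a b => simp [fockDualGen_a]
    | bimodule i u =>
      simp only [AlgHom.comp_apply]
      congr 1
      simp only [map_mul, map_sum, fockDualGen_a, fockDualGen_ω]
      refine Subtype.ext ?_
      rw [AddSubmonoidClass.coe_finsetSum]
      exact B.fγ_fu u i
    | wedge n c hc =>
      simp only [AlgHom.comp_apply, map_sum, map_smul, map_word, fockDualGen_ω, map_zero]
      ext1 v
      refine Subtype.ext ?_
      rw [LinearMap.sum_apply, AddSubmonoidClass.coe_finsetSum]
      refine Eq.trans (Finset.sum_congr rfl fun J _ => ?_) (v.2 n c hc)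
      have h := map_word B.fockOps.val B.fγS J
      have h2 := map_word B.fockRes B.fγS J
      rw [LinearMap.smul_apply, ← h2, Submodule.coe_smul, fockRes_apply]
      exact congrArg (fun T : Module.End k (Fun k A ι) => c J • T v.1) h⟩

theorem fockDual_u (u : U) : B.fockDual (B.dualU u) = B.fockRes (B.fuS u) := by
  rw [← fockDualGen_a]
  exact RingQuot.liftAlgHom_mkAlgHom_apply k _ _ _

theorem fockDual_γ (i : ι) : B.fockDual (B.dualγ i) = B.fockRes (B.fγS i) := by
  rw [← fockDualGen_ω]
  exact RingQuot.liftAlgHom_mkAlgHom_apply k _ _ _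

/-- The Fock representation on generators of the Heisenberg double. -/
def fockGen : B.HGen →ₐ[k] Module.End k B.fockSub :=
  TensorAlgebra.lift k (LinearMap.coprod (B.fockRes.comp B.fockExt).toLinearMap
    B.fockDual.toLinearMap)

theorem fockGen_L (x : B.Ext) : B.fockGen (B.hgenL x) = B.fockRes (B.fockExt x) := by
  simp [fockGen, hgenL]

theorem fockGen_R (y : B.DualExt) : B.fockGen (B.hgenR y) = B.fockDual y := by
  simp [fockGen, hgenR]

/-- The Fock representation of the Heisenberg double. -/
def fock : B.Heis →ₐ[k] Module.End k B.fockSub :=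
  RingQuot.liftAlgHom k ⟨B.fockGen, by
    intro x y h
    induction h with
    | one_left => simp [fockGen_L]
    | mul_left x y => simp [fockGen_L]
    | one_right => simp [fockGen_R]
    | mul_right x y => simp [fockGen_R]
    | u_a u a =>
      have h1 : ∀ t : U ⊗[k] U, B.fockGen (LinearMap.mul' k B.HGen
          (TensorProduct.map (B.hgenL ∘ₗ B.extA.toLinearMap ∘ₗ P.lact.flip a)
            (B.hgenR ∘ₗ B.dualU.toLinearMap) t)) = B.fockRes (LinearMap.mul' k B.fockOps
          (TensorProduct.map (B.faS.toLinearMap ∘ₗ P.lact.flip a) B.fuS.toLinearMap t)) := by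
        intro t
        induction t with
        | zero => simp
        | add s t hs ht => simp only [map_add, hs, ht]
        | tmul x y => simp [fockGen_L, fockGen_R, fockExt_a, fockDual_u]
      have h2 : ∀ t : U ⊗[k] U, (LinearMap.mul' k B.fockOps
          (TensorProduct.map (B.faS.toLinearMap ∘ₗ P.lact.flip a) B.fuS.toLinearMap t)).1 =
          LinearMap.mul' k (Module.End k (Fun k A ι))
            (TensorProduct.map ((fa (ι := ι) (k := k)).toLinearMap ∘ₗ P.lact.flip a) B.fu t) := by
        intro t
        induction t with
        | zero => simp
        | add s t hs ht => simp only [map_add, ← hs, ← ht]; rfl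
        | tmul x y => rfl
      rw [h1]
      simp only [map_mul, fockGen_L, fockGen_R, fockExt_a, fockDual_u]
      rw [← map_mul]
      congr 1
      refine Subtype.ext ?_
      rw [h2]
      exact B.fu_fa u a
    | u_ω u j =>
      simp only [map_mul, map_sum, fockGen_L, fockGen_R, fockExt_ω, fockDual_u]
      simp only [← map_mul, ← map_sum]
      congr 1
      refine Subtype.ext ?_
      rw [AddSubmonoidClass.coe_finsetSum]
      exact B.fu_fω u j
    | γ_a i a =>
      simp only [map_mul, fockGen_L, fockGen_R, fockExt_a, fockDual_γ]
      rfl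
    | γ_ω i j =>
      simp only [map_mul, map_add, map_neg, fockGen_L, fockGen_R, fockExt_ω, fockDual_u,
        fockDual_γ]
      rfl⟩

theorem fock_form (x : B.Ext) : B.fock (B.form x) = B.fockRes (B.fockExt x) := by
  rw [← fockGen_L]
  exact RingQuot.liftAlgHom_mkAlgHom_apply k _ _ _

theorem fock_dual (y : B.DualExt) : B.fock (B.dual y) = B.fockDual y := by
  rw [← fockGen_R]
  exact RingQuot.liftAlgHom_mkAlgHom_apply k _ _ _

/-- The vacuum. -/
def fockVac : B.fockSub :=
  ⟨fun L => match L with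
    | [] => 1
    | _ :: _ => 0, by
    intro n c hc
    match n with
    | 0 =>
      simp only [antisymmetrizer, Matrix.vecMul_one] at hc
      simp [hc]
    | n + 1 =>
      refine Finset.sum_eq_zero fun I _ => ?_
      obtain ⟨I, i, rfl⟩ := exists_snoc I
      change c (snoc' I i) • word (fγ (k := k)) (snoc' I i) _ = 0
      rw [word_snoc, Module.End.mul_apply]
      have h : fγ (k := k) (A := A) i (fun L => match L with
        | [] => 1
        | _ :: _ => 0) = 0 := rfl
      rw [h, map_zero, smul_zero]⟩

/-- The action on the vacuum. -/
def vac : B.Heis →ₗ[k] B.fockSub := (LinearMap.applyₗ B.fockVac) ∘ₗ B.fock.toLinearMap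

theorem vac_mul (x y : B.Heis) : B.vac (x * y) = B.fock x (B.vac y) := by
  simp [vac]

theorem vac_mul_hγ (x : B.Heis) (i : ι) : B.vac (x * B.hγ i) = 0 := by
  have h : B.vac (B.hγ i) = 0 := by
    change B.fock (B.dual (B.dualγ i)) B.fockVac = 0
    rw [fock_dual, fockDual_γ]
    rfl
  rw [vac_mul, h, map_zero]

theorem fu_vac (u : U) : B.fu u B.fockVac.1 = Coalgebra.counit (R := k) u • B.fockVac.1 := by
  ext L
  match L with
  | [] =>
    rw [fu_nil]
    exact P.lact_one_right u
  | i :: L =>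
    rw [fu_cons]
    change _ = Coalgebra.counit (R := k) u • (0 : A)
    refine (Finset.sum_eq_zero fun j _ => ?_).trans (smul_zero _).symm
    have h : fγ (k := k) (A := A) j B.fockVac.1 = 0 := rfl
    rw [h, map_zero]
    rfl

theorem vac_mul_hU (x : B.Heis) (u : U) :
    B.vac (x * B.hU u) = Coalgebra.counit (R := k) u • B.vac x := by
  have h : B.vac (B.hU u) = Coalgebra.counit (R := k) u • B.fockVac := by
    change B.fock (B.dual (B.dualU u)) B.fockVac = _
    rw [fock_dual, fockDual_u]
    exact Subtype.ext (B.fu_vac u)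
  rw [vac_mul, h, map_smul]
  rfl

theorem vac_hA_nil (a : A) : (B.vac (B.hA a)).1 [] = a := by
  change (B.fock (B.form (B.extA a)) B.fockVac).1 [] = a
  rw [fock_form, fockExt_a]
  exact mul_one a

theorem vac_hω_mul_nil (i : ι) (x : B.Heis) : (B.vac (B.hω i * x)).1 [] = 0 := by
  rw [vac_mul]
  change (B.fock (B.form (B.extω i)) _).1 [] = 0
  rw [fock_form, fockExt_ω]
  rfl

/-- A vector of the Fock space vanishes if its vacuum coefficient vanishes and all `γᵢ` annihilate
it. -/
theorem vac_eq_zero {x : B.Heis} (h : (B.vac x).1 [] = 0) (hγ : ∀ i, B.vac (B.hγ i * x) = 0) :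
    B.vac x = 0 := by
  refine Subtype.ext (funext fun L => ?_)
  match L with
  | [] => exact h
  | i :: L =>
    have h1 := hγ i
    rw [vac_mul] at h1
    change B.fock (B.dual (B.dualγ i)) _ = 0 at h1
    rw [fock_dual, fockDual_γ] at h1
    exact congrFun (congrArg Subtype.val h1) L

end BicovariantBimodule
end Fock

/-! ### The Heisenberg double -/

section Heisenberg

variable {k : Type*} [Field k] {A : Type*} [Ring A] [HopfAlgebra k A]
  {U : Type*} [Ring U] [HopfAlgebra k U] {P : HopfDuality k A U}
  {ι : Type*} [Fintype ι] [DecidableEq ι]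

namespace BicovariantBimodule

variable (B : BicovariantBimodule P ι)

/-- The inclusion of `U` in the Heisenberg double as an algebra map. -/
def hUₐ : U →ₐ[k] B.Heis := B.dual.comp B.dualU

/-- The inclusion of `A` in the Heisenberg double as an algebra map. -/
def hAₐ : A →ₐ[k] B.Heis := B.form.comp B.extA

theorem hU_mul (u v : U) : B.hU (u * v) = B.hU u * B.hU v := map_mul B.hUₐ u v

theorem hU_one : B.hU 1 = 1 := map_one B.hUₐ

theorem hU_zero : B.hU 0 = 0 := map_zero B.hUₐ

theorem hU_add (u v : U) : B.hU (u + v) = B.hU u + B.hU v := map_add B.hUₐ u v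

theorem hU_smul (c : k) (u : U) : B.hU (c • u) = c • B.hU u := map_smul B.hUₐ c u

theorem hU_sum {κ : Type*} (s : Finset κ) (u : κ → U) :
    B.hU (∑ x ∈ s, u x) = ∑ x ∈ s, B.hU (u x) := map_sum B.hUₐ u s

theorem hU_ite_one (p : Prop) [Decidable p] : B.hU (if p then 1 else 0) = if p then 1 else 0 := by
  split_ifs
  exacts [B.hU_one, B.hU_zero]

theorem hA_mul (a b : A) : B.hA (a * b) = B.hA a * B.hA b := map_mul B.hAₐ a b

theorem hA_one : B.hA 1 = 1 := map_one B.hAₐ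

theorem hA_zero : B.hA 0 = 0 := map_zero B.hAₐ

theorem hA_add (a b : A) : B.hA (a + b) = B.hA a + B.hA b := map_add B.hAₐ a b

theorem hA_smul (c : k) (a : A) : B.hA (c • a) = c • B.hA a := map_smul B.hAₐ c a

theorem hA_sum {κ : Type*} (s : Finset κ) (a : κ → A) :
    B.hA (∑ x ∈ s, a x) = ∑ x ∈ s, B.hA (a x) := map_sum B.hAₐ a s

theorem hγ_hU (i : ι) (u : U) :
    B.hγ i * B.hU u = ∑ j, B.hU (P.dualLact (B.r j i) u) * B.hγ j := by
  have h := congrArg B.dual (B.dualMk_rel (DualRel.bimodule i u))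
  simp only [map_mul, map_sum] at h
  exact h

theorem hU_hω (u : U) (j : ι) :
    B.hU u * B.hω j = ∑ l, B.hω l * B.hU (P.dualRact u (B.r j l)) := by
  have h := B.heisMk_rel (HRel.u_ω u j)
  simp only [map_mul, map_sum] at h
  exact h

theorem hγ_hA (i : ι) (a : A) : B.hγ i * B.hA a = B.hA a * B.hγ i := by
  have h := B.heisMk_rel (HRel.γ_a i a)
  simp only [map_mul] at h
  exact h

theorem hγ_hω (i j : ι) : B.hγ i * B.hω j = -(B.hω j * B.hγ i) + B.hU (B.f j i) := by
  have h := B.heisMk_rel (HRel.γ_ω i j)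
  simp only [map_mul, map_add, map_neg] at h
  exact h

theorem hω_hA (i : ι) (a : A) : B.hω i * B.hA a = ∑ j, B.hA (P.lact (B.f i j) a) * B.hω j := by
  have h := congrArg B.form (B.extA_bimodule i a)
  simp only [map_mul, map_sum] at h
  exact h

theorem rowKer_word_hω (n : ℕ) : RowKer (antisymmetrizer B.σ n) (fun J => word B.hω J) := by
  intro c hc
  have h := congrArg B.form (B.ext_wedge n c hc)
  simp only [map_sum, map_smul, map_word, map_zero] at h
  exact h

theorem colKer_word_hγ (n : ℕ) : ColKer (antisymmetrizer B.σ n) (fun J => word B.hγ J) := by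
  intro c hc
  have h := congrArg B.dual (B.dualMk_rel (DualRel.wedge n c hc))
  simp only [map_sum, map_smul, map_word, map_zero] at h
  exact h

theorem hU_hA_of_comul {κ : Type*} [Fintype κ] {u : U} {x y : κ → U}
    (hu : Coalgebra.comul (R := k) u = ∑ l, x l ⊗ₜ[k] y l) (a : A) :
    B.hU u * B.hA a = ∑ l, B.hA (P.lact (x l) a) * B.hU (y l) := by
  rw [heis_u_a, hu]
  simp [hA, hU]

theorem hU_f_hA (i j : ι) (a : A) :
    B.hU (B.f i j) * B.hA a = ∑ l, B.hA (P.lact (B.f i l) a) * B.hU (B.f l j) :=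
  B.hU_hA_of_comul (B.comul_f i j) a

theorem hU_f_hω (i j l : ι) :
    B.hU (B.f j i) * B.hω l = ∑ a, ∑ b, B.σ (a, b) (j, l) • (B.hω a * B.hU (B.f b i)) := by
  rw [hU_hω]
  refine Finset.sum_congr rfl fun a _ => ?_
  simp only [dualRact_f, hU_sum, hU_smul, Finset.mul_sum, mul_smul_comm]
  rfl

theorem hγ_hU_f (i j l : ι) :
    B.hγ i * B.hU (B.f j l) = ∑ a, ∑ b, B.σ (i, l) (a, b) • (B.hU (B.f j a) * B.hγ b) := by
  rw [hγ_hU, Finset.sum_comm]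
  refine Finset.sum_congr rfl fun a _ => ?_
  simp only [dualLact_f, hU_sum, hU_smul, Finset.sum_mul, smul_mul_assoc]
  rfl

theorem word_hγ_hA {n : ℕ} (I : Fin n → ι) (a : A) :
    word B.hγ I * B.hA a = B.hA a * word B.hγ I := by
  induction n with
  | zero => simp [word_zero]
  | succ n ih =>
    obtain ⟨i, I, rfl⟩ := exists_cons I
    rw [word_cons, mul_assoc, ih, ← mul_assoc, hγ_hA, mul_assoc]

theorem word_hω_hA {n : ℕ} (I : Fin n → ι) (a : A) :
    word B.hω I * B.hA a = ∑ K, B.hA (P.lact (gword B.fT n K I) a) * word B.hω K := by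
  induction n generalizing a with
  | zero => simp [sum_fin_zero, word_zero, gword_zero, P.lact_one]
  | succ n ih =>
    obtain ⟨i, I, rfl⟩ := exists_cons I
    rw [word_cons, mul_assoc, ih, Finset.mul_sum, sum_cons, Finset.sum_comm]
    refine Finset.sum_congr rfl fun K _ => ?_
    rw [← mul_assoc, hω_hA, Finset.sum_mul]
    simp only [gword_cons, word_cons, P.lact_mul, mul_assoc]

/-! ### The action on the vacuum -/

theorem vac_congr {x y : B.Heis} (h : B.vac x = B.vac y) (z : B.Heis) :
    B.vac (z * x) = B.vac (z * y) := by
  rw [vac_mul, h, ← vac_mul]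

/-- In `u a = (u₍₁₎ ▷ a) u₍₂₎` the factor `u₍₂₎` reaches the vacuum and becomes its counit. -/
theorem vac_hU_hA (x : B.Heis) (u : U) (a : A) :
    B.vac (x * (B.hU u * B.hA a)) = B.vac (x * B.hA (P.lact u a)) := by
  refine B.vac_congr ?_ x
  have h : ∀ t : U ⊗[k] U, B.vac (LinearMap.mul' k B.Heis
      (TensorProduct.map (B.form.toLinearMap ∘ₗ B.extA.toLinearMap ∘ₗ P.lact.flip a)
        (B.dual.toLinearMap ∘ₗ B.dualU.toLinearMap) t)) =
      B.vac (B.hA (P.lact (TensorProduct.rid k U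
        ((Coalgebra.counit (R := k)).lTensor U t)) a)) := by
    intro t
    induction t with
    | zero => simp [hA_zero]
    | add s t hs ht => simp only [map_add, hs, ht, LinearMap.add_apply, hA_add]
    | tmul x y =>
      have h1 := B.vac_mul_hU (B.hA (P.lact x a)) y
      rw [TensorProduct.map_tmul, LinearMap.mul'_apply, LinearMap.lTensor_tmul,
        TensorProduct.rid_tmul, map_smul, LinearMap.smul_apply, hA_smul, map_smul]
      exact h1
  rw [heis_u_a, h, Coalgebra.lTensor_counit_comul]
  simp

/-- The sign `(-1)^{n (n - 1) / 2}`. -/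
def sgn (k : Type*) [Field k] : ℕ → k
  | 0 => 1
  | n + 1 => (-1) ^ n * sgn k n

theorem sgn_mul_self (n : ℕ) : sgn k n * sgn k n = 1 := by
  induction n with
  | zero => simp [sgn]
  | succ n ih =>
    rw [sgn, mul_mul_mul_comm, ih, ← mul_pow]
    simp

theorem vac_hγ_word_hω (x : B.Heis) (j : ι) {n : ℕ} (K : Fin (n + 1) → ι) :
    B.vac (x * (B.hγ j * word B.hω K)) =
      (-1 : k) ^ n • ∑ L : Fin n → ι, Mm B.σ n (snoc' L j) K • B.vac (x * word B.hω L) := by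
  rw [γ_mul_word B.σ (f := fun i j => B.hU (B.f i j)) B.hU_f_hω B.hγ_hω j K]
  simp only [mul_add, mul_smul_comm, map_add, map_smul, ← mul_assoc, vac_mul_hγ, smul_zero,
    zero_add, Finset.mul_sum, map_sum, vac_mul_hU, B.counit_f]
  congr 1
  refine Finset.sum_congr rfl fun L _ => ?_
  rw [Finset.sum_eq_single j (fun b _ hb => by simp [hb]) (by simp)]
  simp

/-- The innermost `γ` contracts with the word through `Mm` and the other letters give `A_{1→n}` by
induction; the product of the two is `A_{1→n+1}`. The antisymmetrizer is therefore the Gram matrix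
of the two kinds of words. -/
theorem vac_word_hγ_word_hω (x : B.Heis) {n : ℕ} (J K : Fin n → ι) :
    B.vac (x * (word B.hγ J * word B.hω K)) =
      (sgn k n * antisymmetrizer B.σ n J K) • B.vac x := by
  induction n generalizing x with
  | zero => simp [word_zero, sgn, antisymmetrizer, Subsingleton.elim J K, Matrix.one_apply]
  | succ n ih =>
    obtain ⟨J, j, rfl⟩ := exists_snoc J
    rw [word_snoc, mul_assoc, ← mul_assoc, vac_hγ_word_hω, antisymmetrizer_eq_Mm,
      Matrix.mul_apply, sum_snoc]
    simp only [mul_assoc, ih, shiftR_snoc, smul_smul, ← Finset.sum_smul, Finset.mul_sum, ite_mul,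
      zero_mul, sgn]
    rw [Finset.sum_eq_single j (fun b _ hb => by simp [Ne.symm hb]) (by simp)]
    congr 1
    refine Finset.sum_congr rfl fun L _ => ?_
    simp only [if_true]
    ring

theorem vac_word_hγ_word_hω_of_lt (x : B.Heis) {m n : ℕ} (hmn : n < m) (J : Fin m → ι)
    (K : Fin n → ι) : B.vac (x * (word B.hγ J * word B.hω K)) = 0 := by
  induction n generalizing x m with
  | zero =>
    obtain ⟨m, rfl⟩ : ∃ q, m = q + 1 := ⟨m - 1, by omega⟩
    obtain ⟨J, j, rfl⟩ := exists_snoc J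
    rw [word_zero, mul_one, word_snoc, ← mul_assoc, vac_mul_hγ]
  | succ n ih =>
    obtain ⟨m, rfl⟩ : ∃ q, m = q + 1 := ⟨m - 1, by omega⟩
    obtain ⟨J, j, rfl⟩ := exists_snoc J
    rw [word_snoc, mul_assoc, ← mul_assoc, vac_hγ_word_hω]
    simp only [mul_assoc, ih _ (by omega : n < m), smul_zero, Finset.sum_const_zero]

/-- The forms `ωᴵ` are free over `A`, up to the relations of the exterior product. -/
theorem antisymmetrizer_smul_eq_zero {n : ℕ} {a : (Fin n → ι) → A}
    (h : B.vac (∑ I, B.hA (a I) * word B.hω I) = 0) (J : Fin n → ι) :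
    ∑ I, antisymmetrizer B.σ n J I • a I = 0 := by
  have h1 : B.vac (word B.hγ J * ∑ I, B.hA (a I) * word B.hω I) = 0 := by
    rw [vac_mul, h, map_zero]
  have h2 : ∀ I, B.vac (word B.hγ J * (B.hA (a I) * word B.hω I)) =
      (sgn k n * antisymmetrizer B.σ n J I) • B.vac (B.hA (a I)) := by
    intro I
    rw [← vac_word_hγ_word_hω, ← mul_assoc, word_hγ_hA, mul_assoc]
  rw [Finset.mul_sum, map_sum] at h1
  simp only [h2, mul_smul, ← Finset.smul_sum] at h1
  have h3 : ∑ I, antisymmetrizer B.σ n J I • B.vac (B.hA (a I)) = 0 := by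
    have := congrArg (fun v => sgn k n • v) h1
    simpa [smul_smul, sgn_mul_self] using this
  have h4 : B.vac (B.hA (∑ I, antisymmetrizer B.σ n J I • a I)) = 0 := by
    simpa [hA_sum, hA_smul] using h3
  rw [← B.vac_hA_nil (∑ I, _), h4]
  rfl

theorem coeff_eq_of_vac {a b : ι → A}
    (h : B.vac (∑ i, B.hA (a i) * B.hω i) = B.vac (∑ i, B.hA (b i) * B.hω i)) : a = b := by
  have h1 : ∀ c : ι → A, ∑ I : Fin 1 → ι, B.hA (c (I 0)) * word B.hω I =
      ∑ i, B.hA (c i) * B.hω i := by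
    intro c
    rw [sum_cons]
    simp [sum_fin_zero, word_cons, word_zero]
  rw [← h1, ← h1, ← sub_eq_zero, ← map_sub, ← Finset.sum_sub_distrib] at h
  have h2 : ∀ I : Fin 1 → ι, B.hA (a (I 0)) * word B.hω I - B.hA (b (I 0)) * word B.hω I =
      B.hA (a (I 0) - b (I 0)) * word B.hω I := fun I => by
    rw [← sub_mul]
    exact congrArg (· * _) (map_sub B.hAₐ _ _).symm
  simp only [h2] at h
  ext i
  have h3 := B.antisymmetrizer_smul_eq_zero h (fun _ => i)
  have h4 : antisymmetrizer B.σ 1 = 1 := by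
    rw [antisymmetrizer_succ, Bm_zero, antisymmetrizer, shift_one, mul_one]
  rw [h4] at h3
  simp only [Matrix.one_apply, ite_smul, one_smul, zero_smul, Finset.sum_ite_eq,
    Finset.mem_univ, if_true] at h3
  exact sub_eq_zero.mp h3

/-- An element `∑ ωᴵ u_I` vanishes if it annihilates the vectors `a |0⟩`. -/
theorem sum_word_hω_mul_hU_eq_zero
    (hS : Function.Bijective (HopfAlgebra.antipode k (A := U))) {n : ℕ} {u : (Fin n → ι) → U}
    (h : ∀ a, B.vac ((∑ I, word B.hω I * B.hU (u I)) * B.hA a) = 0) :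
    ∑ I, word B.hω I * B.hU (u I) = 0 := by
  -- On `a |0⟩` the element `u_I` acts as `u_I ▷ a`, which passes to the left of `ω^I` and picks up
  -- a word in `f`.
  have h1 : ∀ a, B.vac (∑ K, B.hA (P.lact (∑ I, gword B.fT n K I * u I) a) * word B.hω K) = 0 := by
    intro a
    rw [← h a, Finset.sum_mul]
    simp only [mul_assoc, map_sum (B.vac), vac_hU_hA, word_hω_hA, ← P.lact_mul]
    rw [Finset.sum_comm]
    simp only [map_sum, LinearMap.sum_apply, hA_sum, Finset.sum_mul]
  have h2 : ∀ J, ∑ K, antisymmetrizer B.σ n J K • ∑ I, gword B.fT n K I * u I = 0 := by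
    intro J
    refine P.lact_injective fun a => ?_
    have := B.antisymmetrizer_smul_eq_zero (h1 a) J
    simpa only [map_sum, map_smul, LinearMap.sum_apply, LinearMap.smul_apply] using this
  -- The antisymmetrizer intertwines the words in `f` and so passes through them; these words are
  -- then cancelled with the inverse matrix `S⁻¹(f)`.
  have h3 : ∀ J, ∑ L, gword B.fT n J L * ∑ I, antisymmetrizer B.σ n L I • u I = 0 := by
    intro J
    rw [← h2 J]
    simp only [Finset.smul_sum, Finset.mul_sum, mul_smul_comm]
    rw [Finset.sum_comm]
    refine Eq.trans ?_ Finset.sum_comm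
    refine Finset.sum_congr rfl fun I _ => ?_
    simp only [← smul_mul_assoc, ← Finset.sum_mul]
    rw [intertwines_antisymmetrizer B.σ B.intertwines_f n J I]
  have h4 := gword_left_cancel (g := B.fT) (h := fun i j => sinv hS (B.f j i))
    (fun i j => (B.sinv_mul_f hS j i).trans (by simp only [eq_comm])) n _ h3
  refine (B.rowKer_word_hω n).sum_mul_eq_zero fun L => ?_
  simp only [← hU_smul, ← hU_sum]
  rw [congrFun h4 L]
  exact B.hU_zero

end BicovariantBimodule
end Heisenberg

section Omega

variable {k : Type*} [Field k] {A : Type*} [Ring A] [HopfAlgebra k A]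
  {U : Type*} [Ring U] [HopfAlgebra k U] {P : HopfDuality k A U}
  {ι : Type*} [Fintype ι] [DecidableEq ι]

namespace BicovariantBimodule

variable (B : BicovariantBimodule P ι)
  (hS : Function.Bijective (HopfAlgebra.antipode k (A := U)))

/-! ### The elements `Ωⁱ` -/

theorem Ω_eq (i : ι) : B.Ω hS i = ∑ j, B.hω j * B.hU (sinv hS (B.f i j)) := rfl

theorem hω_eq_sum_Ω (j : ι) : B.hω j = ∑ p, B.Ω hS p * B.hU (B.f j p) := by
  simp only [Ω_eq, Finset.sum_mul, mul_assoc, ← hU_mul]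
  rw [Finset.sum_comm]
  simp only [← Finset.mul_sum, ← hU_sum, sinv_mul_f, hU_ite_one]
  simp

/-- Multiply on the right by `S⁻¹(f)`. An identity for `Ω` can thus be checked after replacing `Ω`
by `ω`, where it is a defining relation. -/
theorem eq_zero_of_sum_mul_hU_f (hS : Function.Bijective (HopfAlgebra.antipode k (A := U)))
    {E : ι → B.Heis} (h : ∀ j, ∑ i, E i * B.hU (B.f j i) = 0) (i : ι) :
    E i = 0 := by
  have h1 : ∑ j, (∑ p, E p * B.hU (B.f j p)) * B.hU (sinv hS (B.f i j)) = E i := by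
    simp only [Finset.sum_mul, mul_assoc, ← hU_mul]
    rw [Finset.sum_comm]
    simp only [← Finset.mul_sum, ← hU_sum, f_mul_sinv, hU_ite_one]
    simp
  rw [← h1]
  simp [h]

/-- The factor `S⁻¹(f)` undoes the twist in `ωⁱ a = (fⁱⱼ ▷ a) ωʲ`. -/
theorem Ω_mul_hA (i : ι) (a : A) : B.Ω hS i * B.hA a = B.hA a * B.Ω hS i := by
  rw [← sub_eq_zero]
  refine B.eq_zero_of_sum_mul_hU_f hS (E := fun i => B.Ω hS i * B.hA a - B.hA a * B.Ω hS i) ?_ i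
  intro m
  have h1 : ∀ (j : ι) (b : A), ∑ q, ∑ p, (B.Ω hS p * B.hA (P.lact (B.f j q) b) -
      B.hA (P.lact (B.f j q) b) * B.Ω hS p) * B.hU (B.f q p) = 0 := by
    intro j b
    have h2 := B.hω_hA j b
    simp only [hω_eq_sum_Ω B hS, Finset.sum_mul, Finset.mul_sum, mul_assoc, hU_f_hA] at h2
    simp only [sub_mul, Finset.sum_sub_distrib, mul_assoc]
    rw [sub_eq_zero, ← h2, Finset.sum_comm]
  -- Taking `b = S⁻¹(f) ▷ a` and summing over `j` makes the twist `f ▷ b` collapse to `a`.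
  have h3 : ∑ j, ∑ q, ∑ p, (B.Ω hS p * B.hA (P.lact (B.f j q) (P.lact (sinv hS (B.f m j)) a)) -
      B.hA (P.lact (B.f j q) (P.lact (sinv hS (B.f m j)) a)) * B.Ω hS p) * B.hU (B.f q p) = 0 :=
    Finset.sum_eq_zero fun j _ => h1 j _
  simp only [← P.lact_mul] at h3
  rw [Finset.sum_comm] at h3
  have h4 : ∀ q, ∑ j, P.lact (B.f j q * sinv hS (B.f m j)) a = if m = q then a else 0 := by
    intro q
    rw [← LinearMap.sum_apply, ← map_sum, f_mul_sinv]
    split_ifs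
    · exact P.lact_one a
    · simp
  have h5 : ∀ q p, ∑ j, (B.Ω hS p * B.hA (P.lact (B.f j q * sinv hS (B.f m j)) a) -
      B.hA (P.lact (B.f j q * sinv hS (B.f m j)) a) * B.Ω hS p) * B.hU (B.f q p) =
      if m = q then (B.Ω hS p * B.hA a - B.hA a * B.Ω hS p) * B.hU (B.f q p) else 0 := by
    intro q p
    rw [← Finset.sum_mul, Finset.sum_sub_distrib, ← Finset.mul_sum, ← Finset.sum_mul, ← hA_sum, h4]
    split_ifs
    · rfl
    · simp [hA_zero]
  rw [Finset.sum_congr rfl fun q _ => Finset.sum_comm] at h3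
  simp only [h5] at h3
  rw [Finset.sum_eq_single m (fun b _ hb => by simp [Ne.symm hb]) (by simp)] at h3
  simpa using h3

/-- The rule for `u ω` in terms of the right action becomes one in terms of the left action, by
`compat_dual`. This matches the rule for `γ u`, so that `U` acts in the same way on both sides of a
tensor element. -/
theorem hU_mul_Ω (u : U) (i : ι) :
    B.hU u * B.Ω hS i = ∑ p, B.Ω hS p * B.hU (P.dualLact (B.r i p) u) := by
  rw [← sub_eq_zero]
  refine B.eq_zero_of_sum_mul_hU_f hS (E := fun i => B.hU u * B.Ω hS i -
    ∑ p, B.Ω hS p * B.hU (P.dualLact (B.r i p) u)) ?_ i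
  intro j
  have h := B.hU_hω u j
  simp only [hω_eq_sum_Ω B hS, Finset.sum_mul, Finset.mul_sum, mul_assoc, ← hU_mul] at h
  rw [Finset.sum_comm] at h
  simp only [← Finset.mul_sum, ← hU_sum, ← B.compat_dual] at h
  simp only [sub_mul, Finset.sum_sub_distrib, mul_assoc]
  rw [← Finset.mul_sum, h, sub_eq_zero]
  simp only [Finset.sum_mul, Finset.mul_sum, mul_assoc, hU_sum, hU_mul]
  rw [Finset.sum_comm]

theorem hU_f_mul_hγ (j p i : ι) : B.hU (B.f j p) * B.hγ i =
    ∑ l, ∑ n, B.σinv hS (p, i) (l, n) • (B.hγ l * B.hU (B.f j n)) := by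
  simp only [hγ_hU_f, Finset.smul_sum, smul_smul]
  have h : ∀ a b, ∑ l, ∑ n, B.σinv hS (p, i) (l, n) * B.σ (l, n) (a, b) =
      if (p, i) = (a, b) then 1 else 0 := by
    intro a b
    rw [← Matrix.one_apply, ← B.σinv_mul_σ hS, Matrix.mul_apply, Fintype.sum_prod_type]
  calc _ = ∑ a, ∑ b, (∑ l, ∑ n, B.σinv hS (p, i) (l, n) * B.σ (l, n) (a, b)) •
        (B.hU (B.f j a) * B.hγ b) := by
        simp only [h, Prod.mk.injEq, ite_smul, one_smul, zero_smul, ite_and]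
        simp
    _ = _ := by
        simp only [Finset.sum_smul]
        rw [Finset.sum_congr rfl fun a _ => Finset.sum_comm, Finset.sum_comm]
        refine Finset.sum_congr rfl fun l _ => ?_
        rw [Finset.sum_congr rfl fun a _ => Finset.sum_comm, Finset.sum_comm]

theorem hγ_mul_Ω (i n : ι) : B.hγ i * B.Ω hS n = (if i = n then 1 else 0) -
    ∑ p, ∑ l, B.σinv hS (p, i) (l, n) • (B.Ω hS p * B.hγ l) := by
  rw [← sub_eq_zero]
  refine B.eq_zero_of_sum_mul_hU_f hS (E := fun n => B.hγ i * B.Ω hS n - ((if i = n then 1 else 0) -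
    ∑ p, ∑ l, B.σinv hS (p, i) (l, n) • (B.Ω hS p * B.hγ l))) ?_ n
  intro j
  have h := B.hγ_hω i j
  simp only [hω_eq_sum_Ω B hS, Finset.sum_mul, Finset.mul_sum, mul_assoc, hU_f_mul_hγ B hS,
    mul_smul_comm] at h
  simp only [sub_mul, Finset.sum_sub_distrib, mul_assoc, Finset.sum_mul, smul_mul_assoc, ite_mul,
    one_mul, zero_mul]
  rw [h, Finset.sum_ite_eq, if_pos (Finset.mem_univ _), sub_sub_eq_add_sub]
  have h2 : ∑ n, ∑ p, ∑ l, B.σinv hS (p, i) (l, n) • (B.Ω hS p * (B.hγ l * B.hU (B.f j n))) =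
      ∑ p, ∑ l, ∑ n, B.σinv hS (p, i) (l, n) • (B.Ω hS p * (B.hγ l * B.hU (B.f j n))) := by
    rw [Finset.sum_comm]
    refine Finset.sum_congr rfl fun p _ => Finset.sum_comm
  rw [h2]
  abel

theorem revWord_Ω_mul_hA {n : ℕ} (I : Fin n → ι) (a : A) :
    revWord (B.Ω hS) I * B.hA a = B.hA a * revWord (B.Ω hS) I := by
  induction n with
  | zero => simp [revWord_zero]
  | succ n ih =>
    obtain ⟨i, I, rfl⟩ := exists_cons I
    rw [revWord_cons, mul_assoc, Ω_mul_hA, ← mul_assoc, ih, mul_assoc]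

theorem hU_mul_revWord_Ω (u : U) {n : ℕ} (I : Fin n → ι) :
    B.hU u * revWord (B.Ω hS) I =
      ∑ K, revWord (B.Ω hS) K * B.hU (P.dualLact (gword B.rT n K I) u) := by
  induction n with
  | zero => simp [sum_fin_zero, revWord_zero, gword_zero, P.one_dualLact]
  | succ n ih =>
    obtain ⟨i, I, rfl⟩ := exists_cons I
    rw [revWord_cons, ← mul_assoc, ih, Finset.sum_mul, sum_cons, Finset.sum_comm]
    refine Finset.sum_congr rfl fun K _ => ?_
    rw [mul_assoc, hU_mul_Ω, Finset.mul_sum]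
    simp only [gword_cons, revWord_cons, P.dualLact_dualLact, mul_assoc]

/-- The matrix of the contraction of `γ` with a product of the `Ωⁱ`. -/
def Minv : (n : ℕ) → Matrix (Fin (n + 1) → ι) (Fin (n + 1) → ι) k
  | 0 => 1
  | n + 1 => 1 - onLast n (B.σinv hS) * shiftR (Minv n)

theorem onLast_mul_shiftR_apply {n : ℕ} (X : Matrix (Fin (n + 1) → ι) (Fin (n + 1) → ι) k)
    (σ : Matrix (ι × ι) (ι × ι) k) (p j i : ι) (L : Fin n → ι) (I : Fin (n + 1) → ι) :
    (onLast n σ * shiftR X) (snoc' (snoc' L p) j) (snoc' I i) =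
      ∑ l, σ (p, j) (l, i) * X (snoc' L l) I := by
  rw [Matrix.mul_apply, sum_snoc, Finset.sum_eq_single i (fun b _ hb => by simp [shiftR_snoc, hb])
    (by simp), sum_snoc]
  refine Finset.sum_congr rfl fun l _ => ?_
  simp only [onLast_snoc, shiftR_snoc, if_true, ite_mul, zero_mul]
  rw [Finset.sum_eq_single L (fun b _ hb => by simp [Ne.symm hb]) (by simp)]
  simp

/-- Only the contraction is made explicit. The remainder lies in the left ideal generated by the
`γ`s, which `vac` kills, so its coefficients `z` need not be known. -/
theorem hγ_mul_revWord_Ω (j : ι) {n : ℕ} (I : Fin (n + 1) → ι) :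
    ∃ z : ι → B.Heis, B.hγ j * revWord (B.Ω hS) I =
      ∑ L, B.Minv hS n (snoc' L j) I • revWord (B.Ω hS) L + ∑ l, z l * B.hγ l := by
  induction n generalizing j with
  | zero =>
    obtain ⟨I, i, rfl⟩ := exists_snoc I
    refine ⟨fun l => -∑ p, B.σinv hS (p, j) (l, i) • B.Ω hS p, ?_⟩
    simp only [revWord_snoc, revWord_zero, mul_one, hγ_mul_Ω, sum_fin_zero, Minv, sub_eq_add_neg]
    congr 1
    · rw [Subsingleton.elim I Fin.elim0]
      by_cases h : j = i
      · subst h; simp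
      · have h2 : (snoc' Fin.elim0 j : Fin 1 → ι) ≠ snoc' Fin.elim0 i := fun h3 =>
          h (congrFun h3 (Fin.last 0))
        simp [h, Matrix.one_apply, h2]
    · rw [Finset.sum_comm]
      simp [Finset.sum_mul, neg_mul]
  | succ n ih =>
    obtain ⟨I, i, rfl⟩ := exists_snoc I
    choose z hz using fun l => ih l I
    refine ⟨fun m => -∑ p, ∑ l, B.σinv hS (p, j) (l, i) • (B.Ω hS p * z l m), ?_⟩
    have h1 : ∀ L : Fin n → ι, ∀ p, B.Minv hS (n + 1) (snoc' (snoc' L p) j) (snoc' I i) =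
        (if j = i then (if I = snoc' L p then 1 else 0) else 0) -
          ∑ l, B.σinv hS (p, j) (l, i) * B.Minv hS n (snoc' L l) I := by
      intro L p
      rw [Minv, Matrix.sub_apply, onLast_mul_shiftR_apply]
      congr 1
      by_cases h : j = i
      · subst h
        by_cases h2 : I = snoc' L p
        · subst h2; simp
        · have : (snoc' (snoc' L p) j : Fin (n + 2) → ι) ≠ snoc' I j := fun h3 =>
            h2 (by simpa using (congrArg Fin.init h3).symm)
          simp [Matrix.one_apply, this, h2]
      · have : (snoc' (snoc' L p) j : Fin (n + 2) → ι) ≠ snoc' I i := fun h3 =>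
          h (by simpa using congrFun h3 (Fin.last _))
        simp [Matrix.one_apply, this, h]
    have h2 : revWord (B.Ω hS) I = ∑ p, ∑ L : Fin n → ι,
        (if I = snoc' L p then (1 : k) else 0) • revWord (B.Ω hS) (snoc' L p) := by
      rw [← sum_snoc (fun K => (if I = K then (1 : k) else 0) • revWord (B.Ω hS) K)]
      simp
    have h3 : ∑ p, ∑ l, B.σinv hS (p, j) (l, i) • (B.Ω hS p * (B.hγ l * revWord (B.Ω hS) I)) =
        ∑ p, ∑ L : Fin n → ι, (∑ l, B.σinv hS (p, j) (l, i) * B.Minv hS n (snoc' L l) I) •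
          revWord (B.Ω hS) (snoc' L p) +
        ∑ m, (∑ p, ∑ l, B.σinv hS (p, j) (l, i) • (B.Ω hS p * z l m)) * B.hγ m := by
      simp only [hz, mul_add, smul_add, Finset.sum_add_distrib]
      congr 1
      · refine Finset.sum_congr rfl fun p _ => ?_
        simp only [Finset.mul_sum, Finset.smul_sum, Finset.sum_smul, mul_smul_comm, smul_smul,
          revWord_snoc]
        exact Finset.sum_comm
      · simp only [Finset.mul_sum, Finset.smul_sum, Finset.sum_mul, smul_mul_assoc, mul_assoc]
        rw [Finset.sum_congr rfl fun p _ => Finset.sum_comm, Finset.sum_comm]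
    rw [revWord_snoc, ← mul_assoc, hγ_mul_Ω, sub_mul]
    simp only [Finset.sum_mul, smul_mul_assoc, mul_assoc, h3]
    rw [sum_snoc]
    simp only [h1, sub_smul, Finset.sum_sub_distrib, neg_mul, Finset.sum_neg_distrib]
    rw [sub_add_eq_sub_sub, sub_eq_add_neg _ (∑ m, _)]
    congr 2
    · split_ifs with h
      · rw [one_mul]
        exact h2
      · simp
    · simp only [Finset.sum_mul, smul_mul_assoc, mul_assoc]

/-- Contractions with `Ω`s involve the inverse braid. Multiplication by the chain `Rch` turns it
into braids, and the recursion of `Minv` becomes, up to sign, that of `Bm'`. -/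
theorem Rch_mul_Minv (n : ℕ) : Rch B.σ n * B.Minv hS n = (-1 : k) ^ n • Bm' B.σ n := by
  induction n with
  | zero => simp [Rch, Minv, Bm']
  | succ n ih =>
    have h : onLast n B.σ * onLast n (B.σinv hS) = 1 := by
      rw [← onLast_mul, σ_mul_σinv, onLast_one]
    rw [Minv, mul_sub, mul_one, Rch_succ', mul_assoc (shiftR _), ← mul_assoc (onLast n B.σ), h,
      one_mul, ← shiftR_mul, ih, Bm', shiftR_smul, ← Rch_succ', smul_add, smul_smul, ← mul_pow,
      pow_succ]
    simp [sub_eq_add_neg, add_comm]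

/-- The inverse of `Rch`. -/
def RchInv : (n : ℕ) → Matrix (Fin (n + 1) → ι) (Fin (n + 1) → ι) k
  | 0 => 1
  | n + 1 => shift (RchInv n) * onFirst n (B.σinv hS)

theorem RchInv_mul_Rch (n : ℕ) : B.RchInv hS n * Rch B.σ n = 1 := by
  induction n with
  | zero => simp [RchInv, Rch]
  | succ n ih =>
    rw [RchInv, Rch, mul_assoc, ← mul_assoc (onFirst n _), ← onFirst_mul, σinv_mul_σ, onFirst_one,
      one_mul, ← shift_mul, ih, shift_one]

theorem antisymmetrizer_eq_Minv (n : ℕ) : antisymmetrizer B.σ (n + 1) =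
    (-1 : k) ^ n • (Rch B.σ n * (shiftR (antisymmetrizer B.σ n) * B.Minv hS n)) := by
  rw [← mul_assoc, Rch_mul_shiftR_antisymmetrizer, mul_assoc, Rch_mul_Minv, mul_smul_comm,
    smul_smul, ← mul_pow, antisymmetrizer_eq_Bm']
  simp

/-- `Rch` is invertible, so `A_{1→n+1}` has the same kernel as `(A_{1→n} ⊗ 1) Minv`. This compares
one contraction of an `Ω`-word with one step of the antisymmetrizer. -/
theorem antisymmetrizer_smul_eq_zero_iff {n : ℕ} (c : (Fin (n + 1) → ι) → A) :
    (∀ J, ∑ I, antisymmetrizer B.σ (n + 1) J I • c I = 0) ↔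
      ∀ j, ∀ J : Fin n → ι, ∑ L, antisymmetrizer B.σ n J L •
        ∑ I, B.Minv hS n (snoc' L j) I • c I = 0 := by
  have h1 : ∀ (M N : Matrix (Fin (n + 1) → ι) (Fin (n + 1) → ι) k) (J : Fin (n + 1) → ι),
      ∑ I, (M * N) J I • c I = ∑ K, M J K • ∑ I, N K I • c I := by
    intro M N J
    simp only [Matrix.mul_apply, Finset.sum_smul, Finset.smul_sum, smul_smul]
    exact Finset.sum_comm
  have h2 : ∀ j (J : Fin n → ι),
      ∑ I, (shiftR (antisymmetrizer B.σ n) * B.Minv hS n) (snoc' J j) I • c I =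
        ∑ L, antisymmetrizer B.σ n J L • ∑ I, B.Minv hS n (snoc' L j) I • c I := by
    intro j J
    rw [h1, sum_snoc, Finset.sum_eq_single j (fun b _ hb => by simp [shiftR_snoc, Ne.symm hb])
      (by simp)]
    simp [shiftR_snoc]
  simp only [← h2]
  constructor
  · intro h j J
    have h3 : B.RchInv hS n * antisymmetrizer B.σ (n + 1) =
        (-1 : k) ^ n • (shiftR (antisymmetrizer B.σ n) * B.Minv hS n) := by
      rw [antisymmetrizer_eq_Minv B hS, mul_smul_comm, ← mul_assoc, RchInv_mul_Rch, one_mul]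
    have h4 : shiftR (antisymmetrizer B.σ n) * B.Minv hS n =
        (-1 : k) ^ n • (B.RchInv hS n * antisymmetrizer B.σ (n + 1)) := by
      rw [h3, smul_smul, ← mul_pow]
      simp
    rw [h4]
    simp only [Matrix.smul_apply, smul_assoc, ← Finset.smul_sum, h1, h, smul_zero,
      Finset.sum_const_zero]
  · intro h J
    rw [antisymmetrizer_eq_Minv B hS]
    simp only [Matrix.smul_apply, smul_assoc, ← Finset.smul_sum, h1]
    refine (congrArg _ (Finset.sum_eq_zero fun K _ => ?_)).trans (smul_zero _)
    obtain ⟨K, j, rfl⟩ := exists_snoc K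
    exact (congrArg (_ • ·) ((h1 _ _ _).symm.trans (h j K))).trans (smul_zero _)

/-- After the coefficient has been moved past the leftmost `Ω`, the element starts with an `ω`. -/
theorem vac_sum_revWord_Ω_nil {n : ℕ} (c : (Fin (n + 1) → ι) → A) :
    (B.vac (∑ I, B.hA (c I) * revWord (B.Ω hS) I)).1 [] = 0 := by
  have h : ∀ x i, B.hA x * B.Ω hS i = ∑ j, B.hω j * (B.hU (sinv hS (B.f i j)) * B.hA x) := by
    intro x i
    rw [← Ω_mul_hA, Ω_eq, Finset.sum_mul]
    simp only [mul_assoc]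
  have h1 : ∀ I : Fin (n + 1) → ι, (B.vac (B.hA (c I) * revWord (B.Ω hS) I)).1 [] = 0 := by
    intro I
    obtain ⟨I, i, rfl⟩ := exists_snoc I
    rw [revWord_snoc, ← mul_assoc, h, Finset.sum_mul, map_sum, AddSubmonoidClass.coe_finsetSum,
      Finset.sum_apply]
    simp only [mul_assoc, vac_hω_mul_nil, Finset.sum_const_zero]
  rw [map_sum, AddSubmonoidClass.coe_finsetSum, Finset.sum_apply]
  exact Finset.sum_eq_zero fun I _ => h1 I

theorem vac_hγ_sum_revWord_Ω (j : ι) {n : ℕ} (c : (Fin (n + 1) → ι) → A) :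
    B.vac (B.hγ j * ∑ I, B.hA (c I) * revWord (B.Ω hS) I) =
      B.vac (∑ L, B.hA (∑ I, B.Minv hS n (snoc' L j) I • c I) * revWord (B.Ω hS) L) := by
  have h1 : ∀ I, B.vac (B.hγ j * (B.hA (c I) * revWord (B.Ω hS) I)) =
      ∑ L, B.Minv hS n (snoc' L j) I • B.vac (B.hA (c I) * revWord (B.Ω hS) L) := by
    intro I
    obtain ⟨z, hz⟩ := B.hγ_mul_revWord_Ω hS j I
    rw [← mul_assoc, hγ_hA, mul_assoc, hz]
    simp only [mul_add, Finset.mul_sum, map_add, map_sum, mul_smul_comm, map_smul, ← mul_assoc,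
      vac_mul_hγ, Finset.sum_const_zero, add_zero]
  rw [Finset.mul_sum, map_sum, Finset.sum_congr rfl fun I _ => h1 I, Finset.sum_comm]
  simp only [hA_sum, hA_smul, Finset.sum_mul, smul_mul_assoc, map_sum, map_smul]

/-- The elements `c_I Ω^{iₙ} ⋯ Ω^{i₁} |0⟩` satisfy precisely the relations of the exterior
product. -/
theorem vac_sum_revWord_Ω_eq_zero_iff {n : ℕ} (c : (Fin n → ι) → A) :
    B.vac (∑ I, B.hA (c I) * revWord (B.Ω hS) I) = 0 ↔
      ∀ J, ∑ I, antisymmetrizer B.σ n J I • c I = 0 := by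
  induction n with
  | zero =>
    simp only [sum_fin_zero, revWord_zero, mul_one, antisymmetrizer, Matrix.one_apply]
    constructor
    · intro h J
      rw [← B.vac_hA_nil (c _), h]
      simp
    · intro h
      have := h Fin.elim0
      simp only [if_true, one_smul] at this
      rw [this, hA_zero, map_zero]
  | succ n ih =>
    rw [antisymmetrizer_smul_eq_zero_iff B hS]
    constructor
    · intro h j
      refine (ih _).mp ?_
      rw [← vac_hγ_sum_revWord_Ω, vac_mul, h, map_zero]
    · intro h
      refine B.vac_eq_zero (B.vac_sum_revWord_Ω_nil hS c) fun j => ?_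
      rw [vac_hγ_sum_revWord_Ω]
      exact (ih _).mpr (h j)

theorem vac_sum_smul_revWord_Ω_eq_zero_iff {n : ℕ} (c : (Fin n → ι) → k) :
    B.vac (∑ I, c I • revWord (B.Ω hS) I) = 0 ↔ antisymmetrizer B.σ n *ᵥ c = 0 := by
  have h1 : ∑ I, c I • revWord (B.Ω hS) I =
      ∑ I, B.hA (algebraMap k A (c I)) * revWord (B.Ω hS) I := by
    refine Finset.sum_congr rfl fun I _ => ?_
    rw [Algebra.algebraMap_eq_smul_one, hA_smul, hA_one, smul_mul_assoc, one_mul]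
  have h2 : Function.Injective (algebraMap k A) := by
    intro a b hab
    have := congrArg (Coalgebra.counit (R := k)) hab
    simpa using this
  rw [h1, vac_sum_revWord_Ω_eq_zero_iff, funext_iff]
  refine forall_congr' fun J => ?_
  simp only [Algebra.smul_def, ← map_mul, ← map_sum, map_eq_zero_iff _ h2]
  rfl

theorem hU_mul_word_hω (u : U) {n : ℕ} (J : Fin n → ι) : B.hU u * word B.hω J =
    ∑ L, word B.hω L * B.hU (P.dualRact u (gword B.rT n L J)) :=
  B.u_mul_word_ω B.hUₐ.toLinearMap B.hU_hω J u

theorem word_hγ_mul_hU {n : ℕ} (I : Fin n → ι) (u : U) : word B.hγ I * B.hU u =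
    ∑ K, B.hU (P.dualLact (gword B.rT n I K) u) * word B.hγ K :=
  B.word_γ_mul_u B.hUₐ.toLinearMap B.hγ_hU I u

theorem revWord_Ω_mem {n : ℕ} (I : Fin n → ι) :
    ∃ u : (Fin n → ι) → U, revWord (B.Ω hS) I = ∑ K, word B.hω K * B.hU (u K) := by
  induction n with
  | zero => exact ⟨fun _ => 1, by simp [sum_fin_zero, revWord_zero, word_zero, hU_one]⟩
  | succ n ih =>
    obtain ⟨I, i, rfl⟩ := exists_snoc I
    obtain ⟨u, hu⟩ := ih I
    refine ⟨fun K => ∑ L, P.dualRact (sinv hS (B.f i (K 0))) (gword B.rT n (Fin.tail K) L) * u L, ?_⟩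
    rw [revWord_snoc, hu, sum_cons, Ω_eq, Finset.sum_mul]
    refine Finset.sum_congr rfl fun j _ => ?_
    simp only [Fin.cons_zero, Fin.tail_cons, word_cons, Finset.mul_sum, hU_sum]
    rw [Finset.sum_comm]
    refine Finset.sum_congr rfl fun L _ => ?_
    rw [mul_assoc, ← mul_assoc (B.hU _), hU_mul_word_hω]
    simp only [Finset.sum_mul, Finset.mul_sum, hU_mul, mul_assoc]

/-- The relation is known on the vacuum. As the `Ω`s commute with `A` it holds on all `a |0⟩`, and
for forms with coefficients in `U`, to which `Ω`-words belong, this suffices. -/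
theorem rowKer_revWord_Ω (n : ℕ) :
    RowKer (antisymmetrizer B.σ n) (fun I => revWord (B.Ω hS) I) := by
  intro c hc
  choose u hu using fun I : Fin n → ι => B.revWord_Ω_mem hS I
  have h1 : ∑ I, c I • revWord (B.Ω hS) I =
      ∑ K, word B.hω K * B.hU (∑ I, c I • u I K) := by
    simp only [hu, hU_sum, hU_smul, Finset.mul_sum, Finset.smul_sum, mul_smul_comm]
    exact Finset.sum_comm
  rw [h1]
  refine B.sum_word_hω_mul_hU_eq_zero hS fun a => ?_
  rw [← h1, Finset.sum_mul]
  simp only [smul_mul_assoc, revWord_Ω_mul_hA, ← mul_smul_comm]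
  rw [← Finset.mul_sum, vac_mul, (B.vac_sum_smul_revWord_Ω_eq_zero_iff hS c).mpr hc, map_zero]

end BicovariantBimodule
end Omega

/-! ### The quantum Lie algebra of a differential calculus -/

section Differential

variable {k : Type*} [Field k] {A : Type*} [Ring A] [HopfAlgebra k A]
  {U : Type*} [Ring U] [HopfAlgebra k U] {P : HopfDuality k A U}
  {ι : Type*} [Fintype ι] [DecidableEq ι]

/-- Non-degeneracy is used in one leg at a time: slicing with `b` gives zero in `U`, and then each
coordinate of `t` with respect to a basis in the first leg is an element of `U` orthogonal to all
`b`. -/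
theorem HopfDuality.tensor_eq_zero (P : HopfDuality k A U) {t : U ⊗[k] U}
    (h : ∀ a b, LinearMap.mul' k k (TensorProduct.map (P.pair.flip a) (P.pair.flip b) t) = 0) :
    t = 0 := by
  classical
  let bU := Module.Basis.ofVectorSpace k U
  have h1 : ∀ b, TensorProduct.rid k U ((P.pair.flip b).lTensor U t) = 0 := by
    intro b
    refine P.ext_left fun a => ?_
    rw [map_zero, LinearMap.zero_apply, ← h a b]
    generalize t = s
    induction s with
    | zero => simp
    | add s t hs ht => simp only [map_add, LinearMap.add_apply, hs, ht]
    | tmul x y => simp [mul_comm]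
  refine (TensorProduct.equivFinsuppOfBasisLeft bU).injective ?_
  rw [map_zero]
  ext i
  refine P.ext_left fun b => ?_
  have h2 : ∀ s : U ⊗[k] U, P.pair (TensorProduct.equivFinsuppOfBasisLeft bU s i) b =
      bU.repr (TensorProduct.rid k U ((P.pair.flip b).lTensor U s)) i := by
    intro s
    induction s with
    | zero => simp
    | add s t hs ht => simp only [map_add, LinearMap.add_apply, Finsupp.add_apply, hs, ht]
    | tmul x y => simp [mul_comm]
  rw [h2, h1]
  simp

theorem BicovariantBimodule.mem_extDeg (B : BicovariantBimodule P ι) (a : A) {n : ℕ}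
    (I : Fin n → ι) : B.extA a * word B.extω I ∈ B.extDeg n :=
  Submodule.subset_span ⟨(a, I), rfl⟩

theorem BicovariantBimodule.extA_mem (B : BicovariantBimodule P ι) (a : A) :
    B.extA a ∈ B.extDeg 0 := by
  simpa [word_zero] using B.mem_extDeg a Fin.elim0

theorem BicovariantBimodule.extω_mem (B : BicovariantBimodule P ι) (i : ι) :
    B.extω i ∈ B.extDeg 1 := by
  simpa [word_cons, word_zero] using B.mem_extDeg 1 (Fin.cons i Fin.elim0)

theorem BicovariantBimodule.word_extω_mem (B : BicovariantBimodule P ι) {n : ℕ} (I : Fin n → ι) :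
    word B.extω I ∈ B.extDeg n := by
  simpa using B.mem_extDeg 1 I

namespace BicovariantCalculus

variable (B : BicovariantCalculus P ι) {d : B.Ext →ₗ[k] B.Ext}

theorem form_d_extA (hd : B.IsDifferential d) (a : A) :
    B.form (d (B.extA a)) = ∑ i, B.hA (P.lact (B.χ i) a) * B.hω i := by
  rw [hd.d_a, map_sum]
  simp only [map_mul]
  rfl

/-- Compare the coefficients of `ωʲ` in `d(ab) = da · b + a · db`; they are determined because the
`ωⁱ` are free over `A`. -/
theorem lact_χ_mul (hd : B.IsDifferential d) (j : ι) (a b : A) :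
    P.lact (B.χ j) (a * b) =
      ∑ i, P.lact (B.χ i) a * P.lact (B.f i j) b + a * P.lact (B.χ j) b := by
  have h := hd.leibniz 0 _ (B.extA_mem a) (B.extA b)
  rw [← map_mul, pow_zero, one_smul] at h
  have h1 := congrArg B.form h
  rw [map_add, map_mul B.form, map_mul B.form, form_d_extA B hd, form_d_extA B hd,
    form_d_extA B hd] at h1
  change _ = _ * B.hA b + B.hA a * _ at h1
  refine congrFun (B.coeff_eq_of_vac (a := fun j => P.lact (B.χ j) (a * b))
    (b := fun j => ∑ i, P.lact (B.χ i) a * P.lact (B.f i j) b + a * P.lact (B.χ j) b) ?_) j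
  rw [h1]
  congr 1
  simp only [Finset.sum_mul, Finset.mul_sum, mul_assoc, B.hω_hA, B.hA_add, B.hA_sum, B.hA_mul,
    add_mul, Finset.sum_add_distrib]
  congr 1
  exact Finset.sum_comm

theorem counit_χ (hd : B.IsDifferential d) (j : ι) : Coalgebra.counit (R := k) (B.χ j) = 0 := by
  have h := B.lact_χ_mul hd j 1 1
  simp only [one_mul, P.lact_one_right, B.counit_f, smul_mul_assoc] at h
  have h1 := congrArg (Coalgebra.counit (R := k)) h
  simpa [Finset.sum_ite_eq] using h1

theorem comul_χ (hd : B.IsDifferential d) (j : ι) :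
    Coalgebra.comul (R := k) (B.χ j) = ∑ i, B.χ i ⊗ₜ[k] B.f i j + 1 ⊗ₜ[k] B.χ j := by
  rw [← sub_eq_zero]
  refine P.tensor_eq_zero fun a b => ?_
  have h := congrArg (Coalgebra.counit (R := k)) (B.lact_χ_mul hd j a b)
  simp only [map_add, map_sum, Bialgebra.counit_mul, P.counit_lact] at h
  rw [map_sub, map_sub, ← P.mul_right, h]
  simp [P.one_left]

/-- The term `1 ⊗ χⱼ` is put under the index `none`, so that the lemmas for coproducts given as a
single finite sum apply. -/
theorem comul_χ_option (hd : B.IsDifferential d) (j : ι) : Coalgebra.comul (R := k) (B.χ j) =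
    ∑ l : Option ι, (l.elim 1 B.χ) ⊗ₜ[k] (l.elim (B.χ j) fun i => B.f i j) := by
  rw [B.comul_χ hd, Fintype.sum_option, add_comm]
  rfl

theorem hU_χ_hA (hd : B.IsDifferential d) (j : ι) (a : A) : B.hU (B.χ j) * B.hA a =
    ∑ i, B.hA (P.lact (B.χ i) a) * B.hU (B.f i j) + B.hA a * B.hU (B.χ j) := by
  rw [B.hU_hA_of_comul (B.comul_χ_option hd j), Fintype.sum_option, add_comm]
  simp [P.lact_one]

theorem dualLact_χ (hd : B.IsDifferential d) (j : ι) (a : A) : P.dualLact a (B.χ j) =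
    ∑ i, P.pair (B.f i j) a • B.χ i + P.pair (B.χ j) a • 1 := by
  rw [P.dualLact_of_comul (B.comul_χ_option hd j), Fintype.sum_option, add_comm]
  simp

/-- Right covariance with the counit applied to the first leg. -/
theorem sum_lact_χ_mul_r (j : ι) (a : A) :
    ∑ i, P.lact (B.χ i) a * B.r i j = P.ract a (B.χ j) := by
  have h := congrArg (fun t => TensorProduct.lid k A ((Coalgebra.counit (R := k)).rTensor A t))
    (B.right_covariant j a)
  have h1 : ∀ (s : A ⊗[k] A) (b : A), TensorProduct.lid k A ((Coalgebra.counit (R := k)).rTensor A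
      (s * ((1 : A) ⊗ₜ[k] b))) =
      TensorProduct.lid k A ((Coalgebra.counit (R := k)).rTensor A s) * b := by
    intro s b
    induction s with
    | zero => simp
    | add s t hs ht => simp only [map_add, add_mul, hs, ht]
    | tmul x y => simp
  have h2 : ∀ s : A ⊗[k] A, TensorProduct.lid k A ((Coalgebra.counit (R := k)).rTensor A
      ((P.lact (B.χ j)).rTensor A s)) = TensorProduct.lid k A ((P.pair (B.χ j)).rTensor A s) := by
    intro s
    induction s with
    | zero => simp
    | add s t hs ht => simp only [map_add, hs, ht]
    | tmul x y => simp [P.counit_lact]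
  simp only [map_sum, h1, h2, Coalgebra.rTensor_counit_comul, TensorProduct.lid_tmul,
    one_smul] at h
  exact h

/-- The dual form of right covariance. For `u = χ` it gives the quantum Lie algebra, and in general
it makes `Ωⁱ χᵢ` commute with `U`. -/
theorem χ_mul (j : ι) (u : U) : B.χ j * u = ∑ i, P.dualLact (B.r i j) u * B.χ i := by
  refine P.ext_left fun a => ?_
  rw [← P.pair_ract, ← sum_lact_χ_mul_r]
  simp only [map_sum, LinearMap.sum_apply, ← P.pair_dualLact, P.pair_lact]

theorem intertwines_C : Intertwines k B.rT B.C := by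
  intro I J
  have h := B.sum_lact_χ_mul_r (I 1) (B.r (J 0) (I 0))
  have h0 : ∀ u i j, P.lact u (B.r i j) = ∑ l, P.pair u (B.r i l) • B.r l j :=
    fun u i j => B.lact_r u i j
  have h1 : ∀ u i j, P.ract (B.r i j) u = ∑ l, P.pair u (B.r l j) • B.r i l :=
    fun u i j => B.ract_r u i j
  simp only [h0, h1, Finset.sum_mul, smul_mul_assoc] at h
  rw [Finset.sum_comm] at h
  obtain ⟨i, I, rfl⟩ := exists_cons I
  obtain ⟨i', I, rfl⟩ := exists_cons I
  obtain ⟨j, J, rfl⟩ := exists_cons J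
  simp only [sum_cons, sum_fin_zero, gword_cons, gword_zero, mul_one, C, Matrix.of_apply]
  exact h

/-- The relations of the quantum Lie algebra. -/
theorem χ_mul_χ (hd : B.IsDifferential d) (i j : ι) : B.χ i * B.χ j =
    ∑ m, ∑ l, B.σ (i, j) (m, l) • (B.χ m * B.χ l) +
      ∑ l, B.C (Fin.cons i (Fin.cons j Fin.elim0)) (Fin.cons l Fin.elim0) • B.χ l := by
  rw [χ_mul]
  simp only [B.dualLact_χ hd, add_mul, Finset.sum_mul, Finset.sum_add_distrib, smul_mul_assoc,
    one_mul]
  congr 1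
  exact Finset.sum_comm

/-! ### The Maurer-Cartan equation -/

/-- Replacing `a` by `a₍₂₎` and multiplying by `S(a₍₁₎)` turns `χᵢ ▷ a` into the scalar `⟨χᵢ, a⟩`;
the dual elements `aʲ` then isolate each `β j`. -/
theorem eq_zero_of_sum_lact_χ_mul {β : ι → A} (h : ∀ a, ∑ i, P.lact (B.χ i) a * β i = 0) :
    β = 0 := by
  have h1 : ∀ a, ∑ i, P.pair (B.χ i) a • β i = 0 := by
    intro a
    have h2 : ∀ s : A ⊗[k] A, ∑ i, LinearMap.mul' k A (TensorProduct.map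
        (HopfAlgebra.antipode k) (P.lact (B.χ i)) s) * β i = 0 := by
      intro s
      induction s with
      | zero => simp
      | add s t hs ht => simp only [map_add, add_mul, Finset.sum_add_distrib, hs, ht, add_zero]
      | tmul x y =>
        simp only [TensorProduct.map_tmul, LinearMap.mul'_apply, mul_assoc, ← Finset.mul_sum, h,
          mul_zero]
    have h3 : ∀ u : U, LinearMap.mul' k A (TensorProduct.map (HopfAlgebra.antipode k) (P.lact u)
        (Coalgebra.comul (R := k) a)) = P.pair u a • 1 := by
      intro u
      have h4 : ∀ s : A ⊗[k] A, TensorProduct.map (HopfAlgebra.antipode k) (P.lact u) s =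
          (HopfAlgebra.antipode k).rTensor A ((P.lact u).lTensor A s) := by
        intro s
        induction s with
        | zero => simp
        | add s t hs ht => simp only [map_add, hs, ht]
        | tmul x y => simp
      rw [h4, ← P.comul_lact, HopfAlgebra.mul_antipode_rTensor_comul_apply, P.counit_lact,
        Algebra.algebraMap_eq_smul_one]
    have h5 := h2 (Coalgebra.comul (R := k) a)
    simpa only [h3, smul_mul_assoc, one_mul] using h5
  obtain ⟨e, he⟩ := B.exists_dual
  ext j
  simpa [he] using h1 (e j)

theorem exists_form_d_extω (hd : B.IsDifferential d) (i : ι) : ∃ b : (Fin 2 → ι) → A,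
    B.form (d (B.extω i)) = ∑ K, B.hA (b K) * word B.hω K := by
  have h := hd.map_deg 1 _ (B.extω_mem i)
  generalize d (B.extω i) = η at h
  change η ∈ Submodule.span k _ at h
  induction h using Submodule.span_induction with
  | mem x hx =>
    obtain ⟨⟨a, I⟩, rfl⟩ := hx
    refine ⟨Pi.single I a, ?_⟩
    rw [Finset.sum_eq_single I (fun K _ hK => by simp [hK, B.hA_zero]) (by simp)]
    simp only [Pi.single_eq_same, map_mul, map_word]
    rfl
  | zero => exact ⟨0, by simp [B.hA_zero]⟩
  | add x y _ _ hx hy =>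
    obtain ⟨b, hb⟩ := hx
    obtain ⟨c, hc⟩ := hy
    exact ⟨b + c, by simp [hb, hc, B.hA_add, add_mul, Finset.sum_add_distrib]⟩
  | smul c x _ hx =>
    obtain ⟨b, hb⟩ := hx
    exact ⟨c • b, by simp [hb, B.hA_smul, Finset.smul_sum]⟩

/-- The Maurer-Cartan equation: `dωⁱ = ωʲ ωˡ D^i_{jl}` with `A_{1 → 2} D = - C`. -/
theorem maurer_cartan (hd : B.IsDifferential d) : ∃ D : Matrix (Fin 2 → ι) (Fin 1 → ι) k,
    antisymmetrizer B.σ 2 * D = -B.C ∧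
    ∀ i, B.form (d (B.extω i)) = ∑ K, D K (Fin.cons i Fin.elim0) • word B.hω K := by
  choose b hb using B.exists_form_d_extω hd
  have h2 : antisymmetrizer B.σ 2 = 1 - onFirst 0 B.σ := by
    rw [antisymmetrizer_succ, antisymmetrizer_succ, antisymmetrizer, Bm_succ, Bm_zero]
    simp [shift_one]
  -- The coefficients of the two-form `d(da) = 0`, written with the unknown `dωⁱ = b_K ω^K`.
  have h1 : ∀ a, B.vac (∑ K : Fin 2 → ι, B.hA (P.lact (B.χ (K 0) * B.χ (K 1)) a +
      ∑ i, P.lact (B.χ i) a * b i K) * word B.hω K) = 0 := by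
    intro a
    have h3 := congrArg B.form (hd.sq_zero (B.extA a))
    rw [hd.d_a, map_sum, map_sum, map_zero] at h3
    rw [← map_zero B.vac, ← h3]
    congr 1
    have h4 : ∀ i, B.form (d (B.extA (P.lact (B.χ i) a) * B.extω i)) =
        ∑ j, B.hA (P.lact (B.χ j * B.χ i) a) * (B.hω j * B.hω i) +
          ∑ K, B.hA (P.lact (B.χ i) a * b i K) * word B.hω K := by
      intro i
      rw [hd.leibniz 0 _ (B.extA_mem _), pow_zero, one_smul, map_add, map_mul, map_mul,
        form_d_extA B hd, hb]
      change _ * B.hω i + B.hA _ * _ = _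
      simp only [Finset.sum_mul, Finset.mul_sum, P.lact_mul, mul_assoc, B.hA_mul]
    simp only [h4, B.hA_add, B.hA_sum, add_mul, Finset.sum_add_distrib, Finset.sum_mul]
    congr 1
    · simp only [sum_cons, sum_fin_zero, word_cons, word_zero, mul_one]
      rw [Finset.sum_comm]
      rfl
    · exact Finset.sum_comm
  -- The quantum Lie algebra relation says `A_{1→2} χχ = C χ`, so the vanishing coefficients have
  -- the form `∑ (χᵢ ▷ a) βᵢ` and every `βᵢ` is zero.
  have h3 : ∀ J i, ∑ K, antisymmetrizer B.σ 2 J K • b i K + B.C J (Fin.cons i Fin.elim0) • 1 = 0 := by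
    intro J
    refine congrFun (B.eq_zero_of_sum_lact_χ_mul (β := fun i => ∑ K, antisymmetrizer B.σ 2 J K • b i K
      + B.C J (Fin.cons i Fin.elim0) • 1) fun a => ?_)
    have h4 := B.antisymmetrizer_smul_eq_zero (h1 a) J
    have h5 : ∑ K, antisymmetrizer B.σ 2 J K • (B.χ (K 0) * B.χ (K 1)) =
        ∑ i, B.C J (Fin.cons i Fin.elim0) • B.χ i := by
      rw [h2]
      obtain ⟨i, J, rfl⟩ := exists_cons J
      obtain ⟨j, J, rfl⟩ := exists_cons J
      have h6 := B.χ_mul_χ hd i j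
      simp only [Matrix.sub_apply, sub_smul, Finset.sum_sub_distrib]
      rw [sub_eq_iff_eq_add]
      refine Eq.trans ?_ (add_comm _ _)
      simp only [Matrix.one_apply, ite_smul, one_smul, zero_smul, Finset.sum_ite_eq,
        Finset.mem_univ, if_true]
      rw [Subsingleton.elim J Fin.elim0]
      simp only [sum_cons, sum_fin_zero, onFirst_cons, if_true]
      exact h6
    have h7 := congrArg (fun u => P.lact u a) h5
    simp only [map_sum, map_smul, LinearMap.sum_apply, LinearMap.smul_apply] at h7
    simp only [smul_add, Finset.sum_add_distrib, h7] at h4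
    rw [← h4]
    simp only [mul_add, Finset.mul_sum, Finset.sum_add_distrib, Finset.smul_sum, mul_smul_comm,
      mul_one]
    rw [add_comm]
    congr 1
    exact Finset.sum_comm
  -- The coefficients `b` need not be scalar, but `A_{1→2} b` is. Hence `A_{1→2}` kills `b - ε(b)`,
  -- and `ε(b)` represents the same form.
  refine ⟨Matrix.of fun K I => Coalgebra.counit (R := k) (b (I 0) K), ?_, fun i => ?_⟩
  · ext J I
    obtain ⟨i, I, rfl⟩ := exists_cons I
    have h4 := congrArg (Coalgebra.counit (R := k)) (h3 J i)
    simp only [map_add, map_sum, map_smul, smul_eq_mul, Bialgebra.counit_one, mul_one,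
      map_zero] at h4
    rw [Subsingleton.elim I Fin.elim0, Matrix.neg_apply, ← add_eq_zero_iff_eq_neg, ← h4]
    rfl
  · rw [hb, ← sub_eq_zero, ← Finset.sum_sub_distrib]
    have h4 : ∀ K : Fin 2 → ι, B.hA (b i K) * word B.hω K -
        Coalgebra.counit (R := k) (b i K) • word B.hω K =
        B.hA (b i K - Coalgebra.counit (R := k) (b i K) • 1) * word B.hω K := by
      intro K
      have : B.hA (b i K - Coalgebra.counit (R := k) (b i K) • 1) =
          B.hA (b i K) - B.hA (Coalgebra.counit (R := k) (b i K) • 1) := map_sub B.hAₐ _ _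
      rw [this, B.hA_smul, B.hA_one, sub_mul, smul_mul_assoc, one_mul]
    refine (Finset.sum_congr rfl fun K _ => h4 K).trans
      ((B.rowKer_word_hω 2).sum_mul_eq_zero' fun J => ?_)
    rw [Finset.sum_congr rfl fun K _ => (B.hA_smul _ _).symm, ← B.hA_sum]
    have h5 := h3 J i
    have h6 := congrArg (Coalgebra.counit (R := k)) h5
    simp only [map_add, map_sum, map_smul, smul_eq_mul, Bialgebra.counit_one, mul_one,
      map_zero] at h6
    have h7 : ∑ K, antisymmetrizer B.σ 2 J K • (b i K - Coalgebra.counit (R := k) (b i K) • (1 : A))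
        = 0 := by
      simp only [smul_sub, Finset.sum_sub_distrib, smul_smul, ← Finset.sum_smul]
      rw [eq_neg_of_add_eq_zero_left h5, eq_neg_of_add_eq_zero_left h6]
      simp
    rw [h7, B.hA_zero]

end BicovariantCalculus
end Differential

/-! ### Normal ordered elements -/

section NormalOrder

variable {k : Type*} [Field k] {A : Type*} [Ring A] [HopfAlgebra k A]
  {U : Type*} [Ring U] [HopfAlgebra k U] {P : HopfDuality k A U}
  {ι : Type*} [Fintype ι] [DecidableEq ι]

namespace BicovariantBimodule

variable (B : BicovariantBimodule P ι)
  (hS : Function.Bijective (HopfAlgebra.antipode k (A := U)))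

/-- The elements `∑ X_{IJ} Ω^{iₘ} ⋯ Ω^{i₁} γ_{j₁} ⋯ γ_{jₙ}`. -/
def tensorElt {m n : ℕ} (X : Matrix (Fin m → ι) (Fin n → ι) k) : B.Heis :=
  ∑ I, ∑ J, X I J • (revWord (B.Ω hS) I * word B.hγ J)

/-- The elements `∑ Z_{I, pJ} Ω^{iₘ} ⋯ Ω^{i₁} fᵗₚ γ_{j₁} ⋯ γ_{jₙ}`. -/
def tensorEltF {m n : ℕ} (Z : Matrix (Fin m → ι) (Fin (n + 1) → ι) k) (t : ι) : B.Heis :=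
  ∑ I, ∑ p, ∑ J, Z I (Fin.cons p J) • (revWord (B.Ω hS) I * B.hU (B.f t p) * word B.hγ J)

variable {B hS}

theorem tensorElt_add {m n : ℕ} (X Y : Matrix (Fin m → ι) (Fin n → ι) k) :
    B.tensorElt hS (X + Y) = B.tensorElt hS X + B.tensorElt hS Y := by
  simp [tensorElt, add_smul, Finset.sum_add_distrib]

theorem tensorEltF_add {m n : ℕ} (Y Z : Matrix (Fin m → ι) (Fin (n + 1) → ι) k) (t : ι) :
    B.tensorEltF hS (Y + Z) t = B.tensorEltF hS Y t + B.tensorEltF hS Z t := by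
  simp [tensorEltF, add_smul, Finset.sum_add_distrib]

theorem tensorEltF_smul {m n : ℕ} (c : k) (Z : Matrix (Fin m → ι) (Fin (n + 1) → ι) k) (t : ι) :
    B.tensorEltF hS (c • Z) t = c • B.tensorEltF hS Z t := by
  simp [tensorEltF, mul_smul, Finset.smul_sum]

/-- The exterior relations hold for the `Ω`s on the left and the `γ`s on the right, so a tensor
matters only between two antisymmetrizers. -/
theorem tensorElt_eq_zero {m n : ℕ} {X : Matrix (Fin m → ι) (Fin n → ι) k}
    (h : antisymmetrizer B.σ m * X * antisymmetrizer B.σ n = 0) : B.tensorElt hS X = 0 := by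
  refine Eq.trans ?_ ((B.rowKer_revWord_Ω hS m).sum_mul_mul_eq_zero (B.colKer_word_hγ n)
    (z := fun I J => X I J • 1) fun a b => ?_)
  · simp only [tensorElt, mul_smul_comm, smul_mul_assoc, mul_one]
  · have h1 := congrFun (congrFun h a) b
    simp only [Matrix.mul_apply, Finset.sum_mul] at h1
    rw [Finset.sum_comm] at h1
    simp only [smul_smul, ← Finset.sum_smul]
    refine (congrArg (· • (1 : B.Heis)) ?_).trans (zero_smul k (1 : B.Heis))
    refine Eq.trans ?_ h1
    exact Finset.sum_congr rfl fun I _ => Finset.sum_congr rfl fun J _ => by ring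

theorem tensorEltF_eq_zero {m n : ℕ} {Z : Matrix (Fin m → ι) (Fin (n + 1) → ι) k}
    (h : antisymmetrizer B.σ m * Z * shift (antisymmetrizer B.σ n) = 0) (t : ι) :
    B.tensorEltF hS Z t = 0 := by
  refine Eq.trans ?_ ((B.rowKer_revWord_Ω hS m).sum_mul_mul_eq_zero (B.colKer_word_hγ n)
    (z := fun I J => ∑ p, Z I (Fin.cons p J) • B.hU (B.f t p)) fun a b => ?_)
  · simp only [tensorEltF, mul_smul_comm, smul_mul_assoc, Finset.mul_sum, Finset.sum_mul]
    exact Finset.sum_congr rfl fun I _ => Finset.sum_comm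
  · have h1 : ∀ p, ∑ I, ∑ J, antisymmetrizer B.σ m a I * antisymmetrizer B.σ n J b *
        Z I (Fin.cons p J) = 0 := by
      intro p
      have h1 := congrFun (congrFun h a) (Fin.cons p b)
      simp only [Matrix.mul_apply, Finset.sum_mul, sum_cons, shift_cons, mul_ite, mul_zero] at h1
      rw [Finset.sum_eq_single p (fun q _ hq => by simp [hq]) (by simp)] at h1
      simp only [if_true] at h1
      rw [Finset.sum_comm] at h1
      refine Eq.trans ?_ h1
      exact Finset.sum_congr rfl fun I _ => Finset.sum_congr rfl fun J _ => by ring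
    calc _ = ∑ p, (∑ I, ∑ J, antisymmetrizer B.σ m a I * antisymmetrizer B.σ n J b *
          Z I (Fin.cons p J)) • B.hU (B.f t p) := by
          simp only [Finset.smul_sum, Finset.sum_smul, smul_smul]
          rw [Finset.sum_congr rfl fun I _ => Finset.sum_comm, Finset.sum_comm]
          simp only [mul_assoc]
      _ = 0 := by simp [h1]

theorem tensorElt_mul_hA {m n : ℕ} (X : Matrix (Fin m → ι) (Fin n → ι) k) (a : A) :
    B.tensorElt hS X * B.hA a = B.hA a * B.tensorElt hS X := by
  simp only [tensorElt, Finset.sum_mul, Finset.mul_sum, smul_mul_assoc, mul_smul_comm, mul_assoc,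
    word_hγ_hA]
  simp only [← mul_assoc, revWord_Ω_mul_hA]

theorem revWord_Ω_mul_hω {n : ℕ} (I : Fin n → ι) (t : ι) : revWord (B.Ω hS) I * B.hω t =
    ∑ p, revWord (B.Ω hS) (Fin.cons p I) * B.hU (B.f t p) := by
  rw [hω_eq_sum_Ω B hS, Finset.mul_sum]
  simp only [revWord_cons, mul_assoc]

theorem hω_mul_revWord_Ω {n : ℕ} (I : Fin n → ι) (t : ι) : B.hω t * revWord (B.Ω hS) I =
    ∑ L, ∑ p, Lch B.σ n L (Fin.cons p I) • (revWord (B.Ω hS) L * B.hU (B.f t p)) := by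
  rw [hω_eq_sum_Ω B hS, Finset.sum_mul, sum_snoc]
  refine Finset.sum_congr rfl fun m _ => ?_
  rw [mul_assoc, hU_mul_revWord_Ω, Finset.mul_sum]
  refine Finset.sum_congr rfl fun L _ => ?_
  simp only [dualLact_f, hU_sum, hU_smul, Finset.mul_sum, mul_smul_comm, revWord_snoc, Lch_apply,
    mul_assoc]

/-- From the right, `ωᵗ` is either contracted with the `γ`s, which gives `X Bm`, or passes them with
a sign and becomes the innermost `Ω`, which gives `shift X`. From the left, it passes the `Ω`s to
that same place and collects the chain `Lch`. -/
theorem tensorElt_anticomm_hω {m n : ℕ} (X : Matrix (Fin m → ι) (Fin (n + 1) → ι) k) (t : ι) :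
    B.tensorElt hS X * B.hω t + B.hω t * B.tensorElt hS X =
      (-1 : k) ^ n • B.tensorEltF hS (X * Bm B.σ n) t +
        B.tensorEltF hS ((Lch B.σ m + (-1 : k) ^ (n + 1) • 1) * shift X) t := by
  have h1 : B.tensorElt hS X * B.hω t = (-1 : k) ^ n • B.tensorEltF hS (X * Bm B.σ n) t +
      (-1 : k) ^ (n + 1) • B.tensorEltF hS (shift X) t := by
    have e1 : ∀ (I : Fin m → ι) (J : Fin (n + 1) → ι), revWord (B.Ω hS) I * word B.hγ J * B.hω t =
        (-1 : k) ^ (n + 1) • ∑ p, revWord (B.Ω hS) (Fin.cons p I) * B.hU (B.f t p) * word B.hγ J +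
        (-1 : k) ^ n • ∑ p, ∑ L : Fin n → ι, Bm B.σ n J (Fin.cons p L) •
          (revWord (B.Ω hS) I * B.hU (B.f t p) * word B.hγ L) := by
      intro I J
      rw [mul_assoc, word_mul_ω B.σ (f := fun i j => B.hU (B.f i j)) B.hγ_hω B.hγ_hU_f t J,
        mul_add, mul_smul_comm, mul_smul_comm, ← mul_assoc, revWord_Ω_mul_hω, Finset.sum_mul]
      simp only [Finset.mul_sum, mul_smul_comm, mul_assoc]
    have e2 : B.tensorEltF hS (shift X) t = ∑ I, ∑ J, X I J •
        ∑ p, revWord (B.Ω hS) (Fin.cons p I) * B.hU (B.f t p) * word B.hγ J := by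
      simp only [tensorEltF, sum_cons (fun I : Fin (m + 1) → ι => _), shift_cons, ite_smul,
        zero_smul, Finset.smul_sum]
      rw [Finset.sum_comm]
      refine Finset.sum_congr rfl fun I _ => ?_
      rw [Finset.sum_comm (f := fun J p => X I J • _)]
      refine Finset.sum_congr rfl fun p _ => ?_
      rw [Finset.sum_eq_single p (fun q _ hq => by simp [Ne.symm hq]) (by simp)]
      simp
    have e3 : B.tensorEltF hS (X * Bm B.σ n) t = ∑ I, ∑ J, X I J • ∑ p, ∑ L : Fin n → ι,
        Bm B.σ n J (Fin.cons p L) • (revWord (B.Ω hS) I * B.hU (B.f t p) * word B.hγ L) := by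
      simp only [tensorEltF, Matrix.mul_apply, Finset.sum_smul, Finset.smul_sum, smul_smul]
      refine Finset.sum_congr rfl fun I _ => ?_
      rw [Finset.sum_congr rfl fun p _ => Finset.sum_comm, Finset.sum_comm]
    rw [e2, e3, tensorElt]
    simp only [Finset.sum_mul, smul_mul_assoc, e1, smul_add, Finset.sum_add_distrib,
      smul_comm (X _ _) ((-1 : k) ^ _), ← Finset.smul_sum]
    rw [add_comm]
  have h2 : B.hω t * B.tensorElt hS X = B.tensorEltF hS (Lch B.σ m * shift X) t := by
    have e1 : ∀ L p (J : Fin (n + 1) → ι), (Lch B.σ m * shift X) L (Fin.cons p J) =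
        ∑ I, Lch B.σ m L (Fin.cons p I) * X I J := by
      intro L p J
      rw [Matrix.mul_apply, sum_cons, Finset.sum_eq_single p (fun q _ hq => by simp [shift_cons, hq])
        (by simp)]
      simp [shift_cons]
    simp only [tensorElt, tensorEltF, e1, Finset.mul_sum, mul_smul_comm, ← mul_assoc,
      hω_mul_revWord_Ω, Finset.sum_mul, smul_mul_assoc, Finset.smul_sum, Finset.sum_smul, smul_smul]
    rw [Finset.sum_congr rfl fun I _ => (Finset.sum_comm.trans
      (Finset.sum_congr rfl fun L _ => Finset.sum_comm)), Finset.sum_comm]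
    refine Finset.sum_congr rfl fun L _ => ?_
    rw [Finset.sum_comm]
    refine Finset.sum_congr rfl fun p _ => ?_
    rw [Finset.sum_comm]
    simp only [mul_comm]
  rw [h1, h2, Matrix.add_mul, tensorEltF_add, Matrix.smul_mul, Matrix.one_mul, tensorEltF_smul]
  abel

theorem vac_tensorElt_mul_word {m n : ℕ} (X : Matrix (Fin m → ι) (Fin n → ι) k) (K : Fin n → ι) :
    B.vac (B.tensorElt hS X * word B.hω K) =
      sgn k n • ∑ I, (X * antisymmetrizer B.σ n) I K • B.vac (revWord (B.Ω hS) I) := by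
  simp only [tensorElt, Finset.sum_mul, smul_mul_assoc, mul_assoc, map_sum, map_smul,
    vac_word_hγ_word_hω, Matrix.mul_apply, Finset.sum_smul, Finset.smul_sum, smul_smul]
  exact Finset.sum_congr rfl fun I _ => Finset.sum_congr rfl fun J _ => by congr 1; ring

theorem vac_tensorElt_mul_word_of_lt {m n l : ℕ} (hl : l < n)
    (X : Matrix (Fin m → ι) (Fin n → ι) k) (K : Fin l → ι) :
    B.vac (B.tensorElt hS X * word B.hω K) = 0 := by
  simp only [tensorElt, Finset.sum_mul, smul_mul_assoc, mul_assoc, map_sum, map_smul,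
    vac_word_hγ_word_hω_of_lt _ _ hl, smul_zero, Finset.sum_const_zero]

theorem vac_tensorEltF_mul_word {m n : ℕ} (Z : Matrix (Fin m → ι) (Fin (n + 1) → ι) k) (t : ι)
    (K : Fin n → ι) : B.vac (B.tensorEltF hS Z t * word B.hω K) =
      sgn k n • ∑ I, (Z * shift (antisymmetrizer B.σ n)) I (Fin.cons t K) •
        B.vac (revWord (B.Ω hS) I) := by
  have e1 : ∀ I, (Z * shift (antisymmetrizer B.σ n)) I (Fin.cons t K) =
      ∑ J, Z I (Fin.cons t J) * antisymmetrizer B.σ n J K := by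
    intro I
    rw [Matrix.mul_apply, sum_cons, Finset.sum_eq_single t (fun q _ hq => by simp [shift_cons, hq])
      (by simp)]
    simp [shift_cons]
  simp only [tensorEltF, Finset.sum_mul, smul_mul_assoc, mul_assoc _ (word _ _), map_sum, map_smul,
    vac_word_hγ_word_hω, vac_mul_hU, B.counit_f, e1, Finset.sum_smul, Finset.smul_sum]
  refine Finset.sum_congr rfl fun I _ => ?_
  rw [Finset.sum_eq_single t (fun q _ hq => by simp [Ne.symm hq]) (by simp)]
  refine Finset.sum_congr rfl fun J _ => ?_
  simp only [if_true, one_smul, smul_smul]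
  congr 1
  ring

theorem vac_tensorEltF_mul_word_of_lt {m n l : ℕ} (hl : l < n)
    (Z : Matrix (Fin m → ι) (Fin (n + 1) → ι) k) (t : ι) (K : Fin l → ι) :
    B.vac (B.tensorEltF hS Z t * word B.hω K) = 0 := by
  simp only [tensorEltF, Finset.sum_mul, smul_mul_assoc, mul_assoc _ (word _ _), map_sum, map_smul,
    vac_word_hγ_word_hω_of_lt _ _ hl, smul_zero, Finset.sum_const_zero]

/-! ### Forms with coefficients in `U` -/

variable (B) in
/-- The span of the elements `ωᴵ u` of degree `n`. -/
def formU (n : ℕ) : Submodule k B.Heis :=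
  Submodule.span k (Set.range fun Iu : (Fin n → ι) × U => word B.hω Iu.1 * B.hU Iu.2)

theorem word_hω_mul_hU_mem {n : ℕ} (I : Fin n → ι) (u : U) :
    word B.hω I * B.hU u ∈ B.formU n := Submodule.subset_span ⟨(I, u), rfl⟩

theorem exists_of_mem_formU {n : ℕ} {x : B.Heis} (hx : x ∈ B.formU n) :
    ∃ u : (Fin n → ι) → U, x = ∑ I, word B.hω I * B.hU (u I) := by
  induction hx using Submodule.span_induction with
  | mem x hx =>
    obtain ⟨⟨I, u⟩, rfl⟩ := hx
    refine ⟨Pi.single I u, ?_⟩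
    rw [Finset.sum_eq_single I (fun K _ hK => by simp [hK, B.hU_zero]) (by simp)]
    simp
  | zero => exact ⟨0, by simp [B.hU_zero]⟩
  | add x y _ _ hx hy =>
    obtain ⟨b, hb⟩ := hx
    obtain ⟨c, hc⟩ := hy
    exact ⟨b + c, by simp [hb, hc, B.hU_add, mul_add, Finset.sum_add_distrib]⟩
  | smul c x _ hx =>
    obtain ⟨b, hb⟩ := hx
    exact ⟨c • b, by simp [hb, B.hU_smul, Finset.smul_sum]⟩

theorem eq_zero_of_mem_formU (hS : Function.Bijective (HopfAlgebra.antipode k (A := U))) {n : ℕ}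
    {x : B.Heis} (hx : x ∈ B.formU n) (h : ∀ a, B.vac (x * B.hA a) = 0) : x = 0 := by
  obtain ⟨u, rfl⟩ := exists_of_mem_formU hx
  exact B.sum_word_hω_mul_hU_eq_zero hS h

theorem mul_mem_of_span {s : Set B.Heis} {N : Submodule k B.Heis} (z : B.Heis)
    (h : ∀ x ∈ s, z * x ∈ N) {x : B.Heis} (hx : x ∈ Submodule.span k s) : z * x ∈ N :=
  (Submodule.span_le (p := N.comap (LinearMap.mulLeft k z))).mpr h hx

theorem hω_mul_mem_formU {n : ℕ} (i : ι) {x : B.Heis} (hx : x ∈ B.formU n) :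
    B.hω i * x ∈ B.formU (n + 1) := by
  refine mul_mem_of_span _ ?_ hx
  rintro _ ⟨⟨I, u⟩, rfl⟩
  rw [← mul_assoc, ← word_cons]
  exact word_hω_mul_hU_mem _ _

theorem hU_mul_mem_formU {n : ℕ} (v : U) {x : B.Heis} (hx : x ∈ B.formU n) :
    B.hU v * x ∈ B.formU n := by
  refine mul_mem_of_span _ ?_ hx
  rintro _ ⟨⟨I, u⟩, rfl⟩
  rw [← mul_assoc, hU_mul_word_hω, Finset.sum_mul]
  refine Submodule.sum_mem _ fun K _ => ?_
  rw [mul_assoc, ← hU_mul]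
  exact word_hω_mul_hU_mem _ _

theorem Ω_mul_mem_formU {n : ℕ} (i : ι) {x : B.Heis} (hx : x ∈ B.formU n) :
    B.Ω hS i * x ∈ B.formU (n + 1) := by
  rw [Ω_eq, Finset.sum_mul]
  refine Submodule.sum_mem _ fun j _ => ?_
  rw [mul_assoc]
  exact hω_mul_mem_formU _ (hU_mul_mem_formU _ hx)

theorem hU_mem_formU (u : U) : B.hU u ∈ B.formU 0 := by
  simpa [word_zero] using word_hω_mul_hU_mem (B := B) Fin.elim0 u

theorem revWord_Ω_mul_hU_mem {n : ℕ} (I : Fin n → ι) (u : U) :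
    revWord (B.Ω hS) I * B.hU u ∈ B.formU n := by
  induction n with
  | zero => simpa [revWord_zero] using hU_mem_formU (B := B) u
  | succ n ih =>
    obtain ⟨I, i, rfl⟩ := exists_snoc I
    rw [revWord_snoc, mul_assoc]
    exact Ω_mul_mem_formU _ (ih I)

end BicovariantBimodule
end NormalOrder

/-! ### The commutators of the BRST operator -/

section Commutators

variable {k : Type*} [Field k] {A : Type*} [Ring A] [HopfAlgebra k A]
  {U : Type*} [Ring U] [HopfAlgebra k U] {P : HopfDuality k A U}
  {ι : Type*} [Fintype ι] [DecidableEq ι]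

namespace BicovariantBimodule

variable (B : BicovariantBimodule P ι)
  (hS : Function.Bijective (HopfAlgebra.antipode k (A := U)))

theorem antisymmetrizer_one : antisymmetrizer B.σ 1 = 1 := by
  rw [antisymmetrizer_succ, Bm_zero, antisymmetrizer, shift_one, mul_one]

theorem antisymmetrizer_two : antisymmetrizer B.σ 2 = 1 - onFirst 0 B.σ := by
  rw [antisymmetrizer_succ, antisymmetrizer_one, Bm_succ, Bm_zero]
  simp [shift_one]

/-- In `ωⁱ = Ωᵖ fⁱₚ` the factor `f` becomes its counit on the vacuum. -/
theorem vac_mul_hω (x : B.Heis) (i : ι) : B.vac (x * B.hω i) = B.vac (x * B.Ω hS i) := by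
  rw [B.hω_eq_sum_Ω hS, Finset.mul_sum, map_sum,
    Finset.sum_eq_single i (fun j _ hj => by
      rw [← mul_assoc, vac_mul_hU, B.counit_f, if_neg (Ne.symm hj), zero_smul]) (by simp),
    ← mul_assoc, vac_mul_hU, B.counit_f, if_pos rfl, one_smul]

theorem vac_word_hω_two (K : Fin 2 → ι) : B.vac (word B.hω K) =
    ∑ I, onFirst 0 B.σ I K • B.vac (revWord (B.Ω hS) I) := by
  obtain ⟨a, K, rfl⟩ := exists_cons K
  obtain ⟨b, K, rfl⟩ := exists_cons K
  rw [word_cons, word_cons, word_zero, mul_one, vac_mul_hω B hS, hω_eq_sum_Ω B hS]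
  simp only [Finset.sum_mul, mul_assoc, hU_mul_Ω, Finset.mul_sum, map_sum]
  simp only [← mul_assoc, vac_mul_hU, P.counit_dualLact, sum_cons, sum_fin_zero, onFirst_cons,
    revWord_cons, revWord_zero, one_mul, Subsingleton.elim Fin.elim0 K, if_true, σ_apply]
  exact Finset.sum_comm

end BicovariantBimodule

namespace BicovariantCalculus

open BicovariantBimodule

variable (B : BicovariantCalculus P ι) {d : B.Ext →ₗ[k] B.Ext}
  (hS : Function.Bijective (HopfAlgebra.antipode k (A := U)))

/-- The element `Ωⁱ χᵢ`. -/
def Ωχ : B.Heis := ∑ i, B.Ω hS i * B.hU (B.χ i)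

theorem Qr_eq (X : (r : ℕ) → Matrix (Fin (r + 1) → ι) (Fin r → ι) k) (r : ℕ) :
    B.Qr hS X r = B.tensorElt hS (X r) := rfl

theorem Q_one (X : (r : ℕ) → Matrix (Fin (r + 1) → ι) (Fin r → ι) k) :
    B.Q hS 1 X = B.Ωχ hS := by
  simp [Q, Ωχ]

theorem Q_succ (X : (r : ℕ) → Matrix (Fin (r + 1) → ι) (Fin r → ι) k) (N : ℕ) :
    B.Q hS (N + 2) X = B.Q hS (N + 1) X + B.tensorElt hS (X (N + 1)) := by
  simp only [Q, Nat.add_sub_cancel, show N + 2 - 1 = N + 1 by omega]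
  rw [Finset.sum_Icc_succ_top (by omega), ← add_assoc, Qr_eq]

theorem Ωχ_mul_hA (hd : B.IsDifferential d) (a : A) :
    B.Ωχ hS * B.hA a = B.hA a * B.Ωχ hS + B.form (d (B.extA a)) := by
  simp only [Ωχ, Finset.sum_mul, mul_assoc, B.hU_χ_hA hd, mul_add, Finset.mul_sum,
    Finset.sum_add_distrib]
  rw [add_comm]
  congr 1
  · refine Finset.sum_congr rfl fun i _ => ?_
    rw [← mul_assoc, B.Ω_mul_hA, mul_assoc]
  · rw [B.form_d_extA hd, Finset.sum_comm]
    refine Finset.sum_congr rfl fun l _ => ?_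
    rw [B.hω_eq_sum_Ω hS, Finset.mul_sum]
    refine Finset.sum_congr rfl fun i _ => ?_
    rw [← mul_assoc, B.Ω_mul_hA, mul_assoc]

/-- All of `d` on `A` comes from `Ωⁱ χᵢ`; the terms `Q_(r)` commute with `A`. -/
theorem Q_mul_hA (hd : B.IsDifferential d)
    (X : (r : ℕ) → Matrix (Fin (r + 1) → ι) (Fin r → ι) k) (N : ℕ) (a : A) :
    B.Q hS (N + 1) X * B.hA a = B.hA a * B.Q hS (N + 1) X + B.form (d (B.extA a)) := by
  induction N with
  | zero => rw [Q_one, Ωχ_mul_hA B hS hd]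
  | succ N ih => rw [Q_succ, add_mul, ih, tensorElt_mul_hA, mul_add]; abel

theorem vac_mul_Ωχ (hd : B.IsDifferential d) (x : B.Heis) : B.vac (x * B.Ωχ hS) = 0 := by
  simp only [Ωχ, Finset.mul_sum, ← mul_assoc, map_sum, B.vac_mul_hU, B.counit_χ hd, zero_smul,
    Finset.sum_const_zero]

theorem vac_Ωχ_mul_hω (t : ι) : B.vac (B.Ωχ hS * B.hω t) =
    ∑ I, B.C I (Fin.cons t Fin.elim0) • B.vac (revWord (B.Ω hS) I) := by
  simp only [Ωχ, Finset.sum_mul, mul_assoc, B.hU_hω, Finset.mul_sum, map_sum]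
  simp only [← mul_assoc, B.vac_mul_hU, P.counit_dualRact, B.vac_mul_hω hS, sum_cons, sum_fin_zero,
    revWord_cons, revWord_zero, one_mul]
  exact Finset.sum_comm

/-- The tensors which satisfy the initial condition and the recurrence up to `X N`. -/
structure IsTensorUpTo (N : ℕ) (X : (r : ℕ) → Matrix (Fin (r + 1) → ι) (Fin r → ι) k) : Prop where
  init : antisymmetrizer B.σ 2 * X 1 = -B.C
  recur : ∀ s, 1 ≤ s → s < N →
    antisymmetrizer B.σ (s + 2) * X (s + 1) * antisymmetrizer B.σ (s + 1) =
      antisymmetrizer B.σ (s + 2) * ((-1 : k) ^ (s + 1) • braidChain B.σ (s + 2) (s + 2) - 1) *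
        shift (X s) * shift (antisymmetrizer B.σ s)

/-- The tensor of the part of `[Q₍ₛ₎, ωᵗ]` which is not cancelled by `[Q₍ᵣ₎, ωᵗ]` for `r < s`. -/
def rest (X : (r : ℕ) → Matrix (Fin (r + 1) → ι) (Fin r → ι) k) (s : ℕ) :
    Matrix (Fin (s + 2) → ι) (Fin (s + 1) → ι) k :=
  (Lch B.σ (s + 1) + (-1 : k) ^ s • 1) * shift (X s)

theorem recur_rhs (X : (r : ℕ) → Matrix (Fin (r + 1) → ι) (Fin r → ι) k) (s : ℕ) :
    antisymmetrizer B.σ (s + 2) * ((-1 : k) ^ (s + 1) • braidChain B.σ (s + 2) (s + 2) - 1) *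
        shift (X s) * shift (antisymmetrizer B.σ s) =
    (-1 : k) ^ (s + 1) • (antisymmetrizer B.σ (s + 2) * B.rest X s *
      shift (antisymmetrizer B.σ s)) := by
  have h : ((-1 : k) ^ (s + 1) • braidChain B.σ (s + 2) (s + 2) - 1) =
      (-1 : k) ^ (s + 1) • (Lch B.σ (s + 1) + (-1 : k) ^ s • 1) := by
    have h1 : (-1 : k) ^ (s + 1 + s) = -1 := Odd.neg_one_pow ⟨s, by ring⟩
    rw [smul_add, smul_smul, ← pow_add, h1, neg_smul, one_smul, ← sub_eq_add_neg, Lch]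
  rw [h, rest]
  simp only [Matrix.mul_smul, Matrix.smul_mul, Matrix.mul_assoc]

/-- On the vacuum `dω` is the `Ω`-word tensor `σ D`, with `D` from the Maurer-Cartan equation. Both
sides therefore agree exactly when `A_{1→2}(C + X - σ D) = 0`. Since `A_{1→2} = 1 - σ` commutes with
`σ` and `A_{1→2} D = -C`, the left side equals `A_{1→2} X + C`. -/
theorem initial_condition_iff (hd : B.IsDifferential d)
    (X : Matrix (Fin 2 → ι) (Fin 1 → ι) k) :
    (∀ t, ∑ I, (B.C + X) I (Fin.cons t Fin.elim0) • B.vac (revWord (B.Ω hS) I) =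
      B.vac (B.form (d (B.extω t)))) ↔ antisymmetrizer B.σ 2 * X = -B.C := by
  obtain ⟨D, hD, hdω⟩ := B.maurer_cartan hd
  have h1 : ∀ t, B.vac (B.form (d (B.extω t))) =
      ∑ I, (onFirst 0 B.σ * D) I (Fin.cons t Fin.elim0) • B.vac (revWord (B.Ω hS) I) := by
    intro t
    rw [hdω, map_sum]
    simp only [map_smul, B.vac_word_hω_two hS, Matrix.mul_apply, Finset.smul_sum,
      Finset.sum_smul, smul_smul]
    rw [Finset.sum_comm]
    simp only [mul_comm]
  have h2 : antisymmetrizer B.σ 2 * (B.C + X - onFirst 0 B.σ * D) =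
      antisymmetrizer B.σ 2 * X + B.C := by
    have h4 : antisymmetrizer B.σ 2 * (onFirst 0 B.σ * D) = -(onFirst 0 B.σ * B.C) := by
      rw [← Matrix.mul_neg, ← hD, ← Matrix.mul_assoc, ← Matrix.mul_assoc, antisymmetrizer_two,
        Matrix.sub_mul, Matrix.mul_sub, Matrix.one_mul, Matrix.mul_one]
    rw [Matrix.mul_sub, Matrix.mul_add, h4, antisymmetrizer_two, Matrix.sub_mul,
      Matrix.one_mul]
    abel
  have h3 : ∀ t, (∑ I, (B.C + X) I (Fin.cons t Fin.elim0) • B.vac (revWord (B.Ω hS) I) =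
      B.vac (B.form (d (B.extω t)))) ↔
      antisymmetrizer B.σ 2 *ᵥ (fun I => (B.C + X - onFirst 0 B.σ * D) I (Fin.cons t Fin.elim0)) =
        0 := by
    intro t
    rw [← B.vac_sum_smul_revWord_Ω_eq_zero_iff hS, map_sum, h1, ← sub_eq_zero,
      ← Finset.sum_sub_distrib]
    simp only [map_smul, map_sub, Matrix.sub_apply, sub_smul]
  simp only [h3]
  rw [eq_neg_iff_add_eq_zero, ← h2]
  constructor
  · intro h
    ext J I
    obtain ⟨t, I, rfl⟩ := exists_cons I
    rw [Subsingleton.elim I Fin.elim0]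
    exact congrFun (h t) J
  · intro h t
    ext J
    exact congrFun (congrFun h J) (Fin.cons t Fin.elim0)

/-- The difference of the two sides is a two-form with coefficients in `U`. It vanishes on the
vacuum by the initial condition, and it moves past `a` by the same rule as `ωᵗ`, so it vanishes on
every `a |0⟩` and is zero. -/
theorem base_commutator (hd : B.IsDifferential d)
    {X : (r : ℕ) → Matrix (Fin (r + 1) → ι) (Fin r → ι) k}
    (hX : antisymmetrizer B.σ 2 * X 1 = -B.C) (t : ι) :
    B.Ωχ hS * B.hω t + B.hω t * B.Ωχ hS + B.tensorEltF hS (X 1) t = B.form (d (B.extω t)) := by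
  obtain ⟨D, hD, hdω⟩ := B.maurer_cartan hd
  rw [← sub_eq_zero]
  have hE : ∀ t, B.vac (B.Ωχ hS * B.hω t + B.hω t * B.Ωχ hS + B.tensorEltF hS (X 1) t -
      B.form (d (B.extω t))) = 0 := by
    intro t
    have h1 : B.vac (B.tensorEltF hS (X 1) t) =
        ∑ I, X 1 I (Fin.cons t Fin.elim0) • B.vac (revWord (B.Ω hS) I) := by
      have h := vac_tensorEltF_mul_word (B := B.toBicovariantBimodule) (hS := hS) (X 1) t Fin.elim0
      simpa [word_zero, sgn, antisymmetrizer, shift_one] using h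
    rw [map_sub, map_add, map_add, vac_Ωχ_mul_hω B hS, vac_mul_Ωχ B hS hd, h1, add_zero,
      ← (B.initial_condition_iff hS hd (X 1)).mpr hX t, ← Finset.sum_add_distrib, sub_eq_zero]
    simp only [Matrix.add_apply, add_smul]
  refine eq_zero_of_mem_formU (n := 2) hS ?_ fun a => ?_
  · refine Submodule.sub_mem _ (Submodule.add_mem _ (Submodule.add_mem _ ?_ ?_) ?_) ?_
    · rw [Ωχ, Finset.sum_mul]
      refine Submodule.sum_mem _ fun i _ => ?_
      rw [mul_assoc]
      refine Ω_mul_mem_formU _ (hU_mul_mem_formU _ ?_)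
      simpa [B.hU_one] using hω_mul_mem_formU t (hU_mem_formU (B := B.toBicovariantBimodule) 1)
    · refine hω_mul_mem_formU _ (Submodule.sum_mem _ fun i _ => ?_)
      exact Ω_mul_mem_formU _ (hU_mem_formU _)
    · refine Submodule.sum_mem _ fun I _ => Submodule.sum_mem _ fun p _ =>
        Submodule.sum_mem _ fun J _ => Submodule.smul_mem _ _ ?_
      rw [word_zero, mul_one]
      exact revWord_Ω_mul_hU_mem _ _
    · rw [hdω]
      refine Submodule.sum_mem _ fun K _ => Submodule.smul_mem _ _ ?_
      simpa [B.hU_one] using word_hω_mul_hU_mem (B := B.toBicovariantBimodule) K 1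
  -- The Leibniz rule for the bimodule relation `ωᵗ a = (fᵗⱼ ▷ a) ωʲ`.
  · have h1 : B.form (d (B.extω t)) * B.hA a = B.hω t * B.form (d (B.extA a)) +
        ∑ j, (B.form (d (B.extA (P.lact (B.f t j) a))) * B.hω j +
          B.hA (P.lact (B.f t j) a) * B.form (d (B.extω j))) := by
      have h := congrArg (fun x => B.form (d x)) (B.extA_bimodule t a)
      simp only [hd.leibniz 1 _ (B.extω_mem t), map_sum, hd.leibniz 0 _ (B.extA_mem _), pow_zero,
        one_smul, pow_one, neg_smul, map_add, map_neg, map_mul B.form] at h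
      rw [← sub_eq_add_neg, sub_eq_iff_eq_add] at h
      exact h.trans (add_comm _ _)
    have h2 : B.tensorEltF hS (X 1) t * B.hA a =
        ∑ j, B.hA (P.lact (B.f t j) a) * B.tensorEltF hS (X 1) j := by
      simp only [tensorEltF, Finset.sum_mul, Finset.mul_sum, smul_mul_assoc, mul_smul_comm,
        word_zero, mul_one, mul_assoc, B.hU_f_hA, Finset.smul_sum]
      simp only [← mul_assoc, B.revWord_Ω_mul_hA]
      rw [Finset.sum_congr rfl fun I _ => (Finset.sum_congr rfl fun p _ => Finset.sum_comm).trans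
        Finset.sum_comm, Finset.sum_comm]
    have h3 : (B.Ωχ hS * B.hω t + B.hω t * B.Ωχ hS + B.tensorEltF hS (X 1) t -
        B.form (d (B.extω t))) * B.hA a = ∑ j, B.hA (P.lact (B.f t j) a) *
        (B.Ωχ hS * B.hω j + B.hω j * B.Ωχ hS + B.tensorEltF hS (X 1) j - B.form (d (B.extω j))) := by
      rw [sub_mul, add_mul, add_mul, h1, h2, mul_assoc, mul_assoc, Ωχ_mul_hA B hS hd, B.hω_hA,
        mul_add (B.hω t), ← mul_assoc (B.hω t), B.hω_hA, Finset.mul_sum, Finset.sum_mul]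
      simp only [← mul_assoc, Ωχ_mul_hA B hS hd, mul_add, mul_sub, add_mul, Finset.sum_add_distrib,
        Finset.sum_sub_distrib]
      abel
    rw [h3, map_sum]
    refine Finset.sum_eq_zero fun j _ => ?_
    rw [B.vac_mul, hE, map_zero]

/-- The commutators telescope: the contraction of the new summand cancels what the previous ones
left over, and only the uncontracted piece of the last summand remains. -/
theorem Q_anticomm_hω (hd : B.IsDifferential d) {N : ℕ}
    {X : (r : ℕ) → Matrix (Fin (r + 1) → ι) (Fin r → ι) k} (hX : B.IsTensorUpTo (N + 1) X) (t : ι) :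
    B.Q hS (N + 2) X * B.hω t + B.hω t * B.Q hS (N + 2) X =
      B.form (d (B.extω t)) + B.tensorEltF hS (B.rest X (N + 1)) t := by
  induction N with
  | zero =>
    have h := tensorElt_anticomm_hω (B := B.toBicovariantBimodule) (hS := hS) (X 1) t
    rw [Q_succ, Q_one, ← base_commutator B hS hd hX.init t, add_mul, mul_add]
    rw [Bm_zero, Matrix.mul_one, pow_zero, one_smul] at h
    rw [add_assoc (_ + _), rest, ← h]
    abel
  | succ N ih =>
    have h := tensorElt_anticomm_hω (B := B.toBicovariantBimodule) (hS := hS) (X (N + 2)) t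
    have h1 := ih ⟨hX.init, fun s h1 h2 => hX.recur s h1 (by omega)⟩
    rw [Q_succ, add_mul, mul_add, add_add_add_comm, h1, h, rest, rest, add_assoc, ← add_assoc
      (B.tensorEltF hS _ t), ← tensorEltF_smul, ← tensorEltF_add]
    congr 1
    have h2 := hX.recur (N + 1) (by omega) (by omega)
    rw [recur_rhs, rest] at h2
    rw [tensorEltF_eq_zero, zero_add]
    have h3 : antisymmetrizer B.σ (N + 3) * (X (N + 2) * Bm B.σ (N + 1)) *
        shift (antisymmetrizer B.σ (N + 1)) =
        antisymmetrizer B.σ (N + 3) * X (N + 2) * antisymmetrizer B.σ (N + 2) := by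
      rw [antisymmetrizer_succ B.σ (N + 1), Matrix.mul_assoc, Matrix.mul_assoc, Matrix.mul_assoc]
    have h4 : (-1 : k) ^ (N + 1 + (N + 1 + 1)) = -1 := Odd.neg_one_pow ⟨N + 1, by ring⟩
    rw [Matrix.mul_add, Matrix.add_mul, Matrix.mul_smul, Matrix.smul_mul, h3, h2, smul_smul,
      ← pow_add, h4, neg_smul, one_smul, add_neg_cancel]

theorem vac_mul_Q (hd : B.IsDifferential d)
    (X : (r : ℕ) → Matrix (Fin (r + 1) → ι) (Fin r → ι) k) (N : ℕ) (x : B.Heis) :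
    B.vac (x * B.Q hS (N + 1) X) = 0 := by
  induction N with
  | zero => rw [Q_one, vac_mul_Ωχ B hS hd]
  | succ N ih =>
    have h := vac_tensorElt_mul_word_of_lt (B := B.toBicovariantBimodule) (hS := hS) (Nat.succ_pos N) (X (N + 1)) Fin.elim0
    rw [word_zero, mul_one] at h
    rw [Q_succ, mul_add, map_add, ih, B.vac_mul, h, map_zero, add_zero]

theorem d_one (hd : B.IsDifferential d) : d 1 = 0 := by
  have h := hd.leibniz 0 _ (B.extA_mem 1) 1
  simpa using h

theorem form_d_word_cons (hd : B.IsDifferential d) (t : ι) {n : ℕ} (K : Fin n → ι) :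
    B.form (d (word B.extω (Fin.cons t K))) = B.form (d (B.extω t)) * word B.hω K -
      B.hω t * B.form (d (word B.extω K)) := by
  rw [word_cons, hd.leibniz 1 _ (B.extω_mem t), pow_one, neg_smul, one_smul, ← sub_eq_add_neg,
    map_sub, map_mul, map_mul, map_word]
  rfl

/-- After `ωᵗ` has been pulled out, the leftover contains `N + 1` letters `γ`, more than the
remaining word has letters. -/
theorem vac_Q_mul_word (hd : B.IsDifferential d) {N : ℕ}
    {X : (r : ℕ) → Matrix (Fin (r + 1) → ι) (Fin r → ι) k} (hX : B.IsTensorUpTo (N + 1) X)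
    {n : ℕ} (hn : n ≤ N + 1) (K : Fin n → ι) :
    B.vac (B.Q hS (N + 2) X * word B.hω K) = B.vac (B.form (d (word B.extω K))) := by
  induction n with
  | zero =>
    rw [word_zero, word_zero, mul_one, d_one B hd, map_zero, map_zero]
    simpa using vac_mul_Q B hS hd X (N + 1) 1
  | succ n ih =>
    obtain ⟨t, K, rfl⟩ := exists_cons K
    rw [form_d_word_cons B hd, word_cons, ← mul_assoc, eq_sub_of_add_eq (Q_anticomm_hω B hS hd hX t),
      sub_mul, add_mul, map_sub, map_sub, map_add, vac_tensorEltF_mul_word_of_lt (by omega), add_zero,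
      mul_assoc, B.vac_congr (ih (by omega) K)]

/-- The first length at which the leftover survives: its `γ`s are contracted completely. Both the
solvability and the necessity of the next equation are read off here. -/
theorem vac_Q_mul_word_top (hd : B.IsDifferential d) {N : ℕ}
    {X : (r : ℕ) → Matrix (Fin (r + 1) → ι) (Fin r → ι) k} (hX : B.IsTensorUpTo (N + 1) X)
    (K : Fin (N + 2) → ι) :
    B.vac (B.Q hS (N + 2) X * word B.hω K) = B.vac (B.form (d (word B.extω K))) +
      sgn k (N + 1) • ∑ I, (B.rest X (N + 1) * shift (antisymmetrizer B.σ (N + 1))) I K •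
        B.vac (revWord (B.Ω hS) I) := by
  obtain ⟨t, K, rfl⟩ := exists_cons K
  rw [form_d_word_cons B hd, word_cons, ← mul_assoc, eq_sub_of_add_eq (Q_anticomm_hω B hS hd hX t),
    sub_mul, add_mul, map_sub, map_sub, map_add, vac_tensorEltF_mul_word,
    mul_assoc, B.vac_congr (vac_Q_mul_word B hS hd hX le_rfl K)]
  abel

end BicovariantCalculus
end Commutators

/-! ### The recurrence -/

section Recurrence

variable {k : Type*} [Field k] {A : Type*} [Ring A] [HopfAlgebra k A]
  {U : Type*} [Ring U] [HopfAlgebra k U] {P : HopfDuality k A U}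
  {ι : Type*} [Fintype ι] [DecidableEq ι]

theorem Intertwines.map_eq {R : Type*} [Ring R] [Algebra k R] {g : ι → ι → R} {n m : ℕ}
    {Z : Matrix (Fin n → ι) (Fin m → ι) k} (hZ : Intertwines k g Z) :
    gword g n * Z.map (algebraMap k R) = Z.map (algebraMap k R) * gword g m := by
  ext I J
  have h := hZ I J
  simp only [Algebra.smul_def] at h
  simp only [Matrix.mul_apply, Matrix.map_apply, ← Algebra.commutes]
  exact h

namespace BicovariantBimodule

variable (B : BicovariantBimodule P ι)
  (hS : Function.Bijective (HopfAlgebra.antipode k (A := U)))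

/-- The commutator with `u` is an element of the same form with coefficient `Z = r⋯r X - X r⋯r`.
Since the antisymmetrizers intertwine the words in `r`, it is enough that `A Z A = 0`, which the
hypothesis provides. -/
theorem hU_mul_tensorElt {m n : ℕ} {X : Matrix (Fin m → ι) (Fin n → ι) k}
    (hX : Intertwines k B.rT (antisymmetrizer B.σ m * X * antisymmetrizer B.σ n)) (u : U) :
    B.hU u * B.tensorElt hS X = B.tensorElt hS X * B.hU u := by
  let a := algebraMap k A
  let Z : Matrix (Fin m → ι) (Fin n → ι) A := gword B.rT m * X.map a - X.map a * gword B.rT n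
  have hZ : (antisymmetrizer B.σ m).map a * Z * (antisymmetrizer B.σ n).map a = 0 := by
    have h1 := (intertwines_antisymmetrizer B.σ B.intertwines_r m).map_eq
    have h2 := (intertwines_antisymmetrizer B.σ B.intertwines_r n).map_eq
    have h3 := hX.map_eq
    simp only [Matrix.map_mul] at h3
    change _ * (_ - _) * _ = 0
    rw [Matrix.mul_sub, Matrix.sub_mul, ← Matrix.mul_assoc, ← Matrix.mul_assoc, ← h1,
      Matrix.mul_assoc _ (gword B.rT n), h2, ← Matrix.mul_assoc, sub_eq_zero, ← h3]
    simp only [Matrix.mul_assoc]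
    rfl
  let φ : A →ₗ[k] B.Heis := B.hUₐ.toLinearMap ∘ₗ P.dualLactₗ.flip u
  have hφ : ∀ x, φ x = B.hU (P.dualLact x u) := fun _ => rfl
  rw [← sub_eq_zero]
  refine Eq.trans ?_ ((B.rowKer_revWord_Ω hS m).sum_mul_mul_eq_zero (B.colKer_word_hγ n)
    (z := fun I J => φ (Z I J)) fun x y => ?_)
  · have e1 : B.hU u * B.tensorElt hS X = ∑ I, ∑ J,
        revWord (B.Ω hS) I * φ ((gword B.rT m * X.map a) I J) * word B.hγ J := by
      simp only [tensorElt, Finset.mul_sum, mul_smul_comm, ← mul_assoc, hU_mul_revWord_Ω,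
        Finset.sum_mul, Finset.smul_sum, Matrix.mul_apply, map_sum, Matrix.map_apply]
      rw [Finset.sum_comm]
      rw [Finset.sum_congr rfl fun J _ => Finset.sum_comm, Finset.sum_comm]
      refine Finset.sum_congr rfl fun I _ => Finset.sum_congr rfl fun J _ =>
        Finset.sum_congr rfl fun K _ => ?_
      rw [← Algebra.commutes, ← Algebra.smul_def, map_smul, hφ, mul_smul_comm, smul_mul_assoc]
    have e2 : B.tensorElt hS X * B.hU u = ∑ I, ∑ J,
        revWord (B.Ω hS) I * φ ((X.map a * gword B.rT n) I J) * word B.hγ J := by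
      simp only [tensorElt, Finset.sum_mul, smul_mul_assoc, mul_assoc, word_hγ_mul_hU,
        Finset.mul_sum, Finset.smul_sum, Matrix.mul_apply, map_sum, Matrix.map_apply]
      refine Finset.sum_congr rfl fun I _ => ?_
      rw [Finset.sum_comm]
      refine Finset.sum_congr rfl fun J _ => Finset.sum_congr rfl fun K _ => ?_
      rw [← Algebra.smul_def, map_smul, hφ, smul_mul_assoc, mul_smul_comm]
    rw [e1, e2, ← Finset.sum_sub_distrib]
    refine Finset.sum_congr rfl fun I _ => ?_
    rw [← Finset.sum_sub_distrib]
    refine Finset.sum_congr rfl fun J _ => ?_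
    rw [← sub_mul, ← mul_sub, ← map_sub]
    rfl
  · have h1 := congrArg φ (congrFun (congrFun hZ x) y)
    rw [Matrix.zero_apply, map_zero] at h1
    simp only [Matrix.mul_apply, Finset.sum_mul, Matrix.map_apply, map_sum] at h1
    rw [Finset.sum_comm] at h1
    refine Eq.trans ?_ h1
    refine Finset.sum_congr rfl fun I _ => Finset.sum_congr rfl fun J _ => ?_
    rw [← Algebra.commutes, ← Algebra.smul_def, ← Algebra.smul_def, map_smul, map_smul, smul_comm]

end BicovariantBimodule

namespace BicovariantCalculus

open BicovariantBimodule

variable (B : BicovariantCalculus P ι) {d : B.Ext →ₗ[k] B.Ext}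
  (hS : Function.Bijective (HopfAlgebra.antipode k (A := U)))
  {X X' : (r : ℕ) → Matrix (Fin (r + 1) → ι) (Fin r → ι) k}

/-! #### Uniqueness -/

/-- The right-hand side is brought to a form that involves `X s` only between two antisymmetrizers.
For the `1` this is the definition of `A_{1→s+2}`; for the chain, split off the last space by `Dm`
and let the chain carry `A_{1→s+1}` to the last spaces. -/
theorem conj_succ (hX : B.IsBRSTTensor X) (s : ℕ) (hs : 1 ≤ s) :
    antisymmetrizer B.σ (s + 2) * X (s + 1) * antisymmetrizer B.σ (s + 1) =
      ((-1 : k) ^ (s + 1) • (Dm B.σ (s + 1) * Lch B.σ (s + 1)) - Bm B.σ (s + 1)) *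
        shift (antisymmetrizer B.σ (s + 1) * X s * antisymmetrizer B.σ s) := by
  have h1 : antisymmetrizer B.σ (s + 2) * Lch B.σ (s + 1) =
      Dm B.σ (s + 1) * Lch B.σ (s + 1) * shift (antisymmetrizer B.σ (s + 1)) := by
    rw [B.antisymmetrizer_eq_Dm, Matrix.mul_assoc, Matrix.mul_assoc, B.Lch_mul_shift
      (intertwines_antisymmetrizer B.σ B.intertwines_r _)]
  have h2 : braidChain B.σ (s + 2) (s + 2) = Lch B.σ (s + 1) := rfl
  rw [hX.recur s hs, h2, Matrix.mul_sub, Matrix.mul_smul, h1, Matrix.mul_one,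
    antisymmetrizer_succ B.σ (s + 1), ← Matrix.smul_mul, ← Matrix.sub_mul, shift_mul, shift_mul]
  simp only [Matrix.mul_assoc]

theorem conj_one (hX : B.IsBRSTTensor X) :
    antisymmetrizer B.σ 2 * X 1 * antisymmetrizer B.σ 1 = -B.C := by
  rw [antisymmetrizer_one, Matrix.mul_one, hX.init]

theorem conj_unique (hX : B.IsBRSTTensor X) (hX' : B.IsBRSTTensor X') (r : ℕ) :
    antisymmetrizer B.σ (r + 2) * X (r + 1) * antisymmetrizer B.σ (r + 1) =
      antisymmetrizer B.σ (r + 2) * X' (r + 1) * antisymmetrizer B.σ (r + 1) := by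
  induction r with
  | zero => rw [conj_one B hX, conj_one B hX']
  | succ r ih => rw [conj_succ B hX _ (by omega), conj_succ B hX' _ (by omega), ih]

theorem Qr_unique (hX : B.IsBRSTTensor X) (hX' : B.IsBRSTTensor X') (r : ℕ) (hr : 1 ≤ r) :
    B.Qr hS X r = B.Qr hS X' r := by
  obtain ⟨r, rfl⟩ : ∃ q, r = q + 1 := ⟨r - 1, by omega⟩
  have h : B.tensorElt hS (X (r + 1) - X' (r + 1)) = 0 := tensorElt_eq_zero (by
    rw [Matrix.mul_sub, Matrix.sub_mul, conj_unique B hX hX', sub_self])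
  rw [Qr_eq, Qr_eq, ← sub_add_cancel (X (r + 1)) (X' (r + 1)), tensorElt_add, h, zero_add]

theorem intertwines_conj (hX : B.IsBRSTTensor X) (r : ℕ) : Intertwines k B.rT
    (antisymmetrizer B.σ (r + 2) * X (r + 1) * antisymmetrizer B.σ (r + 1)) := by
  induction r with
  | zero =>
    rw [conj_one B hX, ← neg_one_smul k]
    exact B.intertwines_C.smul _
  | succ r ih =>
    rw [conj_succ B hX _ (by omega)]
    exact ((((intertwines_Dm B.σ B.intertwines_r _).mul
      (intertwines_Lch B.σ B.intertwines_r _)).smul _).sub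
      (intertwines_Bm B.σ B.intertwines_r _)).mul ih.shift

theorem hU_mul_Ωχ (u : U) : B.hU u * B.Ωχ hS = B.Ωχ hS * B.hU u := by
  simp only [Ωχ, Finset.mul_sum, Finset.sum_mul, mul_assoc, ← B.hU_mul, B.χ_mul, B.hU_sum]
  rw [Finset.sum_comm]
  refine Finset.sum_congr rfl fun i _ => ?_
  rw [← mul_assoc, B.hU_mul_Ω, Finset.sum_mul]
  simp only [mul_assoc, ← B.hU_mul]

theorem hU_mul_Q (hX : B.IsBRSTTensor X) (u : U) (N : ℕ) :
    B.hU u * B.Q hS (N + 1) X = B.Q hS (N + 1) X * B.hU u := by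
  induction N with
  | zero => rw [Q_one, hU_mul_Ωχ]
  | succ N ih => rw [Q_succ, mul_add, add_mul, ih, B.hU_mul_tensorElt hS (B.intertwines_conj hX N)]

/-! #### Existence -/

/-- The solvability condition of the next equation: for such `c` the form `∑ c_K ω^K` vanishes,
hence so do its images under `Q` and under `d`, and their difference on the vacuum is the leftover
applied to `c`. -/
theorem mulVec_rest_eq_zero (hS : Function.Bijective (HopfAlgebra.antipode k (A := U)))
    (hd : B.IsDifferential d) {N : ℕ} (hX : B.IsTensorUpTo (N + 1) X)
    {c : (Fin (N + 2) → ι) → k} (hc : antisymmetrizer B.σ (N + 2) *ᵥ c = 0) :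
    (antisymmetrizer B.σ (N + 3) * (B.rest X (N + 1) * shift (antisymmetrizer B.σ (N + 1)))) *ᵥ c
      = 0 := by
  rw [← Matrix.mulVec_mulVec, ← B.vac_sum_smul_revWord_Ω_eq_zero_iff hS]
  have h1 : B.vac (B.Q hS (N + 2) X * ∑ K, c K • word B.hω K) = 0 := by
    have h : ∑ K, c K • word B.hω K = 0 := B.rowKer_word_hω _ c hc
    rw [h, mul_zero, map_zero]
  have h2 : ∑ K, c K • B.vac (B.form (d (word B.extω K))) = 0 := by
    simp only [← map_smul]
    rw [← map_sum, ← map_sum, ← map_sum, B.ext_wedge _ c hc]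
    simp
  rw [Finset.mul_sum, map_sum] at h1
  simp only [mul_smul_comm, map_smul, vac_Q_mul_word_top B hS hd hX, smul_add,
    Finset.sum_add_distrib, h2, zero_add, smul_comm (c _) (sgn k (N + 1)), ← Finset.smul_sum] at h1
  have h3 := congrArg (fun v => sgn k (N + 1) • v) h1
  simp only [smul_smul, sgn_mul_self, one_smul, smul_zero] at h3
  rw [← h3, map_sum]
  simp only [map_sum, map_smul, Matrix.mulVec, dotProduct, Finset.sum_smul, Finset.smul_sum,
    smul_smul]
  rw [Finset.sum_comm]
  simp only [mul_comm]

theorem exists_isTensorUpTo (hS : Function.Bijective (HopfAlgebra.antipode k (A := U)))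
    (hd : B.IsDifferential d) (N : ℕ) : ∃ X, B.IsTensorUpTo (N + 1) X := by
  induction N with
  | zero =>
    obtain ⟨D, hD, -⟩ := B.maurer_cartan hd
    exact ⟨Function.update 0 1 D, by simpa using hD, fun s h1 h2 => by omega⟩
  | succ N ih =>
    obtain ⟨X, hX⟩ := ih
    obtain ⟨G, hG⟩ := exists_generalized_inverse (antisymmetrizer B.σ (N + 2))
    let V := B.rest X (N + 1) * shift (antisymmetrizer B.σ (N + 1))
    -- The columns of `G A - 1` lie in the kernel of `A` because `A G A = A`, so the solvability
    -- condition applies to them.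
    have hV : antisymmetrizer B.σ (N + 3) * (V * G) * antisymmetrizer B.σ (N + 2) =
        antisymmetrizer B.σ (N + 3) * V := by
      rw [← sub_eq_zero]
      ext I J
      have h := congrFun (B.mulVec_rest_eq_zero hS hd hX
        (c := fun K => (G * antisymmetrizer B.σ (N + 2) - 1) K J) (by
          have h1 : antisymmetrizer B.σ (N + 2) * (G * antisymmetrizer B.σ (N + 2) - 1) = 0 := by
            rw [Matrix.mul_sub, ← Matrix.mul_assoc, hG, Matrix.mul_one, sub_self]
          ext K
          exact congrFun (congrFun h1 K) J)) I
      have h2 : antisymmetrizer B.σ (N + 3) * (V * G) * antisymmetrizer B.σ (N + 2) -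
        antisymmetrizer B.σ (N + 3) * V =
        antisymmetrizer B.σ (N + 3) * V * (G * antisymmetrizer B.σ (N + 2) - 1) := by
        rw [Matrix.mul_sub, Matrix.mul_one]
        simp only [Matrix.mul_assoc]
      rw [h2]
      exact h
    refine ⟨Function.update X (N + 2) ((-1 : k) ^ (N + 2) • (V * G)), ?_, fun s h1 h2 => ?_⟩
    · rw [Function.update_of_ne (by omega)]
      exact hX.init
    · rcases Nat.lt_or_ge s (N + 1) with h3 | h3
      · rw [Function.update_of_ne (by omega), Function.update_of_ne (by omega)]
        exact hX.recur s h1 h3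
      · obtain rfl : s = N + 1 := by omega
        rw [recur_rhs, Function.update_self, Matrix.mul_smul, Matrix.smul_mul, hV, rest,
          Function.update_of_ne (by omega), Matrix.mul_assoc (antisymmetrizer B.σ (N + 1 + 2))]
        rfl

theorem IsTensorUpTo.isBRSTTensor (hX : ∀ N, B.IsTensorUpTo (N + 1) X) :
    B.IsBRSTTensor X where
  init := (hX 0).init
  recur s hs := (hX s).recur s hs (by omega)

theorem exists_isBRSTTensor (hS : Function.Bijective (HopfAlgebra.antipode k (A := U)))
    (hd : B.IsDifferential d) {h : ℕ} (hh : IsHeight B.σ h) : ∃ X, B.IsBRSTTensor X := by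
  obtain ⟨X, hX⟩ := B.exists_isTensorUpTo hS hd h
  refine ⟨X, hX.init, fun s hs => ?_⟩
  rcases Nat.lt_or_ge s (h + 1) with h1 | h1
  · exact hX.recur s hs h1
  -- Above the height both sides of the recurrence contain a vanishing antisymmetrizer.
  · rw [hh.2 (s + 2) (by omega)]
    simp

theorem IsBRSTTensor.upTo (hX : B.IsBRSTTensor X) (N : ℕ) : B.IsTensorUpTo N X :=
  ⟨hX.init, fun s hs _ => hX.recur s hs⟩

/-! #### Necessity -/

theorem Q_eq_of_le {h : ℕ} (hh : IsHeight B.σ h) (N : ℕ) (hN : h ≤ N + 1) :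
    B.Q hS h X = B.Q hS (N + 1) X := by
  induction N with
  | zero =>
    match h with
    -- Truncated subtraction: for `0` and `1` the sum over `r` is empty alike.
    | 0 => simp [Q]
    | h + 1 => rw [show h = 0 by omega]
  | succ N ih =>
    rcases Nat.lt_or_ge (N + 1) h with h1 | h1
    · rw [show h = N + 2 by omega]
    · rw [ih h1, Q_succ, tensorElt_eq_zero, add_zero]
      rw [hh.2 (N + 1 + 1) (by omega)]
      simp

theorem vac_Q_mul_word_of_le {n : ℕ} (K : Fin n → ι) (N : ℕ) (hN : n ≤ N) :
    B.vac (B.Q hS (N + 1) X * word B.hω K) = B.vac (B.Q hS (n + 1) X * word B.hω K) := by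
  induction N with
  | zero =>
    obtain rfl : n = 0 := by omega
    rfl
  | succ N ih =>
    rcases Nat.lt_or_ge N n with h1 | h1
    · obtain rfl : n = N + 1 := by omega
      rfl
    · rw [Q_succ, add_mul, map_add, vac_tensorElt_mul_word_of_lt (by omega), add_zero, ih h1]

theorem vac_Q_mul_form (hd : B.IsDifferential d) {h : ℕ} (hh : IsHeight B.σ h)
    (hQ : B.Generates d (B.Q hS h X)) {n : ℕ} {η : B.Ext} (hη : η ∈ B.extDeg n) :
    B.vac (B.Q hS h X * B.form η) = B.vac (B.form (d η)) := by
  rw [hQ n η hη, map_sub, map_smul, B.Q_eq_of_le hS hh h (by omega), vac_mul_Q B hS hd, smul_zero,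
    sub_zero]

theorem isTensorUpTo_of_generates (hd : B.IsDifferential d) {h : ℕ} (hh : IsHeight B.σ h)
    (hQ : B.Generates d (B.Q hS h X)) (N : ℕ) : B.IsTensorUpTo (N + 1) X := by
  -- On a word of length `n` only the summands with `r ≤ n` act, so the full `Q` can be truncated.
  have hw : ∀ {n : ℕ} (K : Fin n → ι), B.vac (B.Q hS (n + 1) X * word B.hω K) =
      B.vac (B.form (d (word B.extω K))) := by
    intro n K
    rw [← B.vac_Q_mul_form hS hd hh hQ (B.word_extω_mem K), map_word,
      B.Q_eq_of_le hS hh (n + h) (by omega)]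
    exact (B.vac_Q_mul_word_of_le hS K (n + h) (by omega)).symm
  induction N with
  | zero =>
    refine ⟨(B.initial_condition_iff hS hd (X 1)).mp fun t => ?_, fun s h1 h2 => by omega⟩
    have h1 := hw (Fin.cons t Fin.elim0 : Fin 1 → ι)
    rw [Q_succ, Q_one, add_mul, map_add, vac_tensorElt_mul_word, word_cons, word_zero, mul_one,
      vac_Ωχ_mul_hω, word_cons, word_zero, mul_one, antisymmetrizer_one, Matrix.mul_one] at h1
    rw [← h1]
    simp [sgn, add_smul, Finset.sum_add_distrib]
  | succ N ih =>
    refine ⟨ih.init, fun s h1 h2 => ?_⟩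
    rcases Nat.lt_or_ge s (N + 1) with h3 | h3
    · exact ih.recur s h1 h3
    obtain rfl : s = N + 1 := by omega
    let V := B.rest X (N + 1) * shift (antisymmetrizer B.σ (N + 1))
    -- On words of length `N + 2` the earlier summands exceed `d` by the leftover `V`, and the next
    -- one adds its tensor times `A_{1→N+2}`. As `Q` generates `d`, the sum vanishes as a
    -- combination of `Ω`-words on the vacuum.
    have h4 : antisymmetrizer B.σ (N + 3) *
        (V + (-1 : k) ^ (N + 1) • (X (N + 2) * antisymmetrizer B.σ (N + 2))) = 0 := by
      ext J K
      have h5 := hw K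
      have e : sgn k (N + 2) = sgn k (N + 1) * (-1) ^ (N + 1) := mul_comm _ _
      rw [Q_succ, add_mul, map_add, vac_Q_mul_word_top B hS hd ih, vac_tensorElt_mul_word, add_assoc,
        add_eq_left, e, mul_smul, ← smul_add] at h5
      have h6 := congrArg (fun v => sgn k (N + 1) • v) h5
      simp only [smul_smul, sgn_mul_self, one_smul, smul_zero] at h6
      refine congrFun ((B.vac_sum_smul_revWord_Ω_eq_zero_iff hS fun I =>
        (V + (-1 : k) ^ (N + 1) • (X (N + 2) * antisymmetrizer B.σ (N + 2))) I K).mp ?_) J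
      rw [← h6, map_sum, Finset.smul_sum, ← Finset.sum_add_distrib]
      simp only [map_add, map_smul, Matrix.add_apply, Matrix.smul_apply, add_smul, smul_assoc]
      rfl
    rw [recur_rhs, Matrix.mul_assoc, Matrix.mul_assoc]
    rw [Matrix.mul_add, Matrix.mul_smul, add_eq_zero_iff_eq_neg] at h4
    change _ = _ • (_ * V)
    rw [h4, smul_neg, smul_smul, ← pow_add, Odd.neg_one_pow ⟨N + 1, by ring⟩]
    simp

theorem isBRSTTensor_of_generates (hd : B.IsDifferential d) {h : ℕ} (hh : IsHeight B.σ h)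
    (hQ : B.Generates d (B.Q hS h X)) : B.IsBRSTTensor X :=
  IsTensorUpTo.isBRSTTensor B fun N => B.isTensorUpTo_of_generates hS hd hh hQ N

end BicovariantCalculus
end Recurrence

/-! ### The square of the BRST operator -/

section Square

variable {k : Type*} [Field k] {A : Type*} [Ring A] [HopfAlgebra k A]
  {U : Type*} [Ring U] [HopfAlgebra k U] {P : HopfDuality k A U}
  {ι : Type*} [Fintype ι] [DecidableEq ι]

namespace BicovariantBimodule

variable (B : BicovariantBimodule P ι)
  (hS : Function.Bijective (HopfAlgebra.antipode k (A := U)))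

/-- The span of the elements `Ω^{iₘ} ⋯ Ω^{i₁} u γ_{j₁} ⋯ γ_{jₗ}` with `l ≥ n` and `m - l = z`. -/
def normal (n : ℕ) (z : ℤ) : Submodule k B.Heis :=
  Submodule.span k {x | ∃ (m l : ℕ) (I : Fin m → ι) (u : U) (J : Fin l → ι),
    n ≤ l ∧ (m : ℤ) - l = z ∧ x = revWord (B.Ω hS) I * B.hU u * word B.hγ J}

variable {B hS}

theorem mem_normal {n m l : ℕ} {z : ℤ} (I : Fin m → ι) (u : U) (J : Fin l → ι) (hn : n ≤ l)
    (hz : (m : ℤ) - l = z) : revWord (B.Ω hS) I * B.hU u * word B.hγ J ∈ B.normal hS n z :=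
  Submodule.subset_span ⟨m, l, I, u, J, hn, hz, rfl⟩

theorem Ω_mul_mem_normal {n : ℕ} {z : ℤ} (i : ι) {x : B.Heis} (hx : x ∈ B.normal hS n z) :
    B.Ω hS i * x ∈ B.normal hS n (z + 1) := by
  refine mul_mem_of_span _ ?_ hx
  rintro _ ⟨m, l, I, u, J, hn, hz, rfl⟩
  rw [← mul_assoc, ← mul_assoc, ← revWord_snoc]
  exact mem_normal _ _ _ hn (by push_cast; omega)

theorem hU_mul_mem_normal {n : ℕ} {z : ℤ} (v : U) {x : B.Heis} (hx : x ∈ B.normal hS n z) :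
    B.hU v * x ∈ B.normal hS n z := by
  refine mul_mem_of_span _ ?_ hx
  rintro _ ⟨m, l, I, u, J, hn, hz, rfl⟩
  rw [← mul_assoc, ← mul_assoc, hU_mul_revWord_Ω, Finset.sum_mul, Finset.sum_mul]
  refine Submodule.sum_mem _ fun K _ => ?_
  rw [mul_assoc (revWord _ _), ← hU_mul]
  exact mem_normal _ _ _ hn hz

theorem hγ_mul_mem_normal {z : ℤ} (i : ι) {x : B.Heis} (hx : x ∈ B.normal hS 0 z) :
    B.hγ i * x ∈ B.normal hS 0 (z - 1) := by
  refine mul_mem_of_span _ ?_ hx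
  clear hx
  rintro _ ⟨m, l, I, u, J, -, hz, rfl⟩
  induction m generalizing i z with
  | zero =>
    rw [revWord_zero, one_mul, ← mul_assoc, hγ_hU, Finset.sum_mul]
    refine Submodule.sum_mem _ fun j _ => ?_
    rw [mul_assoc, ← word_cons]
    have h := mem_normal (B := B) (hS := hS) (n := 0) (z := z - 1) I
      (P.dualLact (B.r j i) u) (Fin.cons j J : Fin (l + 1) → ι) (Nat.zero_le _)
      (by push_cast at hz ⊢; omega)
    rwa [revWord_zero, one_mul] at h
  | succ m ih =>
    obtain ⟨I, p, rfl⟩ := exists_snoc I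
    rw [revWord_snoc, mul_assoc, mul_assoc, ← mul_assoc (B.hγ i), hγ_mul_Ω, sub_mul,
      ← mul_assoc (revWord _ _)]
    refine Submodule.sub_mem _ ?_ ?_
    · split_ifs
      · rw [one_mul]
        exact mem_normal _ _ _ (Nat.zero_le _) (by push_cast at hz ⊢; omega)
      · rw [zero_mul]
        exact Submodule.zero_mem _
    · simp only [Finset.sum_mul, smul_mul_assoc, mul_assoc (B.Ω hS _)]
      refine Submodule.sum_mem _ fun q _ => Submodule.sum_mem _ fun j _ =>
        Submodule.smul_mem _ _ ?_
      have h := Ω_mul_mem_normal q (ih (z := z - 1) j I (by push_cast at hz ⊢; omega))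
      rwa [show z - 1 - 1 + 1 = z - 1 by ring] at h

theorem word_hγ_mul_mem_normal {z : ℤ} {n : ℕ} (J : Fin n → ι) {x : B.Heis}
    (hx : x ∈ B.normal hS 0 z) : word B.hγ J * x ∈ B.normal hS 0 (z - n) := by
  induction n with
  | zero => simpa [word_zero] using hx
  | succ n ih =>
    obtain ⟨i, J, rfl⟩ := exists_cons J
    rw [word_cons, mul_assoc]
    convert hγ_mul_mem_normal i (ih J) using 1
    push_cast
    ring_nf

theorem revWord_Ω_mul_mem_normal {z : ℤ} {m : ℕ} (I : Fin m → ι) {x : B.Heis}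
    (hx : x ∈ B.normal hS 0 z) : revWord (B.Ω hS) I * x ∈ B.normal hS 0 (z + m) := by
  induction m with
  | zero => simpa [revWord_zero] using hx
  | succ m ih =>
    obtain ⟨I, i, rfl⟩ := exists_snoc I
    rw [revWord_snoc, mul_assoc]
    convert Ω_mul_mem_normal i (ih I) using 1
    push_cast
    ring_nf

theorem tensorElt_mul_mem_normal {z : ℤ} {m n : ℕ} (X : Matrix (Fin m → ι) (Fin n → ι) k)
    {x : B.Heis} (hx : x ∈ B.normal hS 0 z) :
    B.tensorElt hS X * x ∈ B.normal hS 0 (z + m - n) := by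
  simp only [tensorElt, Finset.sum_mul, smul_mul_assoc, mul_assoc]
  refine Submodule.sum_mem _ fun I _ => Submodule.sum_mem _ fun J _ => Submodule.smul_mem _ _ ?_
  convert revWord_Ω_mul_mem_normal I (word_hγ_mul_mem_normal J hx) using 1
  ring_nf

theorem vac_mem_normal {n l : ℕ} {z : ℤ} {x : B.Heis} (hx : x ∈ B.normal hS n z) (hl : l < n)
    (a : A) (K : Fin l → ι) : B.vac (x * (B.hA a * word B.hω K)) = 0 := by
  refine (Submodule.span_le (p := LinearMap.ker (B.vac ∘ₗ
    LinearMap.mulRight k (B.hA a * word B.hω K)))).mpr ?_ hx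
  rintro _ ⟨m, l', I, u, J, hn, -, rfl⟩
  change B.vac (revWord (B.Ω hS) I * B.hU u * word B.hγ J * (B.hA a * word B.hω K)) = 0
  rw [mul_assoc _ (word B.hγ J), ← mul_assoc (word B.hγ J), word_hγ_hA, mul_assoc (B.hA a),
    ← mul_assoc _ (B.hA a), vac_word_hγ_word_hω_of_lt _ _ (by omega)]

/-- Splits off the leading part, with exactly `n` letters `γ`. Homogeneity fixes the number of `Ω`s
in it as `z + n`; if this is negative there are no such terms, so the truncation is harmless. -/
theorem exists_of_mem_normal {n : ℕ} {z : ℤ} {x : B.Heis} (hx : x ∈ B.normal hS n z) :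
    ∃ y : (Fin n → ι) → B.Heis, (∀ J, y J ∈ B.formU (z + n).toNat) ∧
      x - ∑ J, y J * word B.hγ J ∈ B.normal hS (n + 1) z := by
  induction hx using Submodule.span_induction with
  | mem x hx =>
    obtain ⟨m, l, I, u, J, hn, hz, rfl⟩ := hx
    rcases hn.eq_or_lt with h | h
    · subst h
      refine ⟨Pi.single J (revWord (B.Ω hS) I * B.hU u), fun K => ?_, ?_⟩
      · have hm : (z + n).toNat = m := by omega
        by_cases hK : K = J
        · subst hK
          rw [Pi.single_eq_same, hm]
          exact revWord_Ω_mul_hU_mem I u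
        · rw [Pi.single_eq_of_ne hK]
          exact Submodule.zero_mem _
      · rw [Finset.sum_eq_single J (fun K _ hK => by rw [Pi.single_eq_of_ne hK, zero_mul])
          (by simp), Pi.single_eq_same, sub_self]
        exact Submodule.zero_mem _
    · refine ⟨0, fun K => Submodule.zero_mem _, ?_⟩
      simpa using mem_normal I u J h hz
  | zero => exact ⟨0, fun K => Submodule.zero_mem _, by simp⟩
  | add x x' _ _ hx hx' =>
    obtain ⟨y, h1, h2⟩ := hx
    obtain ⟨y', h1', h2'⟩ := hx'
    refine ⟨y + y', fun K => Submodule.add_mem _ (h1 K) (h1' K), ?_⟩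
    convert Submodule.add_mem _ h2 h2' using 1
    simp only [Pi.add_apply, add_mul, Finset.sum_add_distrib]
    abel
  | smul c x _ hx =>
    obtain ⟨y, h1, h2⟩ := hx
    refine ⟨c • y, fun K => Submodule.smul_mem _ _ (h1 K), ?_⟩
    convert Submodule.smul_mem _ c h2 using 1
    simp only [Pi.smul_apply, smul_mul_assoc, ← Finset.smul_sum, smul_sub]

/-- The vacuum representation is faithful on homogeneous elements which are invariant under the
left coaction. -/
theorem eq_zero_of_mem_normal {h : ℕ} (hh : IsHeight B.σ h) {z : ℤ} {x : B.Heis}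
    (hx : x ∈ B.normal hS 0 z)
    (hv : ∀ (n : ℕ) (a : A) (K : Fin n → ι), B.vac (x * (B.hA a * word B.hω K)) = 0) : x = 0 := by
  have hn : ∀ n, x ∈ B.normal hS n z := by
    intro n
    induction n with
    | zero => exact hx
    | succ n ih =>
      obtain ⟨y, h1, h2⟩ := exists_of_mem_normal ih
      have h3 : ∑ J, y J * word B.hγ J = 0 := by
        -- Tested on `a ω^K |0⟩` with `|K| = n`, terms with more than `n` letters `γ` vanish, and
        -- the leading part gives its coefficients contracted with the antisymmetrizer.
        refine (B.colKer_word_hγ n).sum_mul_eq_zero fun K => ?_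
        refine eq_zero_of_mem_formU hS
          (Submodule.sum_mem _ fun J _ => Submodule.smul_mem _ _ (h1 J)) fun a => ?_
        have h4 := vac_mem_normal h2 (Nat.lt_succ_self n) a K
        rw [sub_mul, map_sub, hv, zero_sub, neg_eq_zero] at h4
        have h5 := congrArg (fun v => sgn k n • v) h4
        simp only [Finset.sum_mul, mul_assoc _ (word B.hγ _), ← mul_assoc (word B.hγ _) (B.hA a),
          word_hγ_hA] at h5
        simp only [mul_assoc (B.hA a), ← mul_assoc _ (B.hA a), map_sum, vac_word_hγ_word_hω,
          Finset.smul_sum, smul_smul, smul_zero, ← mul_assoc (sgn k n), sgn_mul_self, one_mul] at h5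
        rw [Finset.sum_mul, map_sum, ← h5]
        simp only [smul_mul_assoc, map_smul]
      rwa [h3, sub_zero] at h2
  -- Above the height the antisymmetrizer is zero, so every single word in the `γ`s is a relation.
  have h1 : B.normal hS (h + 1) z = ⊥ := by
    refine Submodule.span_eq_bot.mpr ?_
    rintro _ ⟨m, l, I, u, J, hl, -, rfl⟩
    have h2 : ∑ K, (Pi.single J 1 : (Fin l → ι) → k) K • word B.hγ K = 0 :=
      B.colKer_word_hγ l _ (by rw [hh.2 l (by omega), Matrix.vecMul_zero])
    have h3 : word B.hγ J = 0 := by simpa [Pi.single_apply, ite_smul] using h2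
    rw [h3, mul_zero]
  simpa [h1] using hn (h + 1)

end BicovariantBimodule

namespace BicovariantCalculus

open BicovariantBimodule

variable {B : BicovariantCalculus P ι} {d : B.Ext →ₗ[k] B.Ext}
  {hS : Function.Bijective (HopfAlgebra.antipode k (A := U))}
  {X : (r : ℕ) → Matrix (Fin (r + 1) → ι) (Fin r → ι) k}

theorem generates_Q (hd : B.IsDifferential d) {h : ℕ} (hh : IsHeight B.σ h)
    (hX : B.IsBRSTTensor X) : B.Generates d (B.Q hS h X) := by
  have hQω : ∀ t, B.Q hS h X * B.hω t + B.hω t * B.Q hS h X = B.form (d (B.extω t)) := by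
    intro t
    -- Extending the sum beyond the height changes nothing, and the leftover then sits behind a
    -- vanishing antisymmetrizer.
    rw [B.Q_eq_of_le hS hh (h + 1) (by omega),
      B.Q_anticomm_hω hS hd (hX.upTo B (h + 1)) t, tensorEltF_eq_zero, add_zero]
    rw [hh.2 (h + 1 + 2) (by omega), Matrix.zero_mul, Matrix.zero_mul]
  have hQA : ∀ a, B.Q hS h X * B.hA a = B.hA a * B.Q hS h X + B.form (d (B.extA a)) := by
    intro a
    rw [B.Q_eq_of_le hS hh h (by omega), B.Q_mul_hA hS hd]
  have hw : ∀ {n : ℕ} (K : Fin n → ι), B.form (d (word B.extω K)) =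
      B.Q hS h X * word B.hω K - (-1 : k) ^ n • (word B.hω K * B.Q hS h X) := by
    intro n K
    induction n with
    | zero => simp [word_zero, B.d_one hd]
    | succ n ih =>
      obtain ⟨t, K, rfl⟩ := exists_cons K
      rw [B.form_d_word_cons hd, ih, ← hQω, word_cons, mul_sub, add_mul, pow_succ, mul_smul_comm,
        mul_neg_one, neg_smul]
      simp only [mul_assoc]
      abel
  intro n η hη
  refine (Submodule.span_le (p := LinearMap.eqLocus (B.form.toLinearMap ∘ₗ d)
    ((LinearMap.mulLeft k (B.Q hS h X) - (-1 : k) ^ n • LinearMap.mulRight k (B.Q hS h X)) ∘ₗ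
      B.form.toLinearMap))).mpr ?_ hη
  rintro _ ⟨⟨a, K⟩, rfl⟩
  change B.form (d (B.extA a * word B.extω K)) = B.Q hS h X * B.form (B.extA a * word B.extω K) -
    (-1 : k) ^ n • (B.form (B.extA a * word B.extω K) * B.Q hS h X)
  have e : B.form (B.extA a * word B.extω K) = B.hA a * word B.hω K := by
    rw [map_mul, map_word]
    rfl
  have e1 : B.form (B.extA a) = B.hA a := rfl
  have e2 : B.form (word B.extω K) = word B.hω K := map_word _ _ _
  rw [hd.leibniz 0 _ (B.extA_mem a), pow_zero, one_smul, e, map_add, map_mul, map_mul, hw, e1, e2,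
    ← mul_assoc, hQA, mul_sub, add_mul, mul_smul_comm]
  simp only [mul_assoc]
  abel

theorem Q_mul_mem_normal (X : (r : ℕ) → Matrix (Fin (r + 1) → ι) (Fin r → ι) k) {z : ℤ}
    {x : B.Heis} (hx : x ∈ B.normal hS 0 z) (h : ℕ) :
    B.Q hS h X * x ∈ B.normal hS 0 (z + 1) := by
  rw [Q, add_mul, Finset.sum_mul, Finset.sum_mul]
  refine Submodule.add_mem _ (Submodule.sum_mem _ fun i _ => ?_)
    (Submodule.sum_mem _ fun r _ => ?_)
  · rw [mul_assoc]
    exact Ω_mul_mem_normal i (hU_mul_mem_normal _ hx)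
  · rw [Qr_eq]
    convert tensorElt_mul_mem_normal (X r) hx using 1
    push_cast
    ring_nf

/-- `Q` annihilates the vacuum, so on `η |0⟩` it acts as `d`, and `Q²` as `d² = 0`. Since `Q²` is
normal ordered and homogeneous, it is determined by this action. -/
theorem Q_mul_Q (hd : B.IsDifferential d) {h : ℕ} (hh : IsHeight B.σ h)
    (hX : B.IsBRSTTensor X) : B.Q hS h X * B.Q hS h X = 0 := by
  have h1 : (1 : B.Heis) ∈ B.normal hS 0 0 := by
    simpa [revWord_zero, word_zero, hU_one] using
      mem_normal (B := B.toBicovariantBimodule) (hS := hS) (n := 0) (z := 0)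
        Fin.elim0 1 Fin.elim0 le_rfl (by simp)
  have h2 := Q_mul_mem_normal X (Q_mul_mem_normal X h1 h) h
  rw [mul_one] at h2
  refine eq_zero_of_mem_normal hh h2 fun n a K => ?_
  have hη := B.mem_extDeg a K
  have e : B.form (B.extA a * word B.extω K) = B.hA a * word B.hω K := by
    rw [map_mul, map_word]
    rfl
  have hg := generates_Q (hS := hS) hd hh hX
  rw [← e, mul_assoc, B.vac_congr (B.vac_Q_mul_form hS hd hh hg hη),
    B.vac_Q_mul_form hS hd hh hg (hd.map_deg _ _ hη), hd.sq_zero, map_zero, map_zero]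

end BicovariantCalculus
end Square

/-! ### Degree and bi-invariance of the BRST operator -/

section Invariance

variable {k : Type*} [Field k] {A : Type*} [Ring A] [HopfAlgebra k A]
  {U : Type*} [Ring U] [HopfAlgebra k U] {P : HopfDuality k A U}
  {ι : Type*} [Fintype ι] [DecidableEq ι]

namespace BicovariantBimodule

/-- `S⁻¹(u₍₂₎) u₍₁₎ = ε(u)`. -/
theorem mul'_sinv_comul (hS : Function.Bijective (HopfAlgebra.antipode k (A := U))) (u : U) :
    LinearMap.mul' k U ((sinv hS).rTensor U (TensorProduct.comm k U U (Coalgebra.comul u))) =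
      algebraMap k U (Coalgebra.counit u) := by
  refine hS.1 ?_
  have h : ∀ t : U ⊗[k] U, HopfAlgebra.antipode k
      (LinearMap.mul' k U ((sinv hS).rTensor U (TensorProduct.comm k U U t))) =
        LinearMap.mul' k U ((HopfAlgebra.antipode k).rTensor U t) := by
    intro t
    induction t with
    | zero => simp
    | add s t hs ht => simp only [map_add, hs, ht]
    | tmul x y =>
      simp only [TensorProduct.comm_tmul, LinearMap.rTensor_tmul, LinearMap.mul'_apply,
        HopfAlgebra.antipode_mul_antidistrib, antipode_sinv]
  rw [h, HopfAlgebra.mul_antipode_rTensor_comul_apply, Algebra.algebraMap_eq_smul_one, map_smul,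
    HopfAlgebra.antipode_one]

variable (B : BicovariantBimodule P ι)
  (hS : Function.Bijective (HopfAlgebra.antipode k (A := U)))

/-- `u₍₁₎ ⟨S⁻¹(u₍₂₎), rʲᵢ⟩`. -/
def actInv (j i : ι) (u : U) : U :=
  TensorProduct.rid k U (((P.pair.flip (B.r j i)) ∘ₗ sinv hS).lTensor U (Coalgebra.comul u))

/-- The sum over `j` is the coproduct of `r`; by coassociativity it leaves `u₍₁₎ ⟨S⁻¹(u₍₃₎) u₍₂₎,
rˡᵢ⟩`, which collapses. The rule for `γ u` is thereby inverted, so that elements of `U` can be moved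
to the right of the `γ`s, as the grading requires. -/
theorem sum_dualLact_actInv (l i : ι) (u : U) :
    ∑ j, P.dualLact (B.r l j) (B.actInv hS j i u) = if l = i then u else 0 := by
  let ρ : ι → U →ₗ[k] U := fun j => (TensorProduct.rid k U).toLinearMap ∘ₗ
    ((P.pair.flip (B.r j i)) ∘ₗ sinv hS).lTensor U ∘ₗ Coalgebra.comul
  have h1 : ∑ j, P.pair.flip (B.r l j) ∘ₗ ρ j = (if l = i then 1 else 0 : k) • Coalgebra.counit := by
    ext v
    have h2 : ∀ t : U ⊗[k] U, ∑ j, P.pair (TensorProduct.rid k U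
        (((P.pair.flip (B.r j i)) ∘ₗ sinv hS).lTensor U t)) (B.r l j) =
        P.pair (LinearMap.mul' k U ((sinv hS).rTensor U (TensorProduct.comm k U U t)))
          (B.r l i) := by
      intro t
      induction t with
      | zero => simp
      | add s t hs ht =>
        simp only [map_add, LinearMap.add_apply, Finset.sum_add_distrib, hs, ht]
      | tmul x y =>
        simp only [TensorProduct.comm_tmul, LinearMap.rTensor_tmul, LinearMap.mul'_apply,
          P.mul_left, B.comul_r]
        simp
    have h3 := h2 (Coalgebra.comul v)
    rw [mul'_sinv_comul, Algebra.algebraMap_eq_smul_one, map_smul, LinearMap.smul_apply,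
      P.one_left, B.counit_r] at h3
    simp only [LinearMap.sum_apply]
    refine h3.trans ?_
    rw [LinearMap.smul_apply, smul_eq_mul, smul_eq_mul, mul_comm]
  have h2 : ∀ j, P.dualLact (B.r l j) (B.actInv hS j i u) =
      TensorProduct.rid k U ((P.pair.flip (B.r l j) ∘ₗ ρ j).lTensor U (Coalgebra.comul u)) := by
    intro j
    rw [HopfDuality.dualLact, actInv, Coalgebra.comul_rid_lTensor]
    exact congrArg _ (LinearMap.lTensor_comp_apply U (P.pair.flip (B.r l j)) (ρ j) _).symm
  have h3 := map_sum (LinearMap.lTensorHom (R := k) U) (fun j => P.pair.flip (B.r l j) ∘ₗ ρ j)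
    Finset.univ
  simp only [LinearMap.coe_lTensorHom] at h3
  simp only [h2]
  rw [← map_sum, ← LinearMap.sum_apply, ← h3, h1, LinearMap.lTensor_smul,
    LinearMap.smul_apply, Coalgebra.lTensor_counit_comul]
  split_ifs <;> simp

theorem hU_mul_hγ (u : U) (i : ι) :
    B.hU u * B.hγ i = ∑ j, B.hγ j * B.hU (B.actInv hS j i u) := by
  simp only [hγ_hU]
  rw [Finset.sum_comm]
  simp only [← Finset.sum_mul, ← hU_sum, sum_dualLact_actInv]
  rw [Finset.sum_eq_single i (fun l _ hl => by simp [hl, hU_zero]) (by simp), if_pos rfl]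

theorem hU_mul_word_hγ (hS : Function.Bijective (HopfAlgebra.antipode k (A := U))) (u : U) {n : ℕ}
    (J : Fin n → ι) :
    ∃ w : (Fin n → ι) → U, B.hU u * word B.hγ J = ∑ K, word B.hγ K * B.hU (w K) := by
  induction n generalizing u with
  | zero => exact ⟨fun _ => u, by simp [sum_fin_zero, word_zero]⟩
  | succ n ih =>
    obtain ⟨i, J, rfl⟩ := exists_cons J
    choose w hw using fun j => ih (B.actInv hS j i u) J
    refine ⟨fun K => w (K 0) (Fin.tail K), ?_⟩
    rw [word_cons, ← mul_assoc, hU_mul_hγ B hS, Finset.sum_mul, sum_cons]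
    refine Finset.sum_congr rfl fun j _ => ?_
    rw [mul_assoc, hw, Finset.mul_sum]
    simp only [word_cons, Fin.cons_zero, Fin.tail_cons, mul_assoc]

/-- The span of the elements `ωᴵ γᴶ u` of degree `z`. -/
def invDeg (z : ℤ) : Submodule k B.Heis :=
  Submodule.span k {y | ∃ (m n : ℕ) (I : Fin m → ι) (J : Fin n → ι) (u : U),
    (m : ℤ) - n = z ∧ y = word B.hω I * word B.hγ J * B.hU u}

theorem invDeg_le_heisDeg (z : ℤ) : B.invDeg z ≤ B.heisDeg z := by
  refine Submodule.span_le.mpr ?_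
  rintro _ ⟨m, n, I, J, u, h, rfl⟩
  exact Submodule.subset_span ⟨m, n, 1, I, J, u, h, by rw [hA_one, one_mul]⟩

variable {B}

theorem mem_invDeg {z : ℤ} {m n : ℕ} (I : Fin m → ι) (J : Fin n → ι) (u : U)
    (h : (m : ℤ) - n = z) : word B.hω I * word B.hγ J * B.hU u ∈ B.invDeg z :=
  Submodule.subset_span ⟨m, n, I, J, u, h, rfl⟩

theorem hω_mul_mem_invDeg {z : ℤ} (i : ι) {x : B.Heis} (hx : x ∈ B.invDeg z) :
    B.hω i * x ∈ B.invDeg (z + 1) := by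
  refine mul_mem_of_span _ ?_ hx
  rintro _ ⟨m, n, I, J, u, h, rfl⟩
  rw [← mul_assoc, ← mul_assoc, ← word_cons]
  exact mem_invDeg _ _ _ (by push_cast; omega)

theorem hU_mul_mem_invDeg (hS : Function.Bijective (HopfAlgebra.antipode k (A := U))) {z : ℤ}
    (v : U) {x : B.Heis} (hx : x ∈ B.invDeg z) : B.hU v * x ∈ B.invDeg z := by
  refine mul_mem_of_span _ ?_ hx
  rintro _ ⟨m, n, I, J, u, h, rfl⟩
  rw [← mul_assoc, ← mul_assoc, hU_mul_word_hω, Finset.sum_mul, Finset.sum_mul]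
  refine Submodule.sum_mem _ fun K _ => ?_
  obtain ⟨w, hw⟩ := B.hU_mul_word_hγ hS (P.dualRact v (gword B.rT m K I)) J
  rw [mul_assoc (word _ _), hw, Finset.mul_sum, Finset.sum_mul]
  refine Submodule.sum_mem _ fun L _ => ?_
  rw [← mul_assoc, mul_assoc, ← hU_mul]
  exact mem_invDeg _ _ _ h

variable {hS}

theorem Ω_mul_mem_invDeg {z : ℤ} (i : ι) {x : B.Heis} (hx : x ∈ B.invDeg z) :
    B.Ω hS i * x ∈ B.invDeg (z + 1) := by
  rw [Ω_eq, Finset.sum_mul]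
  refine Submodule.sum_mem _ fun j _ => ?_
  rw [mul_assoc]
  exact hω_mul_mem_invDeg _ (hU_mul_mem_invDeg hS _ hx)

theorem revWord_Ω_mul_mem_invDeg {z : ℤ} {m : ℕ} (I : Fin m → ι) {x : B.Heis}
    (hx : x ∈ B.invDeg z) : revWord (B.Ω hS) I * x ∈ B.invDeg (z + m) := by
  induction m with
  | zero => simpa [revWord_zero] using hx
  | succ m ih =>
    obtain ⟨I, i, rfl⟩ := exists_snoc I
    rw [revWord_snoc, mul_assoc]
    convert Ω_mul_mem_invDeg i (ih I) using 1
    push_cast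
    ring_nf

theorem tensorElt_mem_invDeg {m n : ℕ} (X : Matrix (Fin m → ι) (Fin n → ι) k) :
    B.tensorElt hS X ∈ B.invDeg (m - n) := by
  refine Submodule.sum_mem _ fun I _ => Submodule.sum_mem _ fun J _ => Submodule.smul_mem _ _ ?_
  have h := mem_invDeg (B := B) (z := -n) Fin.elim0 J 1 (by simp)
  rw [word_zero, one_mul, hU_one, mul_one] at h
  convert revWord_Ω_mul_mem_invDeg I h using 1
  ring_nf

theorem leftCoaction_hω (i : ι) : B.leftCoaction (B.hω i) = (1 : A) ⊗ₜ[k] B.hω i := by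
  rw [← heisLeftGen_ω]
  exact RingQuot.liftAlgHom_mkAlgHom_apply k _ _ _

theorem leftCoaction_dual (y : B.DualExt) : B.leftCoaction (B.dual y) = (1 : A) ⊗ₜ[k] B.dual y := by
  rw [← heisLeftGen_R]
  exact RingQuot.liftAlgHom_mkAlgHom_apply k _ _ _

variable (B) in
/-- The left-invariant elements of the Heisenberg double. -/
def leftInvariants : Subalgebra k B.Heis :=
  AlgHom.equalizer B.leftCoaction Algebra.TensorProduct.includeRight

theorem mem_leftInvariants {z : B.Heis} :
    z ∈ B.leftInvariants ↔ B.leftCoaction z = (1 : A) ⊗ₜ[k] z := Iff.rfl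

theorem Ω_mem_leftInvariants (i : ι) : B.Ω hS i ∈ B.leftInvariants :=
  Subalgebra.sum_mem _ fun _ _ => Subalgebra.mul_mem _
    (mem_leftInvariants.mpr (leftCoaction_hω _)) (mem_leftInvariants.mpr (leftCoaction_dual _))

theorem tensorElt_mem_leftInvariants {m n : ℕ} (X : Matrix (Fin m → ι) (Fin n → ι) k) :
    B.tensorElt hS X ∈ B.leftInvariants := by
  refine Subalgebra.sum_mem _ fun I _ => Subalgebra.sum_mem _ fun J _ =>
    Subalgebra.smul_mem _ (Subalgebra.mul_mem _ (list_prod_mem ?_) (list_prod_mem ?_)) _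
  · simp only [List.mem_reverse, List.mem_ofFn]
    rintro _ ⟨p, rfl⟩
    exact Ω_mem_leftInvariants _
  · simp only [List.mem_ofFn]
    rintro _ ⟨p, rfl⟩
    exact mem_leftInvariants.mpr (leftCoaction_dual _)

/-- `x₍₁₎ z S(x₍₂₎) = z x₍₁₎ S(x₍₂₎) = ε(x) z`. -/
theorem adjoint_eq_of_commute {z : B.Heis} (hz : ∀ u, B.hU u * z = z * B.hU u) (u : U) :
    B.adjoint u z = Coalgebra.counit (R := k) u • z := by
  have h : ∀ t : U ⊗[k] U, LinearMap.mul' k B.Heis (TensorProduct.map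
      ((LinearMap.mulRight k z) ∘ₗ B.dual.toLinearMap ∘ₗ B.dualU.toLinearMap)
      (B.dual.toLinearMap ∘ₗ B.dualU.toLinearMap ∘ₗ HopfAlgebra.antipode k) t) =
      z * B.hU (LinearMap.mul' k U ((HopfAlgebra.antipode k).lTensor U t)) := by
    intro t
    induction t with
    | zero => simp [hU_zero]
    | add s t hs ht => simp only [map_add, hU_add, mul_add, hs, ht]
    | tmul x y =>
      change B.hU x * z * B.hU _ = _
      rw [hz, mul_assoc, ← hU_mul]
      rfl
  rw [adjoint, h, HopfAlgebra.mul_antipode_lTensor_comul_apply, Algebra.algebraMap_eq_smul_one,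
    hU_smul, hU_one, mul_smul_comm, mul_one]

end BicovariantBimodule

namespace BicovariantCalculus

open BicovariantBimodule

variable {B : BicovariantCalculus P ι} {d : B.Ext →ₗ[k] B.Ext}
  {hS : Function.Bijective (HopfAlgebra.antipode k (A := U))}
  {X : (r : ℕ) → Matrix (Fin (r + 1) → ι) (Fin r → ι) k}

theorem Q_mem_heisDeg (h : ℕ) (X : (r : ℕ) → Matrix (Fin (r + 1) → ι) (Fin r → ι) k) :
    B.Q hS h X ∈ B.heisDeg 1 := by
  refine B.invDeg_le_heisDeg 1 ?_
  rw [Q]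
  refine Submodule.add_mem _ (Submodule.sum_mem _ fun i _ => ?_)
    (Submodule.sum_mem _ fun r _ => ?_)
  · have h1 := mem_invDeg (B := B.toBicovariantBimodule) (z := 0) Fin.elim0 Fin.elim0 (B.χ i)
      (by simp)
    rw [word_zero, word_zero, one_mul, one_mul] at h1
    have h2 := Ω_mul_mem_invDeg (hS := hS) i h1
    rwa [zero_add] at h2
  · rw [Qr_eq]
    convert tensorElt_mem_invDeg (B := B.toBicovariantBimodule) (hS := hS) (X r) using 1
    push_cast
    ring_nf

theorem isBiinvariant_Q {h : ℕ} (hh : IsHeight B.σ h) (hX : B.IsBRSTTensor X) :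
    B.IsBiinvariant (B.Q hS h X) := by
  refine ⟨mem_leftInvariants.mp (Subalgebra.add_mem _ (Subalgebra.sum_mem _ fun i _ =>
    Subalgebra.mul_mem _ (Ω_mem_leftInvariants i) (mem_leftInvariants.mpr (leftCoaction_dual _)))
    (Subalgebra.sum_mem _ fun r _ => tensorElt_mem_leftInvariants _)),
    adjoint_eq_of_commute fun u => ?_⟩
  rw [B.Q_eq_of_le hS hh h (by omega), B.hU_mul_Q hS hX]

theorem isBRSTOperator_Q (hd : B.IsDifferential d) {h : ℕ} (hh : IsHeight B.σ h)
    (hX : B.IsBRSTTensor X) : B.IsBRSTOperator d (B.Q hS h X) where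
  biinvariant := isBiinvariant_Q hh hX
  mem_deg := Q_mem_heisDeg h X
  generates := generates_Q hd hh hX
  mul_self := Q_mul_Q hd hh hX

end BicovariantCalculus
end Invariance

end QuantumBRST

end

theorem mainTheorem1 {k : Type*} [Field k]
    {A : Type*} [Ring A] [HopfAlgebra k A] {U : Type*} [Ring U] [HopfAlgebra k U]
    (P : QuantumBRST.HopfDuality k A U)
    (hS : Function.Bijective (HopfAlgebra.antipode k (A := U)))
    {ι : Type*} [Fintype ι] [DecidableEq ι] (B : QuantumBRST.BicovariantCalculus P ι)
    (h : ℕ) (hh : QuantumBRST.IsHeight B.σ h)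
    (d : B.Ext →ₗ[k] B.Ext) (hd : B.IsDifferential d) :
    (∃ X, B.IsBRSTTensor X) ∧
    (∀ X X', B.IsBRSTTensor X → B.IsBRSTTensor X' → ∀ r, 1 ≤ r → B.Qr hS X r = B.Qr hS X' r) ∧
    (∀ X, B.IsBRSTTensor X → B.IsBRSTOperator d (B.Q hS h X)) ∧
    (∀ X, B.Generates d (B.Q hS h X) → B.IsBRSTTensor X) := 
  ⟨B.exists_isBRSTTensor hS hd hh,
    fun _ _ hX hX' r hr => B.Qr_unique hS hX hX' r hr,
    fun _ hX => QuantumBRST.BicovariantCalculus.isBRSTOperator_Q hd hh hX,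
    fun _ hQ => B.isBRSTTensor_of_generates hS hd hh hQ⟩
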